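/- **Theorem (twisted $L_\infty$-algebra).** Let $\mathbb K$ be a field of characteristic $0$, $A$ an associative $\mathbb K$-algebra (not necessarily unital) with multiplication $\mu$, $M$ an $A$-bimodule with left and right actions $l(a,u)=a\cdot u$ and $r(u,a)=u\cdot a$, and $H:A\otimes A\to M$ a Hochschild $2$-cocycle, i.e. $a\cdot H(b,c)-H(ab,c)+H(a,bc)-H(a,b)\cdot c=0$. A linear map $T:M\to A$ is an $H$-twisted Rota–Baxter operator if $$T(u)T(v)=T\big(u\cdot T(v)+T(u)\cdot v+H(Tu,Tv)\big)\qquad (u,v\in M).$$ Let $L=\bigoplus_{n\ge 0}\mathrm{Hom}(M^{\otimes n},A)$, where $\mathrm{Hom}(M^{\otimes n},A)$ has degree $n$. For multilinear maps $f,g$ of arities $m,n$ put $$f\circ g=\sum_{i=1}^{m}(-1)^{(i-1)(n-1)}f\circ_i g,\qquad (f\circ_i g)(x_1,\dots,x_{m+n-1})=f\big(x_1,\dots,x_{i-1},g(x_i,\dots,x_{i+n-1}),x_{i+n},\dots,x_{m+n-1}\big),$$ and for multilinear maps from a vector space to itself let $[f,g]_{\mathsf G}=f\circ g-(-1)^{(m-1)(n-1)}g\circ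 f$ be the Gerstenhaber bracket. For $P,Q,R\in L$ of arities $p,q,r$, set $$\llbracket P,Q\rrbracket=(-1)^p\,[[\mu+l+r,P]_{\mathsf G},Q]_{\mathsf G}$$ (Gerstenhaber bracket on the vector space $A\oplus M$, with $P$ and $Q$ viewed as maps on $A\oplus M$ through the projection to $M$ and the inclusion of $A$). Let $H(Q,R)\in\mathrm{Hom}(M^{\otimes(q+r)},M)$ be the map $(u_1,\dots,u_{q+r})\mapsto H\big(Q(u_1,\dots,u_q),R(u_{q+1},\dots,u_{q+r})\big)$, put $\langle P;Q,R\rangle=-(-1)^{p+qr}\,P\circ H(Q,R)$, and set $$\llbracket P,Q,R\rrbracket=\langle P;Q,R\rangle-(-1)^{qr}\langle P;R,Q\rangle-(-1)^{pq}\langle Q;P,R\rangle+(-1)^{p(q+r)}\langle Q;R,P\rangle-(-1)^{pq+qr+rp}\langle R;Q,P\rangle+(-1)^{(p+q)r}\langle R;P,Q\rangle .$$ Both brackets are extended multilinearly to $L$. An $L_\infty$-algebra is a $\mathbb Z$-graded vector space with graded skew-symmetric multilinear maps $l_k$ ($k\ge1$) of degree $2-k$ such that, for all $n\ge1$ and homogeneous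 $x_1,\dots,x_n$, $$\sum_{i+j=n+1}\ \sum_{\sigma}(-1)^{\sigma}\epsilon(\sigma)(-1)^{i(j-1)}\,l_j\big(l_i(x_{\sigma(1)},\dots,x_{\sigma(i)}),x_{\sigma(i+1)},\dots,x_{\sigma(n)}\big)=0,$$ where $i,j\ge 1$, $\sigma$ runs over the $(i,n-i)$-unshuffles and $\epsilon(\sigma)$ is the Koszul sign. An element $\alpha$ of degree $1$ is a Maurer–Cartan element if $l_1(\alpha)+\frac1{2!}l_2(\alpha,\alpha)-\frac1{3!}l_3(\alpha,\alpha,\alpha)-\cdots=0$, the sign of the $k$-th term being $-(-1)^{k(k+1)/2}$. Let $T$ be an $H$-twisted Rota–Baxter operator. Then the graded vector space $L$ carries an $L_\infty$-algebra structure (the twisted $L_\infty$-algebra) with structure maps $$l_1(P)=d_T(P):=\llbracket T,P\rrbracket-\tfrac12\llbracket T,T,P\rrbracket,\qquad l_2(P,Q)=\llbracket P,Q\rrbracket-\llbracket T,P,Q\rrbracket,\qquad l_3(P,Q,R)=\llbracket P,Q,R\rrbracket,$$ and $l_k=0$ for $k\ge4$. Moreover, for every linear map $T':M\to A$, the sum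 $T+T'$ is an $H$-twisted Rota–Baxter operator if and only if $T'$ is a Maurer–Cartan element of this twisted $L_\infty$-algebra. -/

import Mathlib

open scoped DirectSum

noncomputable section

namespace TwistedRB

/-! ### `L_∞`-algebras -/

/-- The Koszul sign `ε(σ)` of a permutation of homogeneous elements of degrees `d 0, d 1, …`:
`x_0 ⊙ ⋯ ⊙ x_(n-1) = ε(σ) x_(σ 0) ⊙ ⋯ ⊙ x_(σ (n-1))` in the free graded commutative algebra. -/
def koszulSign {n : ℕ} (d : Fin n → ℤ) (σ : Equiv.Perm (Fin n)) : ℤˣ :=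
  ∏ q : Fin n × Fin n, if q.1 < q.2 ∧ σ q.2 < σ q.1 then (d (σ q.1) * d (σ q.2)).negOnePow else 1

/-- `σ` is an `(i, n - i)`-unshuffle: it is increasing on the first `i` positions and on the
remaining ones. -/
def IsUnshuffle {n : ℕ} (i : ℕ) (σ : Equiv.Perm (Fin n)) : Prop :=
  ∀ a b : Fin n, a < b → (b.val < i ∨ i ≤ a.val) → σ a < σ b

open scoped Classical in
/-- An `L_∞`-algebra structure on the graded vector space `L = ⨁ i : ℤ, 𝒜 i`.
The operations are `l 1, l 2, …`; there is no operation with zero inputs (`l 0 = 0`). -/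
structure LInfinityAlgebra (K : Type*) [Field K] {L : Type*} [AddCommGroup L] [Module K L]
    (𝒜 : ℤ → Submodule K L) where
  /-- `L` is the direct sum of the `𝒜 i`. -/
  isInternal : DirectSum.IsInternal 𝒜
  /-- The structure maps. -/
  l : (k : ℕ) → MultilinearMap K (fun _ : Fin k => L) L
  l_zero : l 0 = 0
  /-- `l k` has degree `2 - k`. -/
  degree : ∀ (k : ℕ) (d : Fin k → ℤ) (x : Fin k → L), (∀ a, x a ∈ 𝒜 (d a)) →
    l k x ∈ 𝒜 (∑ a, d a + (2 - (k : ℤ)))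
  /-- `l k` is graded skew-symmetric. -/
  skew : ∀ (k : ℕ) (d : Fin k → ℤ) (x : Fin k → L), (∀ a, x a ∈ 𝒜 (d a)) →
    ∀ σ : Equiv.Perm (Fin k),
      l k (fun a => x (σ a)) = (Equiv.Perm.sign σ * koszulSign d σ) • l k x
  /-- The higher Jacobi identities: the sum over `i + j = n + 1`, `i, j ≥ 1`, and over all
  `(i, n - i)`-unshuffles `σ` of `(-1)^σ ε(σ) (-1)^(i (j - 1))` times
  `l_j (l_i (x_(σ 1), …, x_(σ i)), x_(σ (i+1)), …, x_(σ n))` vanishes.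
  Here `i = i' + 1` with `i' : Fin n`, so that `j = (n - (i' + 1)) + 1`. -/
  jacobi : ∀ (n : ℕ), 1 ≤ n → ∀ (d : Fin n → ℤ) (x : Fin n → L), (∀ a, x a ∈ 𝒜 (d a)) →
    ∑ i' : Fin n, ∑ σ : Equiv.Perm (Fin n) with IsUnshuffle (i'.val + 1) σ,
      (Equiv.Perm.sign σ * koszulSign d σ * (-1) ^ ((i'.val + 1) * (n - (i'.val + 1)))) •
        l ((n - (i'.val + 1)) + 1)
          (Fin.cons (l (i'.val + 1) (fun a => x (σ ⟨a.val, by omega⟩)))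
            (fun b : Fin (n - (i'.val + 1)) => x (σ ⟨i'.val + 1 + b.val, by omega⟩))) = 0

/-- `α` is a Maurer-Cartan element: `α` has degree `1` and
`l_1(α) + (1/2!) l_2(α,α) - (1/3!) l_3(α,α,α) - (1/4!) l_4(α,α,α,α) + ⋯ = 0`,
the sign of the `k`-th term being `-(-1)^(k(k+1)/2)` (the sum is required to be finite). -/
def LInfinityAlgebra.IsMaurerCartan {K : Type*} [Field K] {L : Type*} [AddCommGroup L]
    [Module K L] {𝒜 : ℤ → Submodule K L} (𝓛 : LInfinityAlgebra K 𝒜) (α : L) : Prop :=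
  α ∈ 𝒜 1 ∧ {k : ℕ | 𝓛.l k (fun _ => α) ≠ 0}.Finite ∧
    ∑ᶠ k : ℕ, (-(-1 : K) ^ (k * (k + 1) / 2) * ((k.factorial : K))⁻¹) • 𝓛.l k (fun _ => α) = 0

/-! ### Multilinear maps, partial compositions and the Gerstenhaber bracket -/

/-- The inputs of `f` in `f ∘_i g`. -/
def insertArgs {V : Type*} {m n : ℕ} (i : Fin m) (g : (Fin n → V) → V) (x : Fin (m + n - 1) → V)
    (j : Fin m) : V :=
  if hj : j.val < i.val then x ⟨j.val, by omega⟩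
  else if h : j.val = i.val then g (fun k => x ⟨i.val + k.val, by omega⟩)
  else x ⟨j.val + n - 1, by omega⟩

theorem insertArgs_update {V : Type*} {m n : ℕ} (i : Fin m) (x : Fin (m + n - 1) → V)
    (t : Fin (m + n - 1)) :
    (∃ k : Fin n, ∀ (g : (Fin n → V) → V) (v : V), insertArgs i g (Function.update x t v) =
      Function.update (insertArgs i g x) i
        (g (Function.update (fun k => x ⟨i.val + k.val, by omega⟩) k v))) ∨
    (∃ j : Fin m, j ≠ i ∧ ∀ (g : (Fin n → V) → V) (v : V),
      insertArgs i g (Function.update x t v) = Function.update (insertArgs i g x) j v) := by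
  rcases lt_or_ge t.val i.val with h1 | h1
  · refine Or.inr ⟨⟨t.val, by omega⟩, fun h => by simp [← h] at h1, fun g v => ?_⟩
    funext j
    simp only [insertArgs, Function.update_apply, Fin.ext_iff]
    split_ifs <;> first | rfl | omega | exact congrArg g (funext fun k => by
      try simp only [Function.update_apply, Fin.ext_iff]
      split_ifs <;> first | rfl | omega)
  · rcases lt_or_ge t.val (i.val + n) with h2 | h2
    · refine Or.inl ⟨⟨t.val - i.val, by omega⟩, fun g v => ?_⟩
      funext j
      simp only [insertArgs, Function.update_apply, Fin.ext_iff]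
      split_ifs <;> first | rfl | omega | exact congrArg g (funext fun k => by
      try simp only [Function.update_apply, Fin.ext_iff]
      split_ifs <;> first | rfl | omega)
    · refine Or.inr ⟨⟨t.val + 1 - n, by omega⟩, fun h => ?_, fun g v => ?_⟩
      · simp only [Fin.ext_iff] at h; omega
      funext j
      simp only [insertArgs, Function.update_apply, Fin.ext_iff]
      split_ifs <;> first | rfl | omega | exact congrArg g (funext fun k => by
      try simp only [Function.update_apply, Fin.ext_iff]
      split_ifs <;> first | rfl | omega)

theorem insertArgs_self {V : Type*} {m n : ℕ} (i : Fin m) (g : (Fin n → V) → V) (x : Fin (m + n - 1) → V) :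
    insertArgs i g x =
      Function.update (insertArgs i g x) i (g (fun k => x ⟨i.val + k.val, by omega⟩)) := by
  funext j
  by_cases h : j = i
  · subst h; simp [insertArgs]
  · simp [h]

theorem insertArgs_eq_update {V : Type*} {m n : ℕ} (i : Fin m) (g g' : (Fin n → V) → V)
    (x : Fin (m + n - 1) → V) :
    insertArgs i g x =
      Function.update (insertArgs i g' x) i (g (fun k => x ⟨i.val + k.val, by omega⟩)) := by
  funext j
  by_cases h : j = i
  · subst h; simp [insertArgs]
  · have h' : j.val ≠ i.val := fun e => h (Fin.ext e)
    simp [h, h', insertArgs]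

section Multilinear

variable (K : Type*) [Field K] (V W : Type*) [AddCommGroup V] [Module K V]
  [AddCommGroup W] [Module K W]

/-- `Hom (V^{⊗ n}, W)`. -/
abbrev Coch (n : ℕ) : Type _ := MultilinearMap K (fun _ : Fin n => V) W

/-- The graded vector space `⨁_{n ≥ 0} Hom (V^{⊗ n}, W)`. -/
abbrev CochSpace : Type _ := ⨁ n : ℕ, Coch K V W n

/-- The homogeneous part of degree `i`: it is `Hom (V^{⊗ n}, W)` for `i = n ≥ 0`, and zero for
negative `i`. -/
def degreePart : ℤ → Submodule K (CochSpace K V W)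
  | Int.ofNat n => LinearMap.range (DirectSum.lof K ℕ (Coch K V W) n)
  | Int.negSucc _ => ⊥

variable {K V W}

/-- A homogeneous element, seen in the direct sum. -/
abbrev single (n : ℕ) : Coch K V W n →ₗ[K] CochSpace K V W := DirectSum.lof K ℕ (Coch K V W) n

/-- A linear map `V → W`, seen in the direct sum as an element of degree one. -/
def ofLinear (T : V →ₗ[K] W) : CochSpace K V W :=
  single 1 (MultilinearMap.ofSubsingleton K V W (0 : Fin 1) T)

/-- The partial composition `f ∘_i g` (with `i` counted from `0`), bilinear in `f` and `g`:
`(f ∘_i g) (x_0, …) = f (x_0, …, x_(i-1), g (x_i, …, x_(i+n-1)), x_(i+n), …)`. -/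
def partialComp {m n : ℕ} (i : Fin m) :
    Coch K V W m →ₗ[K] Coch K V V n →ₗ[K] Coch K V W (m + n - 1) :=
  LinearMap.mk₂ K
    (fun f g =>
      { toFun := fun x => f (insertArgs i g x)
        map_update_add' := by
          intro dec x t a b
          have hd : dec = instDecidableEqFin _ := Subsingleton.elim _ _
          subst hd
          rcases insertArgs_update (n := n) i x t with ⟨k, hk⟩ | ⟨j, -, hj⟩
          · simp only [hk, MultilinearMap.map_update_add]
          · simp only [hj, MultilinearMap.map_update_add]
        map_update_smul' := by
          intro dec x t c a
          have hd : dec = instDecidableEqFin _ := Subsingleton.elim _ _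
          subst hd
          rcases insertArgs_update (n := n) i x t with ⟨k, hk⟩ | ⟨j, -, hj⟩
          · simp only [hk, MultilinearMap.map_update_smul]
          · simp only [hj, MultilinearMap.map_update_smul] })
    (fun f f' g => by ext x; simp)
    (fun c f g => by ext x; simp)
    (fun f g g' => by
      ext x
      simp only [MultilinearMap.coe_mk, add_apply]
      rw [insertArgs_eq_update i (⇑(g + g')) (⇑g), insertArgs_eq_update i (⇑g') (⇑g),
        add_apply, MultilinearMap.map_update_add, ← insertArgs_self])
    (fun c f g => by
      ext x
      simp only [MultilinearMap.coe_mk, smul_apply]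
      rw [insertArgs_eq_update i (⇑(c • g)) (⇑g), smul_apply,
        MultilinearMap.map_update_smul, ← insertArgs_self])

/-- The signed sum of all partial compositions
`f ∘ g = ∑_{1 ≤ i ≤ m} (-1)^((i - 1) (n - 1)) f ∘_i g` for `f`, `g` of arities `m`, `n`.
(Below `i` is counted from `0`, and `n + 1` has the parity of `n - 1`.) -/
def circ (m n : ℕ) : Coch K V W m →ₗ[K] Coch K V V n →ₗ[K] Coch K V W (m + n - 1) :=
  ∑ i : Fin m, (-1 : K) ^ (i.val * (n + 1)) • partialComp i

/-- Linear extension to a direct sum. -/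
def extend₁ {X : ℕ → Type*} [∀ n, AddCommGroup (X n)] [∀ n, Module K (X n)]
    {Z : Type*} [AddCommGroup Z] [Module K Z] :
    (∀ n, X n →ₗ[K] Z) →ₗ[K] (⨁ n, X n) →ₗ[K] Z :=
  (DFinsupp.lsum K).toLinearMap

/-- Bilinear extension to a direct sum. -/
def extend₂ {X Y : ℕ → Type*} [∀ n, AddCommGroup (X n)] [∀ n, Module K (X n)]
    [∀ n, AddCommGroup (Y n)] [∀ n, Module K (Y n)]
    {Z : Type*} [AddCommGroup Z] [Module K Z] :
    (∀ m n, X m →ₗ[K] Y n →ₗ[K] Z) →ₗ[K] (⨁ n, X n) →ₗ[K] (⨁ n, Y n) →ₗ[K] Z :=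
  extend₁ ∘ₗ LinearMap.pi fun m =>
    { toFun := fun B => extend₁ ∘ₗ LinearMap.pi (B m)
      map_add' := fun B B' => by
        ext1 P
        exact map_add extend₁ (LinearMap.pi (B m) P) (LinearMap.pi (B' m) P)
      map_smul' := fun c B => by
        ext1 P
        exact map_smul extend₁ c (LinearMap.pi (B m) P) }

/-- Trilinear extension to a direct sum. -/
def extend₃ {X : ℕ → Type*} [∀ n, AddCommGroup (X n)] [∀ n, Module K (X n)]
    {Z : Type*} [AddCommGroup Z] [Module K Z]
    (B : ∀ p q r, X p →ₗ[K] X q →ₗ[K] X r →ₗ[K] Z) :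
    (⨁ n, X n) →ₗ[K] (⨁ n, X n) →ₗ[K] (⨁ n, X n) →ₗ[K] Z :=
  extend₁ fun p => extend₂ ∘ₗ LinearMap.pi fun q => LinearMap.pi fun r => B p q r

theorem extend₁_single {X : ℕ → Type*} [∀ n, AddCommGroup (X n)] [∀ n, Module K (X n)]
    {Z : Type*} [AddCommGroup Z] [Module K Z] (B : ∀ n, X n →ₗ[K] Z) (n : ℕ) (P : X n) :
    extend₁ B (DirectSum.lof K ℕ X n P) = B n P :=
  DirectSum.toModule_lof K n P

theorem extend₂_single {X Y : ℕ → Type*} [∀ n, AddCommGroup (X n)] [∀ n, Module K (X n)]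
    [∀ n, AddCommGroup (Y n)] [∀ n, Module K (Y n)]
    {Z : Type*} [AddCommGroup Z] [Module K Z] (B : ∀ m n, X m →ₗ[K] Y n →ₗ[K] Z)
    (m n : ℕ) (P : X m) (Q : Y n) :
    extend₂ B (DirectSum.lof K ℕ X m P) (DirectSum.lof K ℕ Y n Q) = B m n P Q := by
  simp only [extend₂, LinearMap.comp_apply, extend₁_single, LinearMap.pi_apply]
  exact extend₁_single _ n Q

theorem extend₃_single {X : ℕ → Type*} [∀ n, AddCommGroup (X n)] [∀ n, Module K (X n)]
    {Z : Type*} [AddCommGroup Z] [Module K Z]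
    (B : ∀ p q r, X p →ₗ[K] X q →ₗ[K] X r →ₗ[K] Z) (p q r : ℕ) (P : X p) (Q : X q) (R : X r) :
    extend₃ B (DirectSum.lof K ℕ X p P) (DirectSum.lof K ℕ X q Q) (DirectSum.lof K ℕ X r R) =
      B p q r P Q R := by
  simp only [extend₃, extend₁_single, LinearMap.comp_apply, extend₂_single, LinearMap.pi_apply]

/-- The Gerstenhaber bracket on `⨁_n Hom (V^{⊗ n}, V)`: for `f`, `g` of arities `m`, `n`,
`[f, g] = f ∘ g - (-1)^((m - 1) (n - 1)) g ∘ f`. -/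
def gerstenhaber : CochSpace K V V →ₗ[K] CochSpace K V V →ₗ[K] CochSpace K V V :=
  extend₂ fun m n => LinearMap.mk₂ K
    (fun f g => single (m + n - 1) (circ m n f g) -
      (-1 : K) ^ ((m + 1) * (n + 1)) • single (n + m - 1) (circ n m g f))
    (fun f f' g => by simp only [map_add, LinearMap.add_apply, smul_add]; abel)
    (fun c f g => by
      simp only [map_smul, LinearMap.smul_apply, smul_sub, smul_comm c ((-1 : K) ^ _)])
    (fun f g g' => by simp only [map_add, LinearMap.add_apply, smul_add]; abel)
    (fun c f g => by
      simp only [map_smul, LinearMap.smul_apply, smul_sub, smul_comm c ((-1 : K) ^ _)])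

/-- A bilinear map as an element of `Hom (V^{⊗ 2}, W)`. -/
def ofBilinear (B : V →ₗ[K] V →ₗ[K] W) : Coch K V W 2 :=
  MultilinearMap.mk' (fun x => B (x 0) (x 1))
    (fun x i a b => by fin_cases i <;> simp)
    (fun x i c a => by fin_cases i <;> simp)

end Multilinear

/-! ### Bimodules, Hochschild cocycles and twisted Rota-Baxter operators -/

/-- A bimodule structure on the vector space `M` over the associative algebra `A`
(which is not assumed to have a unit). -/
structure Bimod (K A M : Type*) [Field K] [NonUnitalRing A] [Module K A] [AddCommGroup M]
    [Module K M] where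
  /-- The left action `(a, u) ↦ a · u`. -/
  left : A →ₗ[K] M →ₗ[K] M
  /-- The right action `(u, a) ↦ u · a`. -/
  right : M →ₗ[K] A →ₗ[K] M
  mul_left : ∀ a b u, left (a * b) u = left a (left b u)
  left_right : ∀ a u b, right (left a u) b = left a (right u b)
  right_mul : ∀ u a b, right (right u a) b = right u (a * b)

section RotaBaxter

variable {K A M : Type*} [Field K] [NonUnitalRing A] [Module K A] [IsScalarTower K A A]
  [SMulCommClass K A A] [AddCommGroup M] [Module K M]

/-- `H : A ⊗ A → M` is a Hochschild `2`-cocycle. -/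
def Bimod.IsTwoCocycle (β : Bimod K A M) (H : A →ₗ[K] A →ₗ[K] M) : Prop :=
  ∀ a b c, β.left a (H b c) - H (a * b) c + H a (b * c) - β.right (H a b) c = 0

/-- `T : M → A` is an `H`-twisted Rota-Baxter operator. -/
def Bimod.IsTwistedRB (β : Bimod K A M) (H : A →ₗ[K] A →ₗ[K] M) (T : M →ₗ[K] A) : Prop :=
  ∀ u v, T u * T v = T (β.right u (T v) + β.left (T u) v + H (T u) (T v))

/-! ### The binary bracket -/

/-- The bilinear map `μ + l + r` on `A ⊕ M`: `((a, u), (b, v)) ↦ (a b, a · v + u · b)`. -/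
def Bimod.mulLR (β : Bimod K A M) : (A × M) →ₗ[K] (A × M) →ₗ[K] (A × M) :=
  LinearMap.mk₂ K (fun x y => (x.1 * y.1, β.left x.1 y.2 + β.right x.2 y.1))
    (fun x x' y => by
      ext <;> simp only [Prod.fst_add, Prod.snd_add, map_add, LinearMap.add_apply, add_mul]
      abel)
    (fun c x y => by
      ext <;> simp only [Prod.smul_fst, Prod.smul_snd, map_smul, LinearMap.smul_apply,
        smul_mul_assoc, smul_add])
    (fun x y y' => by
      ext <;> simp only [Prod.fst_add, Prod.snd_add, map_add, mul_add]
      abel)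
    (fun c x y => by
      ext <;> simp only [Prod.smul_fst, Prod.smul_snd, map_smul, mul_smul_comm,
        smul_add])

/-- A map `M^{⊗ n} → A` regarded as a map `(A ⊕ M)^{⊗ n} → A ⊕ M` through the projection
`A ⊕ M → M` and the inclusion `A → A ⊕ M`. -/
def lift : CochSpace K M A →ₗ[K] CochSpace K (A × M) (A × M) :=
  extend₁ fun n => single n ∘ₗ
    (LinearMap.compMultilinearMapₗ K (LinearMap.inl K A M)) ∘ₗ
    (MultilinearMap.compLinearMapₗ (fun _ : Fin n => LinearMap.snd K A M))

/-- The component `M^{⊗ n} → A` of a map `(A ⊕ M)^{⊗ n} → A ⊕ M`. -/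
def component : CochSpace K (A × M) (A × M) →ₗ[K] CochSpace K M A :=
  extend₁ fun n => single n ∘ₗ
    (LinearMap.compMultilinearMapₗ K (LinearMap.fst K A M)) ∘ₗ
    (MultilinearMap.compLinearMapₗ (fun _ : Fin n => LinearMap.inr K A M))

/-- The operator `P ↦ (-1)^p P` for `P` of arity `p`. -/
def parity : CochSpace K M A →ₗ[K] CochSpace K M A :=
  extend₁ fun n => (-1 : K) ^ n • single n

/-- The binary bracket `⟦P, Q⟧ = (-1)^p [[μ + l + r, P], Q]`, where `[ , ]` is the Gerstenhaber
bracket of multilinear maps on `A ⊕ M` (the right hand side is again a map `M^{⊗ (p+q)} → A`). -/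
def Bimod.bracket₂ (β : Bimod K A M) (P Q : CochSpace K M A) : CochSpace K M A :=
  component (gerstenhaber (gerstenhaber (single 2 (ofBilinear β.mulLR)) (lift (parity P))) (lift Q))

/-! ### The ternary bracket -/

section Updates

variable {V : Type*} {q r : ℕ}

theorem update_castAdd_left (u : Fin (q + r) → V) (a : Fin q) (v : V) :
    (fun a' => Function.update u (Fin.castAdd r a) v (Fin.castAdd r a')) =
      Function.update (fun a' => u (Fin.castAdd r a')) a v := by
  funext a'; simp [Function.update_apply, Fin.ext_iff]

theorem update_castAdd_right (u : Fin (q + r) → V) (a : Fin q) (v : V) :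
    (fun b => Function.update u (Fin.castAdd r a) v (Fin.natAdd q b)) =
      fun b => u (Fin.natAdd q b) := by
  funext b; rw [Function.update_of_ne]; simp only [ne_eq, Fin.ext_iff, Fin.val_natAdd, Fin.val_castAdd]; omega

theorem update_natAdd_left (u : Fin (q + r) → V) (b : Fin r) (v : V) :
    (fun a => Function.update u (Fin.natAdd q b) v (Fin.castAdd r a)) =
      fun a => u (Fin.castAdd r a) := by
  funext a; rw [Function.update_of_ne]; simp only [ne_eq, Fin.ext_iff, Fin.val_natAdd, Fin.val_castAdd]; omega

theorem update_natAdd_right (u : Fin (q + r) → V) (b : Fin r) (v : V) :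
    (fun b' => Function.update u (Fin.natAdd q b) v (Fin.natAdd q b')) =
      Function.update (fun b' => u (Fin.natAdd q b')) b v := by
  funext b'; simp [Function.update_apply, Fin.ext_iff]

end Updates

/-- `H (Q, R) ∈ Hom (M^{⊗ (q+r)}, M)`, i.e.
`(u_1, …, u_(q+r)) ↦ H (Q (u_1, …, u_q), R (u_(q+1), …, u_(q+r)))`. -/
def cupH (H : A →ₗ[K] A →ₗ[K] M) (q r : ℕ) :
    Coch K M A q →ₗ[K] Coch K M A r →ₗ[K] Coch K M M (q + r) :=
  LinearMap.mk₂ K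
    (fun Q R => MultilinearMap.mk'
      (fun u => H (Q fun a => u (Fin.castAdd r a)) (R fun b => u (Fin.natAdd q b)))
      (fun u t x y => by
        refine Fin.addCases (fun a => ?_) (fun b => ?_) t
        · simp only [update_castAdd_left, update_castAdd_right, MultilinearMap.map_update_add,
            map_add, LinearMap.add_apply]
        · simp only [update_natAdd_left, update_natAdd_right, MultilinearMap.map_update_add,
            map_add])
      (fun u t c x => by
        refine Fin.addCases (fun a => ?_) (fun b => ?_) t
        · simp only [update_castAdd_left, update_castAdd_right, MultilinearMap.map_update_smul,
            map_smul, LinearMap.smul_apply]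
        · simp only [update_natAdd_left, update_natAdd_right, MultilinearMap.map_update_smul,
            map_smul]))
    (fun Q Q' R => by ext u; simp)
    (fun c Q R => by ext u; simp)
    (fun Q R R' => by ext u; simp)
    (fun c Q R => by ext u; simp)

/-- The common form of the six terms of the ternary bracket: for `P`, `Q`, `R` of arities
`p`, `q`, `r` it is
`-(-1)^(p + q r) ∑_{1 ≤ i ≤ p} (-1)^((i - 1) (q + r - 1))
  P (u_1, …, u_(i-1), H (Q (u_i, …), R (u_(i+q), …)), u_(i+q+r), …)`. -/
def term (H : A →ₗ[K] A →ₗ[K] M) {p q r : ℕ} (P : Coch K M A p) (Q : Coch K M A q)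
    (R : Coch K M A r) : CochSpace K M A :=
  -(-1 : K) ^ (p + q * r) • single (p + (q + r) - 1) (circ p (q + r) P (cupH H q r Q R))

/-- The ternary bracket of homogeneous elements `P`, `Q`, `R` of arities `p`, `q`, `r`: the graded
skew-symmetrization of `term` (each of the six terms is placed in the direct sum; all of them have
arity `p + q + r - 1`, and a term whose outer map has arity zero vanishes). -/
def ternary (H : A →ₗ[K] A →ₗ[K] M) (p q r : ℕ) :
    Coch K M A p →ₗ[K] Coch K M A q →ₗ[K] Coch K M A r →ₗ[K] CochSpace K M A :=
  let b (P : Coch K M A p) (Q : Coch K M A q) (R : Coch K M A r) : CochSpace K M A :=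
    term H P Q R
      - (-1 : K) ^ (q * r) • term H P R Q
      - (-1 : K) ^ (p * q) • term H Q P R
      + (-1 : K) ^ (p * (q + r)) • term H Q R P
      - (-1 : K) ^ (p * q + q * r + r * p) • term H R Q P
      + (-1 : K) ^ ((p + q) * r) • term H R P Q
  { toFun := fun P => LinearMap.mk₂ K (fun Q R => b P Q R)
      (fun Q Q' R => by
        simp only [b, term, map_add, LinearMap.add_apply, smul_add]; abel)
      (fun c Q R => by
        simp only [b, term, map_smul, LinearMap.smul_apply, smul_add, smul_sub,
          smul_comm c ((-1 : K) ^ _), smul_comm c (-(-1 : K) ^ _)])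
      (fun Q R R' => by
        simp only [b, term, map_add, LinearMap.add_apply, smul_add]; abel)
      (fun c Q R => by
        simp only [b, term, map_smul, LinearMap.smul_apply, smul_add, smul_sub,
          smul_comm c ((-1 : K) ^ _), smul_comm c (-(-1 : K) ^ _)])
    map_add' := fun P P' => by
      ext1 Q; ext1 R
      simp only [b, term, LinearMap.mk₂_apply, map_add, LinearMap.add_apply, smul_add]; abel
    map_smul' := fun c P => by
      ext1 Q; ext1 R
      simp only [b, term, LinearMap.mk₂_apply, map_smul, LinearMap.smul_apply, smul_add, smul_sub,
        smul_comm c ((-1 : K) ^ _), smul_comm c (-(-1 : K) ^ _), RingHom.id_apply] }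

/-- The ternary bracket `⟦P, Q, R⟧`. -/
def bracket₃ (H : A →ₗ[K] A →ₗ[K] M) (P Q R : CochSpace K M A) : CochSpace K M A :=
  extend₃ (ternary H) P Q R

/-- The differential `d_T P = ⟦T, P⟧ - (1/2) ⟦T, T, P⟧`. -/
def Bimod.differential (β : Bimod K A M) (H : A →ₗ[K] A →ₗ[K] M) (T : M →ₗ[K] A)
    (P : CochSpace K M A) : CochSpace K M A :=
  β.bracket₂ (ofLinear T) P - (1 / 2 : K) • bracket₃ H (ofLinear T) (ofLinear T) P

end RotaBaxter

end TwistedRB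

end

noncomputable section

namespace TwistedRB

set_option linter.unusedSectionVars false

/-! ### Insertions into functions of words -/

/-! The proof is the method of higher derived brackets, carried out in the Gerstenhaber graded Lie
algebra of the vector space `A × M`. Give a multilinear map the weight "number of inputs in `A`,
minus one if the output is in `A`". Weights add under the bracket and are never below `-1`. The maps
of weight `-1` are exactly the lifts of elements of `L` (`lift_component`), so these lifts form an
abelian subalgebra. The product `θ = μ + l + r` has weight `1`, and `h`, the cocycle extended to `A
× M`, has weight `2`. Associativity together with the bimodule axioms gives `[θ, θ] = 0`; the
cocycle condition gives `[h, θ] = 0`; and `[h, h] = 0` because `H` reads only `A` and takes values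
in `M`.

The binary bracket is `[[θ, P], Q]` up to sign by definition. The explicit six-term ternary bracket
is `[[[h, P], Q], R]` up to sign; this is `ternary_eq`.

Let `t` be the lift of `T`. Applying the formal exponential of `[·, t]` to `θ + h` and sorting by
weight gives `h`, `m = θ + [h, t]`, `d = [θ, t] + ½ [[h, t], t]` and the curvature `c(t) = ½ [[θ,
t], t] + ⅙ [[[h, t], t], t]`. The twisted Rota-Baxter equation is `c(t) = 0` (`isTwistedRB_iff`). In
that case the relations for `h` and `θ`, bracketed repeatedly with `t`, yield `[h, m] = 0`, `[m, m]
+ 2 [h, d] = 0`, `[m, d] = 0` and `[d, d] = 0`. The operations `l₁`, `l₂`, `l₃` are, up to signs,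
the iterated brackets of lifts with `d`, `m` and `h`. Bracketing these relations with lifted inputs
and distributing by the Leibniz rule gives the Jacobi identities for one to five inputs, since all
unwanted terms have weight below `-1`; with six or more inputs every term contains an operation of
arity at least four.

The curvature is a cubic polynomial, and its Taylor expansion at `t` (`twistCurv_add`) is `c(t + s)
= c(t) + [d, s] + ½ [[m, s], s] + ⅙ [[[h, s], s], s]`. After the signs are inserted, the last three
terms are minus the Maurer-Cartan expression, whence the final equivalence.

Two devices keep the bookkeeping finite. Cochains are treated as functions on lists, so that the
pre-Lie identity `assocIns_symm`, and with it the graded Jacobi identity, follows by induction on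
the first letter. Signs are written as `sgn K` of an exponent and compared in `ZMod 2`, where a
decision procedure settles them. -/

section Words

variable {K : Type*} [Field K] {V W : Type*} [AddCommGroup V] [Module K V]
  [AddCommGroup W] [Module K W]

/-- `∑ φ (G b, c)` over all decompositions of a word as `b ++ c`. -/
def insHead : (List V → V) → (List V → W) → List V → W
  | G, φ, [] => φ [G []]
  | G, φ, x :: w => φ (G [] :: x :: w) + insHead (fun b => G (x :: b)) φ w

/-- `∑ ε ^ |a| φ (a, G b, c)` over all decompositions of a word as `a ++ b ++ c`. -/
def ins (ε : K) (G : List V → V) : (List V → W) → List V → W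
  | φ, [] => φ [G []]
  | φ, x :: w => insHead G φ (x :: w) + ε • ins ε G (fun c => φ (x :: c)) w

/-- `∑ ε ^ (|b| + |c|) φ (F b, c, G d, e)` over all decompositions of a word as
`b ++ c ++ d ++ e`. -/
def insTwo (ε : K) (G : List V → V) : (List V → V) → (List V → W) → List V → W
  | F, φ, [] => ins ε G (fun c => φ (F [] :: c)) []
  | F, φ, x :: w => ins ε G (fun c => φ (F [] :: c)) (x :: w) +
      ε • insTwo ε G (fun b => F (x :: b)) φ w

/-- `φ` is additive in its first letter. -/
def HeadAdd (φ : List V → W) : Prop := ∀ x y c, φ ((x + y) :: c) = φ (x :: c) + φ (y :: c)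

/-- `φ` is homogeneous in its first letter. -/
def HeadSMul (K : Type*) [Field K] {V W : Type*} [AddCommGroup V] [Module K V]
    [AddCommGroup W] [Module K W] (φ : List V → W) : Prop :=
  ∀ (k : K) x c, φ ((k • x) :: c) = k • φ (x :: c)

/-- `φ` is linear in each letter. -/
structure IsMultilin (K : Type*) [Field K] {V W : Type*} [AddCommGroup V] [Module K V]
    [AddCommGroup W] [Module K W] (φ : List V → W) : Prop where
  add : ∀ a, HeadAdd fun c => φ (a ++ c)
  smul : ∀ a, HeadSMul K fun c => φ (a ++ c)

theorem IsMultilin.cons {φ : List V → W} (h : IsMultilin K φ) (x : V) :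
    IsMultilin K fun c => φ (x :: c) :=
  ⟨fun a => h.add (x :: a), fun a => h.smul (x :: a)⟩

theorem IsMultilin.headAdd {φ : List V → W} (h : IsMultilin K φ) : HeadAdd φ := h.add []

theorem IsMultilin.headSMul {φ : List V → W} (h : IsMultilin K φ) : HeadSMul K φ := h.smul []

theorem insHead_add (G : List V → V) (φ ψ : List V → W) (w : List V) :
    insHead G (φ + ψ) w = insHead G φ w + insHead G ψ w := by
  induction w generalizing G with
  | nil => rfl
  | cons x w ih => simp only [insHead, ih, Pi.add_apply]; abel

theorem insHead_smul (G : List V → V) (k : K) (φ : List V → W) (w : List V) :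
    insHead G (k • φ) w = k • insHead G φ w := by
  induction w generalizing G with
  | nil => rfl
  | cons x w ih => simp only [insHead, ih, Pi.smul_apply, smul_add]

theorem ins_add (ε : K) (G : List V → V) (φ ψ : List V → W) (w : List V) :
    ins ε G (φ + ψ) w = ins ε G φ w + ins ε G ψ w := by
  induction w generalizing φ ψ with
  | nil => rfl
  | cons x w ih =>
    simp only [ins, insHead_add]
    have := ih (fun c => φ (x :: c)) (fun c => ψ (x :: c))
    rw [show (fun c => (φ + ψ) (x :: c)) = (fun c => φ (x :: c)) + fun c => ψ (x :: c) from rfl,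
      this, smul_add]
    abel

theorem ins_smul (ε : K) (G : List V → V) (k : K) (φ : List V → W) (w : List V) :
    ins ε G (k • φ) w = k • ins ε G φ w := by
  induction w generalizing φ with
  | nil => rfl
  | cons x w ih =>
    simp only [ins, insHead_smul]
    rw [show (fun c => (k • φ) (x :: c)) = k • (fun c => φ (x :: c)) from rfl, ih, smul_add,
      smul_comm]

theorem insHead_add_left (F G : List V → V) {φ : List V → W} (h : HeadAdd φ) (w : List V) :
    insHead (F + G) φ w = insHead F φ w + insHead G φ w := by
  induction w generalizing F G with
  | nil => exact h _ _ _
  | cons x w ih =>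
    have := ih (fun b => F (x :: b)) (fun b => G (x :: b))
    simp only [insHead, Pi.add_apply, h _ _ _]
    rw [show (fun b => F (x :: b) + G (x :: b)) =
      (fun b => F (x :: b)) + fun b => G (x :: b) from rfl, this]
    abel

theorem insHead_smul_left (k : K) (F : List V → V) {φ : List V → W} (h : HeadSMul K φ)
    (w : List V) : insHead (k • F) φ w = k • insHead F φ w := by
  induction w generalizing F with
  | nil => exact h _ _ _
  | cons x w ih =>
    have := ih (fun b => F (x :: b))
    simp only [insHead, Pi.smul_apply, h _ _ _]
    rw [show (fun b => k • F (x :: b)) = k • (fun b => F (x :: b)) from rfl, this, smul_add]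

theorem ins_mem (S : Submodule K W) (ε : K) (G : List V → V) (φ : List V → W) (w : List V)
    (h : ∀ a b c, w = a ++ b ++ c → φ (a ++ G b :: c) ∈ S) : ins ε G φ w ∈ S := by
  have head : ∀ (w : List V) (G : List V → V) (φ : List V → W),
      (∀ b c, w = b ++ c → φ (G b :: c) ∈ S) → insHead G φ w ∈ S := by
    intro w
    induction w with
    | nil => intro G φ h; exact h [] [] rfl
    | cons x w ih =>
      intro G φ h
      exact S.add_mem (h [] _ rfl) (ih _ _ fun b c e => h (x :: b) c (by simp [e]))
  induction w generalizing φ with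
  | nil => exact h [] [] [] rfl
  | cons x w ih =>
    refine S.add_mem (head _ _ _ fun b c e => h [] b c e) (S.smul_mem _ (ih _ fun a b c e => ?_))
    exact h (x :: a) b c (by simp [e])

/-! ### The pre-Lie identity -/

/-- The hypothesis on `ψ` removes from `insHead F φ` the term with empty `F`-block. What is left
always has the output of `G` inside the block of `F`, so the two insertions are nested. -/
theorem insHead_insHead (F G : List V → V) {φ ψ : List V → W} (h : HeadAdd φ)
    (hψ : ∀ y c, ψ (y :: c) = insHead (fun b => F (y :: b)) φ c) (w : List V) :
    insHead G ψ w = insHead (insHead G F) φ w := by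
  induction w generalizing G with
  | nil => simp only [insHead, hψ]
  | cons x w ih =>
    have e : (fun b => insHead G F (x :: b)) =
        (fun b => F (G [] :: x :: b)) + insHead (fun b => G (x :: b)) F := rfl
    rw [insHead, ih, hψ, insHead, insHead, e, insHead_add_left _ _ h]
    simp only [insHead]
    abel

/-- Once `F` occupies an initial block, an inserted `G` lies either inside that block or strictly to
its right; these are the two summands. -/
theorem ins_insHead (ε : K) (F G : List V → V) {φ : List V → W} (h : HeadAdd φ)
    (h' : HeadSMul K φ) (w : List V) :
    ins ε G (insHead F φ) w = insHead (ins ε G F) φ w + insTwo ε G F φ w := by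
  induction w generalizing F with
  | nil =>
    simp only [ins, insHead, insTwo]
    abel
  | cons x w ih =>
    have e1 : (fun c => insHead F φ (x :: c)) =
        (fun c => φ (F [] :: x :: c)) + insHead (fun b => F (x :: b)) φ := rfl
    have e2 : (fun b => ins ε G F (x :: b)) =
        (fun b => insHead G F (x :: b)) + ε • ins ε G (fun c => F (x :: c)) := rfl
    -- The empty `F`-block is split off: there the output of `G` stands to the right of that of `F`
    -- rather than inside its block.
    have e3 : insHead G (insHead F φ) (x :: w) =
        insHead G (fun c => φ (F [] :: c)) (x :: w) + insHead (insHead G F) φ (x :: w) := by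
      rw [← insHead_insHead F G (ψ := fun c => insHead F φ c - φ (F [] :: c)) h]
      · rw [← insHead_add]; congr 1; funext c; simp
      · intro y c; simp [insHead]
    have e4 : insHead (ins ε G F) φ (x :: w) = φ (ins ε G F [] :: x :: w) +
        insHead (fun b => ins ε G F (x :: b)) φ w := rfl
    have e5 : insHead (insHead G F) φ (x :: w) = φ (insHead G F [] :: x :: w) +
        insHead (fun b => insHead G F (x :: b)) φ w := rfl
    rw [ins, e1, ins_add, ih, insTwo, e3, e4, e2, insHead_add_left _ _ h,
      insHead_smul_left _ _ h', e5]
    simp only [ins, insHead]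
    module

/-- The failure of associativity of insertion, as a function of the inserted maps. -/
def assocIns (ε δ : K) (F G : List V → V) (φ : List V → W) (w : List V) : W :=
  ins δ G (ins ε F φ) w - ins (ε * δ) (ins δ G F) φ w

theorem assocIns_nil (ε δ : K) (F G : List V → V) (φ : List V → W) :
    assocIns ε δ F G φ [] = insTwo δ G F φ [] + ε • insTwo ε F G φ [] := by
  simp only [assocIns, ins, insHead, insTwo]
  abel

/-- On the left `F` passes over the output of `G` as one letter, with sign `ε`; on the right it
passes over the whole block `b`, with sign `ε ^ |b|`. The constant `k` absorbs the difference and is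
rescaled by `ε` at each letter. -/
theorem insHead_eq_smul_insTwo (ε k : K) (F G : List V → V) {φ : List V → W}
    (hk : ∀ b c, ε • ins ε F (fun c => φ (G b :: c)) c =
      (k * ε ^ b.length) • ins ε F (fun c => φ (G b :: c)) c) {ψ : List V → W}
    (hψ : ∀ y c, ψ (y :: c) = ε • ins ε F (fun c => φ (y :: c)) c) (w : List V) :
    insHead G ψ w = k • insTwo ε F G φ w := by
  induction w generalizing G k with
  | nil =>
    have := hk [] []
    simp only [List.length_nil, pow_zero, mul_one] at this
    rw [insHead, hψ, this, insTwo]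
  | cons x w ih =>
    have := hk [] (x :: w)
    simp only [List.length_nil, pow_zero, mul_one] at this
    rw [insHead, hψ, this, insTwo, smul_add, smul_smul, ih (k * ε)]
    intro b c
    rw [hk (x :: b) c, List.length_cons, pow_succ', mul_assoc]

/-- The nested insertions cancel in the associator. Either both blocks start after `x`, which gives
the recursive term, or one of them is at the head with the other to its right, in one order or the
other. -/
theorem assocIns_cons (ε δ s : K) (F G : List V → V) {φ : List V → W} (h : HeadAdd φ)
    (h' : HeadSMul K φ)
    (hs : ∀ b c, ε • ins ε F (fun c => φ (G b :: c)) c =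
      (s * ε ^ b.length) • ins ε F (fun c => φ (G b :: c)) c) (x : V) (w : List V) :
    assocIns ε δ F G φ (x :: w) = (ε * δ) • assocIns ε δ F G (fun c => φ (x :: c)) w +
      insTwo δ G F φ (x :: w) + s • insTwo ε F G φ (x :: w) := by
  have e1 : (fun c => ins ε F φ (x :: c)) =
      (fun c => insHead F φ (x :: c)) + ε • ins ε F (fun c => φ (x :: c)) := rfl
  have e2 := insHead_eq_smul_insTwo ε s F G hs (ψ := ins ε F φ - insHead F φ)
    (fun y c => by simp [ins]) (x :: w)
  have e3 : insHead G (ins ε F φ) (x :: w) =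
      insHead G (insHead F φ) (x :: w) + s • insTwo ε F G φ (x :: w) := by
    rw [← e2, ← insHead_add, add_sub_cancel]
  have e4 := ins_insHead δ F G h h' (x :: w)
  have e5 : ins δ G (insHead F φ) (x :: w) = insHead G (insHead F φ) (x :: w) +
      δ • ins δ G (fun c => insHead F φ (x :: c)) w := rfl
  have e6 : ins δ G (ins ε F φ) (x :: w) = insHead G (ins ε F φ) (x :: w) +
      δ • ins δ G (fun c => ins ε F φ (x :: c)) w := rfl
  have e7 : ins (ε * δ) (ins δ G F) φ (x :: w) = insHead (ins δ G F) φ (x :: w) +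
      (ε * δ) • ins (ε * δ) (ins δ G F) (fun c => φ (x :: c)) w := rfl
  rw [e5] at e4
  rw [assocIns, e6, e7, e3, e1, ins_add, ins_smul, assocIns, eq_sub_of_add_eq e4]
  module

/-- Only blocks of length `n` contribute, and for those `(m+1)(n+1) + (m+1)n` has the parity of
`m+1`. This supplies the hypothesis `hs` of `assocIns_cons`, with the Koszul sign as the constant
`s`. -/
theorem insSign {m n : ℕ} {F G : List V → V} {φ : List V → W} (hφ : IsMultilin K φ)
    (hG : ∀ b, b.length ≠ n → G b = 0) (b c : List V) :
    (-1 : K) ^ (m + 1) • ins ((-1 : K) ^ (m + 1)) F (fun c => φ (G b :: c)) c =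
      ((-1 : K) ^ ((m + 1) * (n + 1)) * ((-1 : K) ^ (m + 1)) ^ b.length) •
        ins ((-1 : K) ^ (m + 1)) F (fun c => φ (G b :: c)) c := by
  by_cases hb : b.length = n
  · congr 1
    calc (-1 : K) ^ (m + 1) = (-1) ^ (2 * ((m + 1) * n)) * (-1) ^ (m + 1) := by simp
      _ = _ := by rw [hb, ← pow_mul, ← pow_add, ← pow_add]; congr 1; ring
  · have : (fun c => φ (G b :: c)) = (0 : K) • fun c => φ (G b :: c) := by
      funext c
      have := hφ.headSMul 0 0 c
      simp only [zero_smul] at this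
      simp [hG b hb, this]
    rw [this, ins_smul]
    simp

/-- The graded pre-Lie identity: the failure of associativity is graded symmetric in the
inserted maps. -/
theorem assocIns_symm {m n : ℕ} {F G : List V → V} {φ : List V → W} (hφ : IsMultilin K φ)
    (hF : ∀ b, b.length ≠ m → F b = 0) (hG : ∀ b, b.length ≠ n → G b = 0) (w : List V) :
    assocIns ((-1 : K) ^ (m + 1)) ((-1) ^ (n + 1)) F G φ w =
      (-1 : K) ^ ((m + 1) * (n + 1)) •
        assocIns ((-1 : K) ^ (n + 1)) ((-1) ^ (m + 1)) G F φ w := by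
  have hs : (-1 : K) ^ ((m + 1) * (n + 1)) * (-1 : K) ^ ((m + 1) * (n + 1)) = 1 := by
    rw [← mul_pow]; simp
  have hc : (n + 1) * (m + 1) = (m + 1) * (n + 1) := mul_comm _ _
  induction w generalizing φ with
  | nil =>
    have h1 := insSign (F := F) (m := m) hφ hG [] []
    have h2 := insSign (F := G) (m := n) hφ hF [] []
    simp only [List.length_nil, pow_zero, mul_one, hc] at h1 h2
    rw [assocIns_nil, assocIns_nil, insTwo, insTwo, h1, h2, smul_add, smul_smul, hs, one_smul]
    abel
  | cons x w ih =>
    have h1 := insSign (F := F) (m := m) hφ hG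
    have h2 := insSign (F := G) (m := n) hφ hF
    rw [hc] at h2
    rw [assocIns_cons _ _ _ F G hφ.headAdd hφ.headSMul h1,
      assocIns_cons _ _ _ G F hφ.headAdd hφ.headSMul h2, ih (hφ.cons x)]
    simp only [smul_add, smul_smul, hs, one_smul]
    rw [mul_comm ((-1 : K) ^ (n + 1)), mul_comm ((-1 : K) ^ ((m + 1) * (n + 1)))]
    abel

end Words

section CochWords

variable {K : Type*} [Field K] {V W : Type*} [AddCommGroup V] [Module K V]
  [AddCommGroup W] [Module K W]

/-! ### Cochains as functions of words -/

/-- The function of words given by the components of `x`. -/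
def toWords : CochSpace K V W →ₗ[K] (List V → W) where
  toFun x w := x w.length w.get
  map_add' _ _ := rfl
  map_smul' _ _ := rfl

theorem toWords_apply (x : CochSpace K V W) {w : List V} {n : ℕ} (h : w.length = n)
    {v : Fin n → V} (hv : ∀ (j : ℕ) (hj : j < n), w[j]'(h ▸ hj) = v ⟨j, hj⟩) :
    toWords x w = x n v := by
  subst h
  exact congrArg (x w.length) (funext fun j : Fin w.length => hv j.1 j.2)

theorem toWords_ofFn (x : CochSpace K V W) {n : ℕ} (v : Fin n → V) :
    toWords x (List.ofFn v) = x n v :=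
  toWords_apply x (by simp) (by simp)

theorem toWords_injective : Function.Injective (toWords (K := K) (V := V) (W := W)) := by
  intro x y h
  refine DFinsupp.ext fun n => MultilinearMap.ext fun v => ?_
  rw [← toWords_ofFn, ← toWords_ofFn, h]

theorem single_apply (n : ℕ) (f : Coch K V W n) : single n f n = f := DirectSum.lof_apply K n f

theorem single_apply_ne {m n : ℕ} (h : m ≠ n) (f : Coch K V W n) : single n f m = 0 :=
  DirectSum.of_eq_of_ne _ _ _ h

theorem toWords_single {n : ℕ} (f : Coch K V W n) {w : List V} (h : w.length = n)
    {v : Fin n → V} (hv : ∀ (j : ℕ) (hj : j < n), w[j]'(h ▸ hj) = v ⟨j, hj⟩) :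
    toWords (single n f) w = f v := by
  rw [toWords_apply _ h hv, single_apply]

theorem toWords_single_ne {n : ℕ} (f : Coch K V W n) {w : List V} (h : w.length ≠ n) :
    toWords (single n f) w = 0 := by
  change (single n f) w.length w.get = 0
  rw [single_apply_ne h]; rfl

theorem toWords_append_cons (x : CochSpace K V W) (a c : List V) :
    ∃ (n : ℕ) (i : Fin n) (v : Fin n → V), ∀ y,
      toWords x (a ++ y :: c) = x n (Function.update v i y) := by
  refine ⟨(a ++ 0 :: c).length, ⟨a.length, by simp⟩, (a ++ 0 :: c).get, fun y => ?_⟩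
  refine toWords_apply x (by simp) fun j hj => ?_
  simp only [Function.update_apply, Fin.ext_iff, List.get_eq_getElem, List.getElem_append,
    List.getElem_cons]
  split_ifs <;> first | rfl | omega

theorem isMultilin_toWords (x : CochSpace K V W) : IsMultilin K (toWords x) := by
  refine ⟨fun a y z c => ?_, fun a k y c => ?_⟩
  · obtain ⟨n, i, v, h⟩ := toWords_append_cons x a c
    simp [h]
  · obtain ⟨n, i, v, h⟩ := toWords_append_cons x a c
    simp [h]

theorem insHead_of_support {n : ℕ} {G : List V → V} {φ : List V → W} (hφ : ∀ c, φ (0 :: c) = 0)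
    (hG : ∀ b, b.length ≠ n → G b = 0) (w : List V) :
    insHead G φ w = if n ≤ w.length then φ (G (w.take n) :: w.drop n) else 0 := by
  induction w generalizing G n with
  | nil =>
    rcases n with _ | n
    · simp [insHead]
    · simp [insHead, hG [] (by simp), hφ]
  | cons x w ih =>
    rcases n with _ | n
    · have : ∀ (G : List V → V) (_ : ∀ b, G b = 0), insHead G φ w = 0 := by
        intro G hG
        clear ih
        induction w generalizing G with
        | nil => simp [insHead, hG, hφ]
        | cons y w ih => rw [insHead, ih _ fun b => hG _, hG, hφ, add_zero]
      simp [insHead, this (fun b => G (x :: b)) (fun b => hG _ (by simp))]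
    · rw [insHead, hG [] (by simp), hφ, zero_add, ih (n := n) fun b hb => hG _ (by simpa using hb)]
      simp

/-- A map of fixed arity leaves one possible block at each starting position, so the sum over
decompositions becomes the usual sum over positions. -/
theorem ins_of_support {n : ℕ} (ε : K) {G : List V → V} {φ : List V → W} (hφ : IsMultilin K φ)
    (hG : ∀ b, b.length ≠ n → G b = 0) (w : List V) :
    ins ε G φ w = ∑ i ∈ Finset.range (w.length + 1), ε ^ i • if i + n ≤ w.length then
      φ (w.take i ++ G ((w.drop i).take n) :: w.drop (i + n)) else 0 := by
  have h0 : ∀ {φ : List V → W}, IsMultilin K φ → ∀ c, φ (0 :: c) = 0 := fun h c => by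
    simpa using h.headSMul (0 : K) 0 c
  induction w generalizing φ with
  | nil =>
    rcases n with _ | n
    · simp [ins]
    · simp [ins, hG [] (by simp), h0 hφ]
  | cons x w ih =>
    rw [ins, insHead_of_support (h0 hφ) hG, ih (hφ.cons x), List.length_cons,
      Finset.sum_range_succ' _ (w.length + 1), add_comm, Finset.smul_sum]
    congr 1
    · refine Finset.sum_congr rfl fun i _ => ?_
      simp only [smul_smul, ← pow_succ', List.take_succ_cons, List.drop_succ_cons,
        List.cons_append, add_right_comm i 1 n, add_le_add_iff_right]
    · simp

/-- The bridge between the indexed definition of `f ∘ g` and the recursive `ins`; after it no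
arithmetic of indices is needed for compositions. -/
theorem toWords_circ {m n : ℕ} (f : Coch K V W m) (g : Coch K V V n) :
    toWords (single (m + n - 1) (circ m n f g)) =
      ins ((-1 : K) ^ (n + 1)) (toWords (single n g)) (toWords (single m f)) := by
  funext w
  rw [ins_of_support (n := n) _ (isMultilin_toWords _) fun b hb => toWords_single_ne g hb]
  by_cases hw : w.length = m + n - 1
  · rw [← Finset.sum_subset (s₁ := Finset.range m)]
    · rw [toWords_single _ hw (v := fun i => w[i.1]) fun _ _ => rfl, circ]
      simp only [LinearMap.sum_apply, sum_apply, LinearMap.smul_apply,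
        smul_apply]
      rw [← Fin.sum_univ_eq_sum_range (fun i => ((-1 : K) ^ (n + 1)) ^ i • if i + n ≤ w.length then
        toWords (single m f) (w.take i ++ toWords (single n g) ((w.drop i).take n) ::
          w.drop (i + n)) else 0)]
      refine Finset.sum_congr rfl fun i _ => ?_
      rw [if_pos (by omega), ← pow_mul, mul_comm (n + 1)]
      congr 1
      symm
      refine toWords_single f (by simp; omega) fun j hj => ?_
      simp only [insertArgs, List.getElem_append, List.length_take, List.getElem_cons,
        List.getElem_take, List.getElem_drop]
      have hi : min i.1 w.length = i.1 := by omega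
      simp only [hi]
      split_ifs with h1 h2 h3 h4
      · rfl
      · refine toWords_single g (by simp; omega) fun k hk => ?_
        simp
      · omega
      · omega
      · congr 1; omega
    · intro i hi; simp only [Finset.mem_range] at *; omega
    · intro i hi hi'
      simp only [Finset.mem_range] at *
      -- The condition can hold only for `m = n = 0`, where the arity `m + n - 1` is truncated to
      -- `0`; the outer word then has the wrong length.
      split_ifs with h
      · rw [toWords_single_ne, smul_zero]
        simp; omega
      · simp
  · rw [toWords_single_ne _ hw]
    refine (Finset.sum_eq_zero fun i _ => ?_).symm
    split_ifs with h
    · rw [toWords_single_ne, smul_zero]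
      simp; omega
    · simp

end CochWords

section Graded

/-! ### Signs -/

/-- The sign `(-1) ^ d` in the field `K`. -/
def sgn (K : Type*) [Field K] (d : ℤ) : K := ((d.negOnePow : ℤ) : K)

variable {K : Type*} [Field K]

theorem sgn_add (a b : ℤ) : sgn K (a + b) = sgn K a * sgn K b := by
  simp [sgn, Int.negOnePow_add]

theorem sgn_mul_self (a : ℤ) : sgn K a * sgn K a = 1 := by
  rcases Int.even_or_odd a with h | h
  · simp [sgn, Int.negOnePow_even _ h]
  · simp [sgn, Int.negOnePow_odd _ h]

theorem sgn_natCast (n : ℕ) : sgn K n = (-1) ^ n := by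
  simp [sgn, Int.negOnePow_def]

theorem sgn_congr {a b : ℤ} (h : (a : ZMod 2) = b) : sgn K a = sgn K b := by
  have : ((b - a : ℤ) : ZMod 2) = 0 := by push_cast; rw [h, sub_self]
  rw [ZMod.intCast_zmod_eq_zero_iff_dvd] at this
  obtain ⟨c, hc⟩ := this
  obtain rfl : b = a + (c + c) := by push_cast at hc; linarith
  rw [sgn_add, sgn_add, sgn_mul_self, mul_one]

theorem sgn_one : sgn K 1 = -1 := by simp [sgn]

theorem sgn_zero : sgn K 0 = 1 := by simp [sgn]

variable {V W : Type*} [AddCommGroup V] [Module K V] [AddCommGroup W] [Module K W]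

/-! ### The graded pre-Lie product -/

theorem single_mem_degreePart (n : ℕ) (f : Coch K V W n) :
    single n f ∈ degreePart K V W n := ⟨f, rfl⟩

theorem degreePart_cases {d : ℤ} {x : CochSpace K V W} (hx : x ∈ degreePart K V W d) :
    x = 0 ∨ ∃ (n : ℕ) (f : Coch K V W n), d = n ∧ x = single n f := by
  rcases d with n | n
  · obtain ⟨f, rfl⟩ := hx
    exact Or.inr ⟨n, f, rfl, rfl⟩
  · exact Or.inl ((Submodule.mem_bot K).1 hx)

/-- The bilinear extension of `f ∘ g` to the direct sum. -/
def circL : CochSpace K V W →ₗ[K] CochSpace K V V →ₗ[K] CochSpace K V W :=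
  extend₂ fun m n => (circ m n).compr₂ (single (m + n - 1))

theorem circL_single {m n : ℕ} (f : Coch K V W m) (g : Coch K V V n) :
    circL (single m f) (single n g) = single (m + n - 1) (circ m n f g) :=
  extend₂_single _ m n f g

theorem circL_single_zero (f : Coch K V W 0) {n : ℕ} (g : Coch K V V n) :
    circL (single 0 f) (single n g) = 0 := by
  rw [circL_single, circ]; simp

theorem circL_mem {a b : ℤ} {x : CochSpace K V W} {y : CochSpace K V V}
    (hx : x ∈ degreePart K V W a) (hy : y ∈ degreePart K V V b) :
    circL x y ∈ degreePart K V W (a + b - 1) := by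
  rcases degreePart_cases hx with rfl | ⟨m, f, rfl, rfl⟩
  · simp
  rcases degreePart_cases hy with rfl | ⟨n, g, rfl, rfl⟩
  · simp
  -- An outer map of arity zero is separate because `m + n - 1` is a truncated subtraction; the
  -- composite is then an empty sum.
  rcases m with _ | m
  · rw [circL_single_zero]; exact zero_mem _
  · rw [circL_single, show ((m + 1 : ℕ) : ℤ) + n - 1 = ((m + 1 + n - 1 : ℕ) : ℤ) by
      rw [Nat.add_right_comm, Nat.add_sub_cancel]; push_cast; ring]
    exact single_mem_degreePart _ _

theorem toWords_circL (x : CochSpace K V W) {n : ℕ} (g : Coch K V V n) :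
    toWords (circL x (single n g)) =
      ins ((-1 : K) ^ (n + 1)) (toWords (single n g)) (toWords x) := by
  funext w
  induction x using DirectSum.induction_on with
  | zero =>
    have := ins_smul ((-1 : K) ^ (n + 1)) (toWords (single n g)) (0 : K) (0 : List V → W) w
    simp only [zero_smul] at this
    simp [this]
  | of m f =>
    exact congrFun ((congrArg toWords (circL_single f g)).trans (toWords_circ f g)) w
  | add x y hx hy =>
    simp only [map_add, LinearMap.add_apply, Pi.add_apply, hx, hy, ins_add]

theorem ins_zero (ε : K) {φ : List V → W} (hφ : IsMultilin K φ) :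
    ins ε (0 : List V → V) φ = 0 := by
  funext w
  refine (Submodule.mem_bot K).1 (ins_mem ⊥ ε 0 φ w fun a b c _ => ?_)
  simpa using (hφ.smul a) (0 : K) 0 c

theorem toWords_circL_circL (x : CochSpace K V W) {m n : ℕ} (f : Coch K V V m)
    (g : Coch K V V n) :
    toWords (circL x (circL (single m f) (single n g))) =
      ins ((-1 : K) ^ (m + 1) * (-1) ^ (n + 1))
        (toWords (circL (single m f) (single n g))) (toWords x) := by
  rcases m with _ | m
  · rw [circL_single_zero, map_zero, map_zero, map_zero, ins_zero _ (isMultilin_toWords x)]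
  · rw [circL_single, toWords_circL]
    congr 1
    rw [← pow_add, show m + 1 + 1 + (n + 1) = m + 1 + n - 1 + 1 + 2 by omega, pow_add _ _ 2]
    simp

/-- Only the inserted maps need to be homogeneous, since the signs do not involve the arity of `x`.
-/
theorem circL_preLie (x : CochSpace K V W) {b c : ℤ} {y z : CochSpace K V V}
    (hy : y ∈ degreePart K V V b) (hz : z ∈ degreePart K V V c) :
    circL (circL x y) z - circL x (circL y z) =
      sgn K ((b + 1) * (c + 1)) • (circL (circL x z) y - circL x (circL z y)) := by
  rcases degreePart_cases hy with rfl | ⟨m, f, rfl, rfl⟩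
  · simp
  rcases degreePart_cases hz with rfl | ⟨n, g, rfl, rfl⟩
  · simp
  apply toWords_injective
  funext w
  have := assocIns_symm (isMultilin_toWords x) (F := toWords (single m f))
    (G := toWords (single n g)) (fun b hb => toWords_single_ne f hb)
    (fun b hb => toWords_single_ne g hb) w
  simp only [assocIns, ← toWords_circL, ← toWords_circL_circL] at this
  rw [show ((m : ℤ) + 1) * (n + 1) = (((m + 1) * (n + 1) : ℕ) : ℤ) by push_cast; ring, sgn_natCast]
  simpa using this

/-! ### The Gerstenhaber bracket -/

theorem gerstenhaber_eq {a b : ℤ} {x y : CochSpace K V V} (hx : x ∈ degreePart K V V a)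
    (hy : y ∈ degreePart K V V b) :
    gerstenhaber x y = circL x y - sgn K ((a + 1) * (b + 1)) • circL y x := by
  rcases degreePart_cases hx with rfl | ⟨m, f, rfl, rfl⟩
  · simp
  rcases degreePart_cases hy with rfl | ⟨n, g, rfl, rfl⟩
  · simp
  rw [show ((m : ℤ) + 1) * (n + 1) = (((m + 1) * (n + 1) : ℕ) : ℤ) by push_cast; ring, sgn_natCast,
    gerstenhaber, extend₂_single, circL_single, circL_single]
  rfl

theorem gerstenhaber_mem {a b : ℤ} {x y : CochSpace K V V} (hx : x ∈ degreePart K V V a)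
    (hy : y ∈ degreePart K V V b) : gerstenhaber x y ∈ degreePart K V V (a + b - 1) := by
  rw [gerstenhaber_eq hx hy]
  refine sub_mem (circL_mem hx hy) (Submodule.smul_mem _ _ ?_)
  rw [add_comm a b]
  exact circL_mem hy hx

theorem gerstenhaber_skew {a b : ℤ} {x y : CochSpace K V V} (hx : x ∈ degreePart K V V a)
    (hy : y ∈ degreePart K V V b) :
    gerstenhaber x y = -(sgn K ((a + 1) * (b + 1)) • gerstenhaber y x) := by
  rw [gerstenhaber_eq hx hy, gerstenhaber_eq hy hx, smul_sub, smul_smul, mul_comm (b + 1),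
    sgn_mul_self]
  module

/-- The graded Jacobi identity, as for the commutator of any graded pre-Lie product: it is a signed
sum of the three pre-Lie identities with `x`, `y`, `z` outermost. The signs are those of degrees
shifted by one. -/
theorem gerstenhaber_leibniz {a b c : ℤ} {x y z : CochSpace K V V} (hx : x ∈ degreePart K V V a)
    (hy : y ∈ degreePart K V V b) (hz : z ∈ degreePart K V V c) :
    gerstenhaber (gerstenhaber x y) z = gerstenhaber x (gerstenhaber y z) +
      sgn K ((b + 1) * (c + 1)) • gerstenhaber (gerstenhaber x z) y := by
  have h1 := circL_preLie x hy hz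
  have h2 := circL_preLie y hx hz
  have h3 := circL_preLie z hx hy
  have e1 : sgn K ((a + b - 1 + 1) * (c + 1)) =
      sgn K ((a + 1) * (c + 1)) * sgn K ((b + 1) * (c + 1)) := by
    rw [← sgn_add]; apply sgn_congr; push_cast; ring_nf; reduce_mod_char
  have e2 : sgn K ((a + 1) * (b + c - 1 + 1)) =
      sgn K ((a + 1) * (b + 1)) * sgn K ((a + 1) * (c + 1)) := by
    rw [← sgn_add]; apply sgn_congr; push_cast; ring_nf; reduce_mod_char
  have e3 : sgn K ((a + c - 1 + 1) * (b + 1)) =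
      sgn K ((a + 1) * (b + 1)) * sgn K ((b + 1) * (c + 1)) := by
    rw [← sgn_add]; apply sgn_congr; push_cast; ring_nf; reduce_mod_char
  rw [gerstenhaber_eq (gerstenhaber_mem hx hy) hz, gerstenhaber_eq hx (gerstenhaber_mem hy hz),
    gerstenhaber_eq (gerstenhaber_mem hx hz) hy, e1, e2, e3, gerstenhaber_eq hx hy,
    gerstenhaber_eq hy hz, gerstenhaber_eq hx hz]
  have sX := sgn_mul_self (K := K) ((a + 1) * (b + 1))
  have sY := sgn_mul_self (K := K) ((a + 1) * (c + 1))
  have sZ := sgn_mul_self (K := K) ((b + 1) * (c + 1))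
  generalize sgn K ((a + 1) * (b + 1)) = X at *
  generalize sgn K ((a + 1) * (c + 1)) = Y at *
  generalize sgn K ((b + 1) * (c + 1)) = Z at *
  simp only [map_sub, map_smul, LinearMap.sub_apply, LinearMap.smul_apply]
  linear_combination (norm := module) h1 - X • h2 + (Y * Z) • h3 +
    sZ • (X • circL y (circL x z) - (X * Y) • circL y (circL z x))

end Graded

/-! ### The weight grading on multilinear maps of `A ⊕ M` -/

section Weights

variable {K A M : Type*} [Field K] [NonUnitalRing A] [Module K A] [IsScalarTower K A A]
  [SMulCommClass K A A] [AddCommGroup M] [Module K M]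

theorem toWords_eq_zero_of_mem {V W : Type*} [AddCommGroup V] [Module K V] [AddCommGroup W]
    [Module K W] (x : CochSpace K V W) {w : List V} (h : 0 ∈ w) : toWords x w = 0 := by
  obtain ⟨a, c, rfl⟩ := List.append_of_mem h
  simpa using (isMultilin_toWords x).smul a (0 : K) 0 c

theorem lift_single (n : ℕ) (f : Coch K M A n) :
    lift (single n f) = single n ((LinearMap.inl K A M).compMultilinearMap
      (f.compLinearMap fun _ => LinearMap.snd K A M)) :=
  extend₁_single _ n f

theorem component_single (n : ℕ) (f : Coch K (A × M) (A × M) n) :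
    component (single n f) = single n ((LinearMap.fst K A M).compMultilinearMap
      (f.compLinearMap fun _ => LinearMap.inr K A M)) :=
  extend₁_single _ n f

theorem toWords_lift (x : CochSpace K M A) (w : List (A × M)) :
    toWords (lift x) w = (toWords x (w.map Prod.snd), 0) := by
  induction x using DirectSum.induction_on with
  | zero => simp; rfl
  | of n f =>
    change toWords (lift (single n f)) w = (toWords (single n f) (w.map Prod.snd), 0)
    rw [lift_single]
    by_cases h : w.length = n
    · rw [toWords_single _ h (v := fun i => w[i.1]) fun _ _ => rfl,
        toWords_single _ (by simpa using h) (v := fun i => w[i.1].2) fun _ _ => by simp]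
      rfl
    · rw [toWords_single_ne _ h, toWords_single_ne _ (by simpa using h)]; rfl
  | add x y hx hy => simp [hx, hy]

theorem toWords_component (x : CochSpace K (A × M) (A × M)) (w : List M) :
    toWords (component x) w = (toWords x (w.map fun u => (0, u))).1 := by
  induction x using DirectSum.induction_on with
  | zero => simp
  | of n f =>
    change toWords (component (single n f)) w = (toWords (single n f) (w.map fun u => (0, u))).1
    rw [component_single]
    by_cases h : w.length = n
    · rw [toWords_single _ h (v := fun i => w[i.1]) fun _ _ => rfl,
        toWords_single _ (by simpa using h) (v := fun i => (0, w[i.1])) fun _ _ => by simp]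
      rfl
    · rw [toWords_single_ne _ h, toWords_single_ne _ (by simpa using h)]; rfl
  | add x y hx hy => simp [hx, hy]

theorem component_lift (x : CochSpace K M A) : component (lift x) = x := by
  apply toWords_injective
  funext w
  simp [toWords_component, toWords_lift, Function.comp_def]

theorem lift_mem {d : ℤ} {x : CochSpace K M A} (hx : x ∈ degreePart K M A d) :
    lift x ∈ degreePart K (A × M) (A × M) d := by
  rcases degreePart_cases hx with rfl | ⟨n, f, rfl, rfl⟩
  · simp
  · rw [lift_single]; exact single_mem_degreePart _ _

theorem component_mem {d : ℤ} {x : CochSpace K (A × M) (A × M)}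
    (hx : x ∈ degreePart K (A × M) (A × M) d) : component x ∈ degreePart K M A d := by
  rcases degreePart_cases hx with rfl | ⟨n, f, rfl, rfl⟩
  · simp
  · rw [component_single]; exact single_mem_degreePart _ _

/-- A homogeneous letter of `A ⊕ M`. -/
def letter : A ⊕ M → A × M := Sum.elim (fun a => (a, 0)) fun u => (0, u)

/-- The number of letters of a word that lie in `A`. -/
def countA (w : List (A ⊕ M)) : ℤ := w.countP Sum.isLeft

theorem countA_append (v w : List (A ⊕ M)) : countA (v ++ w) = countA v + countA w := by
  simp [countA]

theorem countA_cons (x : A ⊕ M) (w : List (A ⊕ M)) :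
    countA (x :: w) = countA w + if x.isLeft then 1 else 0 := by
  simp only [countA, List.countP_cons]; push_cast; rfl

theorem countA_nil : countA ([] : List (A ⊕ M)) = 0 := rfl

theorem countA_nonneg (w : List (A ⊕ M)) : 0 ≤ countA w := Int.natCast_nonneg _

/-- The maps of weight `j`: those raising by `-j` the number of tensor factors in `A`. -/
def weight (K A M : Type*) [Field K] [NonUnitalRing A] [Module K A] [AddCommGroup M] [Module K M]
    (j : ℤ) : Submodule K (CochSpace K (A × M) (A × M)) where
  carrier := {x | ∀ w : List (A ⊕ M),
    (countA w - 1 ≠ j → (toWords x (w.map letter)).1 = 0) ∧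
    (countA w ≠ j → (toWords x (w.map letter)).2 = 0)}
  zero_mem' w := by simp
  add_mem' {x y} hx hy w :=
    ⟨fun h => by simp [(hx w).1 h, (hy w).1 h], fun h => by simp [(hx w).2 h, (hy w).2 h]⟩
  smul_mem' c x hx w := ⟨fun h => by simp [(hx w).1 h], fun h => by simp [(hx w).2 h]⟩

/-- Each letter of `A × M` is a sum of one in `A` and one in `M`, so by multilinearity the words of
homogeneous letters suffice. The induction converts letters one at a time into the homogeneous
prefix `a`. -/
theorem ext_letters {x y : CochSpace K (A × M) (A × M)}
    (h : ∀ w : List (A ⊕ M), toWords x (w.map letter) = toWords y (w.map letter)) : x = y := by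
  have key : ∀ (w : List (A × M)) (a : List (A ⊕ M)),
      toWords x (a.map letter ++ w) = toWords y (a.map letter ++ w) := by
    intro w
    induction w with
    | nil => intro a; simpa using h a
    | cons v w ih =>
      intro a
      have e : v = (v.1, 0) + (0, v.2) := by simp
      have h1 := ih (a ++ [Sum.inl v.1])
      have h2 := ih (a ++ [Sum.inr v.2])
      simp only [List.map_append, List.map_cons, List.map_nil, letter, Sum.elim_inl, Sum.elim_inr,
        List.append_assoc, List.cons_append, List.nil_append] at h1 h2
      have hx := (isMultilin_toWords x).add (a.map letter) (v.1, 0) (0, v.2) w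
      have hy := (isMultilin_toWords y).add (a.map letter) (v.1, 0) (0, v.2) w
      rw [e]
      exact hx.trans ((congrArg₂ _ h1 h2).trans hy.symm)
  exact toWords_injective (funext fun w => by simpa using key w [])

theorem eq_zero_of_weight {j : ℤ} (hj : j < -1) {x : CochSpace K (A × M) (A × M)}
    (hx : x ∈ weight K A M j) : x = 0 := by
  refine ext_letters fun w => ?_
  have := countA_nonneg w
  rw [map_zero]
  exact Prod.ext ((hx w).1 (by omega)) ((hx w).2 (by omega))

theorem zero_mem_map_snd {w : List (A ⊕ M)} (h : countA w ≠ 0) :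
    (0 : M) ∈ (w.map letter).map Prod.snd := by
  simp only [countA, ne_eq, Nat.cast_eq_zero, List.countP_eq_zero] at h
  push Not at h
  obtain ⟨x, hx, h'⟩ := h
  rcases x with a | u
  · exact List.mem_map.2 ⟨(a, 0), List.mem_map.2 ⟨_, hx, rfl⟩, rfl⟩
  · simp at h'

theorem lift_mem_weight (x : CochSpace K M A) : lift x ∈ weight K A M (-1) := by
  refine fun w => ⟨fun h => ?_, fun _ => by rw [toWords_lift]⟩
  rw [toWords_lift]
  exact toWords_eq_zero_of_mem x (zero_mem_map_snd (by omega))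

theorem map_letter_of_countA {w : List (A ⊕ M)} (h : countA w = 0) :
    ((w.map letter).map Prod.snd).map (fun u => ((0 : A), u)) = w.map letter := by
  simp only [countA, Nat.cast_eq_zero, List.countP_eq_zero] at h
  simp only [List.map_map, List.map_inj_left]
  intro x hx
  rcases x with a | u
  · exact absurd rfl (h _ hx)
  · rfl

/-- Weight `-1` forces no input in `A` and output in `A`, since the number of inputs in `A` is
nonnegative. -/
theorem lift_component {x : CochSpace K (A × M) (A × M)} (hx : x ∈ weight K A M (-1)) :
    lift (component x) = x := by
  refine ext_letters fun w => ?_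
  rw [toWords_lift]
  by_cases h : countA w = 0
  · rw [toWords_component, map_letter_of_countA h]
    exact Prod.ext rfl ((hx w).2 (by omega)).symm
  · rw [toWords_eq_zero_of_mem _ (zero_mem_map_snd h)]
    have := countA_nonneg w
    exact Prod.ext ((hx w).1 (by omega)).symm ((hx w).2 (by omega)).symm

/-- For a fixed number of letters in `A`, at most one of the two components of the inner value can
be nonzero. The inner value is therefore again a homogeneous letter, or zero, and counting letters
in `A` before and after the substitution adds the weights. -/
theorem circL_mem_weight {i j b : ℤ} {x y : CochSpace K (A × M) (A × M)}
    (hx : x ∈ weight K A M i) (hy : y ∈ weight K A M j)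
    (hb : y ∈ degreePart K (A × M) (A × M) b) : circL x y ∈ weight K A M (i + j) := by
  rcases degreePart_cases hb with rfl | ⟨n, g, rfl, rfl⟩
  · simp
  have key : ∀ (w : List (A ⊕ M)) (a b c : List (A × M)), w.map letter = a ++ b ++ c →
      (countA w - 1 ≠ i + j → (toWords x (a ++ toWords (single n g) b :: c)).1 = 0) ∧
      (countA w ≠ i + j → (toWords x (a ++ toWords (single n g) b :: c)).2 = 0) := by
    intro w a b c h
    obtain ⟨w', c, rfl, h', rfl⟩ := List.map_eq_append_iff.1 h
    obtain ⟨a, b, rfl, rfl, rfl⟩ := List.map_eq_append_iff.1 h'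
    rw [countA_append, countA_append]
    obtain ⟨h1, h2⟩ := hy b
    by_cases e1 : countA b - 1 = j
    · have e : toWords (single n g) (b.map letter) =
          letter (Sum.inl (toWords (single n g) (b.map letter)).1) :=
        Prod.ext rfl (h2 (by omega))
      have := hx (a ++ Sum.inl (toWords (single n g) (b.map letter)).1 :: c)
      rw [List.map_append, List.map_cons, ← e, countA_append, countA_cons] at this
      simp only [Sum.isLeft_inl, if_true] at this
      exact ⟨fun h => this.1 (by omega), fun h => this.2 (by omega)⟩
    · have e : toWords (single n g) (b.map letter) =
          letter (Sum.inr (toWords (single n g) (b.map letter)).2) :=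
        Prod.ext (h1 e1) rfl
      by_cases e2 : countA b = j
      · have := hx (a ++ Sum.inr (toWords (single n g) (b.map letter)).2 :: c)
        rw [List.map_append, List.map_cons, ← e, countA_append, countA_cons] at this
        simp only [Sum.isLeft_inr] at this
        exact ⟨fun h => this.1 (by simp; omega), fun h => this.2 (by simp; omega)⟩
      · rw [e, h2 e2]
        have : toWords x (a.map letter ++ letter (Sum.inr 0) :: c.map letter) = 0 :=
          toWords_eq_zero_of_mem x (List.mem_append_right _ (List.mem_cons_self (a := (0 : A × M))))
        simp [this]
  intro w
  rw [toWords_circL]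
  exact ⟨fun h => ins_mem (LinearMap.ker (LinearMap.fst K A M)) _ _ _ _
      fun a b c e => (key w a b c e).1 h,
    fun h => ins_mem (LinearMap.ker (LinearMap.snd K A M)) _ _ _ _
      fun a b c e => (key w a b c e).2 h⟩

theorem gerstenhaber_mem_weight {i j a b : ℤ} {x y : CochSpace K (A × M) (A × M)}
    (hx : x ∈ weight K A M i) (hy : y ∈ weight K A M j)
    (ha : x ∈ degreePart K (A × M) (A × M) a) (hb : y ∈ degreePart K (A × M) (A × M) b) :
    gerstenhaber x y ∈ weight K A M (i + j) := by
  rw [gerstenhaber_eq ha hb]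
  refine sub_mem (circL_mem_weight hx hy hb) (Submodule.smul_mem _ _ ?_)
  rw [add_comm]
  exact circL_mem_weight hy hx ha

theorem gerstenhaber_eq_zero_of_weight {i j a b : ℤ} {x y : CochSpace K (A × M) (A × M)}
    (hx : x ∈ weight K A M i) (hy : y ∈ weight K A M j)
    (ha : x ∈ degreePart K (A × M) (A × M) a) (hb : y ∈ degreePart K (A × M) (A × M) b)
    (h : i + j < -1) : gerstenhaber x y = 0 :=
  eq_zero_of_weight h (gerstenhaber_mem_weight hx hy ha hb)

/-! ### The semidirect product and the cocycle -/

/-- The cocycle `H` as a bilinear map on `A ⊕ M`. -/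
def extendH (H : A →ₗ[K] A →ₗ[K] M) : (A × M) →ₗ[K] (A × M) →ₗ[K] (A × M) :=
  (H.compl₁₂ (LinearMap.fst K A M) (LinearMap.fst K A M)).compr₂ (LinearMap.inr K A M)

@[simp] theorem extendH_apply (H : A →ₗ[K] A →ₗ[K] M) (x y : A × M) :
    extendH H x y = (0, H x.1 y.1) := rfl

@[simp] theorem mulLR_apply (β : Bimod K A M) (x y : A × M) :
    β.mulLR x y = (x.1 * y.1, β.left x.1 y.2 + β.right x.2 y.1) := rfl

@[simp] theorem ofBilinear_apply {V W : Type*} [AddCommGroup V] [Module K V] [AddCommGroup W]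
    [Module K W] (B : V →ₗ[K] V →ₗ[K] W) (x : Fin 2 → V) : ofBilinear B x = B (x 0) (x 1) := rfl

/-- A bilinear map, seen in the direct sum. -/
abbrev binary {V : Type*} [AddCommGroup V] [Module K V] (B : V →ₗ[K] V →ₗ[K] V) :
    CochSpace K V V := single 2 (ofBilinear B)

theorem binary_mem {V : Type*} [AddCommGroup V] [Module K V] (B : V →ₗ[K] V →ₗ[K] V) :
    binary B ∈ degreePart K V V 2 := single_mem_degreePart 2 _

theorem toWords_binary {V : Type*} [AddCommGroup V] [Module K V] (B : V →ₗ[K] V →ₗ[K] V)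
    (x y : V) : toWords (binary B) [x, y] = B x y :=
  toWords_single (n := 2) _ (v := ![x, y]) rfl fun j hj => by
    rcases j with _ | _ | j
    · rfl
    · rfl
    · omega

theorem binary_mem_weight {B : (A × M) →ₗ[K] (A × M) →ₗ[K] (A × M)} {j : ℤ}
    (h : ∀ x y : A ⊕ M, (countA [x, y] - 1 ≠ j → (B (letter x) (letter y)).1 = 0) ∧
      (countA [x, y] ≠ j → (B (letter x) (letter y)).2 = 0)) :
    binary B ∈ weight K A M j := by
  intro w
  by_cases hw : w.length = 2
  · obtain ⟨x, y, rfl⟩ := List.length_eq_two.1 hw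
    simpa [toWords_binary] using h x y
  · rw [toWords_single_ne _ (by simpa using hw)]; simp

theorem mulLR_mem_weight (β : Bimod K A M) : binary β.mulLR ∈ weight K A M 1 := by
  refine binary_mem_weight fun x y => ?_
  rcases x with a | u <;> rcases y with b | v <;> simp [countA_cons, countA_nil, letter]

theorem extendH_mem_weight (H : A →ₗ[K] A →ₗ[K] M) : binary (extendH H) ∈ weight K A M 2 := by
  refine binary_mem_weight fun x y => ?_
  rcases x with a | u <;> rcases y with b | v <;> simp [countA_cons, countA_nil, letter]

/-- Arity two is odd in the shifted degree, so the bracket of `B` and `C` is `B ∘ C + C ∘ B`. This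
one computation serves for all three relations between the product and the cocycle. -/
theorem gerstenhaber_binary {V : Type*} [AddCommGroup V] [Module K V]
    (B C : V →ₗ[K] V →ₗ[K] V)
    (h : ∀ x y z, B (C x y) z - B x (C y z) + (C (B x y) z - C x (B y z)) = 0) :
    gerstenhaber (binary B) (binary C) = 0 := by
  rw [gerstenhaber_eq (binary_mem B) (binary_mem C), circL_single, circL_single]
  have hs : sgn K ((2 + 1) * (2 + 1)) = -1 := by
    rw [show ((2 + 1) * (2 + 1) : ℤ) = ((9 : ℕ) : ℤ) by norm_num, sgn_natCast]; norm_num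
  rw [hs]
  have e : circ 2 2 (ofBilinear B) (ofBilinear C) -
      (-1 : K) • circ 2 2 (ofBilinear C) (ofBilinear B) = 0 := by
    ext x
    have := h (x 0) (x 1) (x 2)
    simp [circ, Fin.sum_univ_two, partialComp, insertArgs]
    linear_combination (norm := module) this
  rw [← map_smul, ← map_sub]
  exact (congrArg _ e).trans (map_zero _)

end Weights

/-! ### The ternary bracket as an iterated Gerstenhaber bracket with the cocycle -/

section Ternary

variable {K A M : Type*} [Field K] [NonUnitalRing A] [Module K A] [IsScalarTower K A A]
  [SMulCommClass K A A] [AddCommGroup M] [Module K M]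

/-- A lift sees only the `M`-components of its arguments, hence annihilates anything inserted with
values in `A`. -/
theorem circL_lift_eq_zero (x : CochSpace K M A) {b : ℤ} {y : CochSpace K (A × M) (A × M)}
    (hy : y ∈ degreePart K (A × M) (A × M) b) (h : ∀ w, (toWords y w).2 = 0) :
    circL (lift x) y = 0 := by
  rcases degreePart_cases hy with rfl | ⟨n, g, rfl, rfl⟩
  · simp
  apply toWords_injective
  funext w
  rw [toWords_circL, map_zero]
  refine (Submodule.mem_bot K).1 (ins_mem ⊥ _ _ _ w fun a b c _ => ?_)
  rw [Submodule.mem_bot, toWords_lift, toWords_eq_zero_of_mem]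
  · rfl
  · simp [h]

theorem toWords_circL_mem {V W : Type*} [AddCommGroup V] [Module K V] [AddCommGroup W]
    [Module K W] (S : Submodule K W) {x : CochSpace K V W} (hx : ∀ w, toWords x w ∈ S) {b : ℤ}
    {y : CochSpace K V V} (hy : y ∈ degreePart K V V b) (w : List V) :
    toWords (circL x y) w ∈ S := by
  rcases degreePart_cases hy with rfl | ⟨n, g, rfl, rfl⟩
  · simp
  rw [toWords_circL]
  exact ins_mem S _ _ _ w fun a b c _ => hx _

theorem toWords_circL_lift (x : CochSpace K M A) {b : ℤ} {y : CochSpace K (A × M) (A × M)}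
    (hy : y ∈ degreePart K (A × M) (A × M) b) (w : List (A × M)) :
    (toWords (circL (lift x) y) w).2 = 0 :=
  toWords_circL_mem (LinearMap.ker (LinearMap.snd K A M)) (fun w => by simp [toWords_lift]) hy w

theorem circL_lift_lift (x : CochSpace K M A) {b : ℤ} {y : CochSpace K M A}
    (hy : y ∈ degreePart K M A b) : circL (lift x) (lift y) = 0 :=
  circL_lift_eq_zero x (lift_mem hy) fun w => by simp [toWords_lift]

/-- By the pre-Lie identity the associator equals, up to sign, the one with `y` and `z` exchanged;
there both terms vanish because values in `A` are fed to a lift. -/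
theorem circL_circL_lift (x : CochSpace K M A) {b c : ℤ} {y : CochSpace K (A × M) (A × M)}
    {z : CochSpace K M A} (hy : y ∈ degreePart K (A × M) (A × M) b)
    (hz : z ∈ degreePart K M A c) :
    circL (circL (lift x) y) (lift z) = circL (lift x) (circL y (lift z)) := by
  have := circL_preLie (lift x) hy (lift_mem hz)
  rw [circL_lift_lift x hz, circL_lift_eq_zero x (circL_mem (lift_mem hz) hy)
    (toWords_circL_lift z hy)] at this
  simpa [sub_eq_zero] using this

/-- On words in `M` the outer lift reads only the `M`-component of the inner value, so the
composition can be computed inside `M`. -/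
theorem component_circL_lift (x : CochSpace K M A) {b : ℤ} {y : CochSpace K (A × M) (A × M)}
    {z : CochSpace K M M} (hy : y ∈ degreePart K (A × M) (A × M) b) (hz : z ∈ degreePart K M M b)
    (h : ∀ w : List M, (toWords y (w.map fun u => (0, u))).2 = toWords z w) :
    component (circL (lift x) y) = circL x z := by
  rcases b with n | n
  swap
  · obtain rfl := (Submodule.mem_bot K).1 hy
    obtain rfl := (Submodule.mem_bot K).1 hz
    simp
  obtain ⟨y, rfl⟩ := hy
  obtain ⟨z, rfl⟩ := hz
  apply toWords_injective
  funext w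
  rw [toWords_component, toWords_circL, toWords_circL]
  have head : ∀ (w : List M) (G : List (A × M) → A × M) (G' : List M → M)
      (_ : ∀ w : List M, (G (w.map fun u => (0, u))).2 = G' w) (φ : List (A × M) → A × M)
      (φ' : List M → A) (_ : ∀ w, (φ w).1 = φ' (w.map Prod.snd)),
      (insHead G φ (w.map fun u => (0, u))).1 = insHead G' φ' w := by
    intro w
    induction w with
    | nil => intro G G' hG φ φ' hφ; simpa [insHead, hφ] using congrArg (fun t => φ' [t]) (hG [])
    | cons x w ih =>
      intro G G' hG φ φ' hφ
      have h0 : (G []).2 = G' [] := hG []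
      have := ih (fun b => G ((0, x) :: b)) (fun b => G' (x :: b)) (fun b => hG (x :: b)) φ φ' hφ
      simp [insHead, hφ, h0, this, Function.comp_def]
  have key : ∀ (w : List M) (φ : List (A × M) → A × M)
      (φ' : List M → A) (_ : ∀ w, (φ w).1 = φ' (w.map Prod.snd)),
      (ins ((-1 : K) ^ (n + 1)) (toWords (single n y)) φ (w.map fun u => (0, u))).1 =
        ins ((-1 : K) ^ (n + 1)) (toWords (single n z)) φ' w := by
    intro w
    induction w with
    | nil => intro φ φ' hφ; simpa [ins, hφ] using congrArg (fun t => φ' [t]) (h [])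
    | cons x w ih =>
      intro φ φ' hφ
      have h1 := head (x :: w) _ _ h φ φ' hφ
      have h2 := ih (fun c => φ ((0, x) :: c)) (fun c => φ' (x :: c)) (fun c => hφ _)
      rw [List.map_cons] at h1
      simp only [ins, List.map_cons, Prod.fst_add, Prod.smul_fst, h1, h2]
  exact key w _ _ fun w => by rw [toWords_lift]

theorem insTwo_of_support {V W : Type*} [AddCommGroup V] [Module K V] [AddCommGroup W]
    [Module K W] {n : ℕ} (ε : K) {F G : List V → V} {φ : List V → W}
    (hφ : ∀ c, φ (0 :: c) = 0) (hF : ∀ b, b.length ≠ n → F b = 0) (w : List V) :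
    insTwo ε G F φ w =
      if n ≤ w.length then ε ^ n • ins ε G (fun c => φ (F (w.take n) :: c)) (w.drop n) else 0 := by
  have h0 : ∀ w, ins ε G (fun c => φ (0 :: c)) w = 0 := fun w =>
    (Submodule.mem_bot K).1 (ins_mem ⊥ _ _ _ w fun a b c _ => hφ _)
  induction w generalizing F n with
  | nil =>
    rcases n with _ | n
    · simp [insTwo]
    · simp [insTwo, hF [] (by simp), h0]
  | cons x w ih =>
    rcases n with _ | n
    · have : ∀ (F : List V → V) (_ : ∀ b, F b = 0), insTwo ε G F φ w = 0 := by
        intro F hF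
        clear ih
        induction w generalizing F with
        | nil => simp [insTwo, hF, h0]
        | cons y w ih => rw [insTwo, ih _ fun b => hF _, hF, h0]; simp
      simp [insTwo, this (fun b => F (x :: b)) (fun b => hF _ (by simp))]
    · rw [insTwo, hF [] (by simp), h0, zero_add, ih (n := n) fun b hb => hF _ (by simpa using hb)]
      simp [pow_succ', smul_smul]

variable (H : A →ₗ[K] A →ₗ[K] M)

theorem toWords_extendH_of_length {w : List (A × M)} (h : w.length ≠ 2) :
    toWords (binary (extendH H)) w = 0 := toWords_single_ne _ h

theorem toWords_extendH_inr (u : M) (c : List (A × M)) :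
    toWords (binary (extendH H)) ((0, u) :: c) = 0 := by
  by_cases h : c.length = 1
  · obtain ⟨y, rfl⟩ := List.length_eq_one_iff.1 h
    rw [toWords_binary]; simp
  · exact toWords_extendH_of_length H (by simpa using h)

theorem toWords_extendH_inr' (y : A × M) (u : M) (c : List (A × M)) :
    toWords (binary (extendH H)) (y :: (0, u) :: c) = 0 := by
  by_cases h : c = []
  · subst h; rw [toWords_binary]; simp
  · exact toWords_extendH_of_length H (by simpa using h)

/-- The first slot of `H` is already taken by `y`, and a letter of `M` in the second slot gives
zero. So `G` must consume the entire remaining word. -/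
theorem ins_extendH {n : ℕ} (ε : K) {G : List (A × M) → A × M}
    (hG : ∀ b, b.length ≠ n → G b = 0) (y : A × M) (w : List M) :
    ins ε G (fun c => toWords (binary (extendH H)) (y :: c)) (w.map fun u => (0, u)) =
      (0, H y.1 (G (w.map fun u => (0, u))).1) := by
  rcases w with _ | ⟨x, w⟩
  · simp only [ins, List.map_nil]; rw [toWords_binary]; rfl
  · have h0 : ∀ c, toWords (binary (extendH H)) (y :: (0 : A × M) :: c) = 0 :=
      fun c => toWords_extendH_inr' H y 0 c
    have h1 : (fun c => toWords (binary (extendH H)) (y :: (0, x) :: c)) = 0 :=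
      funext fun c => toWords_extendH_inr' H y x c
    have h2 : ins ε G (0 : List (A × M) → A × M) (w.map fun u => (0, u)) = 0 :=
      (Submodule.mem_bot K).1 (ins_mem ⊥ _ _ _ _ fun a b c _ => rfl)
    rw [List.map_cons, ins, h1, h2, smul_zero, add_zero, insHead_of_support h0 hG]
    by_cases h : w.length + 1 = n
    · subst h
      have e1 : ((0, x) :: w.map fun u => ((0 : A), u)).take (w.length + 1) =
          (0, x) :: w.map fun u => (0, u) := List.take_of_length_le (by simp)
      have e2 : ((0, x) :: w.map fun u => ((0 : A), u)).drop (w.length + 1) = [] :=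
        List.drop_of_length_le (by simp)
      rw [e1, e2, toWords_binary]
      simp
    · rw [hG ((0, x) :: w.map fun u => ((0 : A), u)) (by simpa using h)]
      split_ifs with h'
      · rw [toWords_extendH_of_length]
        · simp; rfl
        · simp only [List.length_cons, List.length_map, List.length_drop] at h' ⊢
          omega
      · simp; rfl

theorem toWords_cupH {q r : ℕ} (Q : Coch K M A q) (R : Coch K M A r) (w : List M) :
    toWords (single (q + r) (cupH H q r Q R)) w = if q ≤ w.length then
      H (toWords (single q Q) (w.take q)) (toWords (single r R) (w.drop q)) else 0 := by
  by_cases h : w.length = q + r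
  · rw [toWords_single _ h (v := fun i => w[i.1]) fun _ _ => rfl, if_pos (by omega),
      toWords_single (n := q) (v := fun i => w[i.1]) _ (by simp; omega) fun _ _ => by simp,
      toWords_single (n := r) (v := fun i => w[q + i.1]) _ (by simp; omega) fun _ _ => by simp]
    rfl
  · rw [toWords_single_ne _ h]
    split_ifs with h'
    · rw [toWords_single_ne (n := r) _ (by simp; omega)]; simp
    · rfl

theorem insTwo_extendH {q r : ℕ} (Q : Coch K M A q) (R : Coch K M A r) (w : List M) :
    (insTwo ((-1 : K) ^ (r + 1)) (toWords (lift (single r R))) (toWords (lift (single q Q)))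
      (toWords (binary (extendH H))) (w.map fun u => (0, u))).2 =
      (-1 : K) ^ (q * (r + 1)) • toWords (single (q + r) (cupH H q r Q R)) w := by
  have hs : ∀ {n : ℕ} (P : Coch K M A n) (b : List (A × M)), b.length ≠ n →
      toWords (lift (single n P)) b = 0 := fun P b hb => by
    rw [lift_single]; exact toWords_single_ne _ hb
  rw [insTwo_of_support (n := q) _ (fun c => toWords_extendH_inr H 0 c) (hs Q), toWords_cupH,
    List.length_map]
  split_ifs with h
  · rw [← List.map_drop, ins_extendH H _ (hs R), ← List.map_take, toWords_lift, toWords_lift,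
      ← pow_mul, mul_comm (r + 1)]
    simp [Function.comp_def]
  · simp

/-- Both inputs of `H` are filled. -/
theorem toWords_circL_circL_extendH {q r : ℕ} (Q : Coch K M A q) (R : Coch K M A r)
    (w : List M) :
    (toWords (circL (circL (binary (extendH H)) (lift (single q Q))) (lift (single r R)))
      (w.map fun u => (0, u))).2 =
      (-1 : K) ^ (q * (r + 1)) • toWords (single (q + r) (cupH H q r Q R)) w +
      ((-1 : K) ^ ((q + 1) * (r + 1)) * (-1 : K) ^ (r * (q + 1))) •
        toWords (single (r + q) (cupH H r q R Q)) w := by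
  have hs : ∀ {n : ℕ} (P : Coch K M A n) (b : List (A × M)), b.length ≠ n →
      toWords (lift (single n P)) b = 0 := fun P b hb => by
    rw [lift_single]; exact toWords_single_ne _ hb
  have hX := isMultilin_toWords (binary (extendH H))
  -- The lifts of `Q` and `R` compose to zero, so the double composition equals its own associator.
  have e : toWords (circL (circL (binary (extendH H)) (lift (single q Q))) (lift (single r R)))
      (w.map fun u => (0, u)) = assocIns ((-1 : K) ^ (q + 1)) ((-1) ^ (r + 1))
        (toWords (lift (single q Q))) (toWords (lift (single r R))) (toWords (binary (extendH H)))
        (w.map fun u => (0, u)) := by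
    have h0 := circL_lift_lift (single q Q) (single_mem_degreePart r R)
    simp only [lift_single] at h0 ⊢
    have h1 := toWords_circL_circL (binary (extendH H)) ((LinearMap.inl K A M).compMultilinearMap
      (Q.compLinearMap fun _ => LinearMap.snd K A M)) ((LinearMap.inl K A M).compMultilinearMap
      (R.compLinearMap fun _ => LinearMap.snd K A M))
    rw [assocIns, ← toWords_circL, ← toWords_circL, ← toWords_circL, ← h1, h0]
    simp
  have hk := insSign (F := toWords (lift (single q Q))) (m := q) hX (hs R)
  rw [e, ← insTwo_extendH, ← smul_smul, ← insTwo_extendH, ← Prod.smul_snd, ← Prod.snd_add]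
  congr 1
  -- The recursive term of `assocIns_cons` vanishes because a letter `x` of `M` would occupy the
  -- first slot of `H`. The two terms with disjoint blocks remain, one for each order of `Q` and
  -- `R`.
  rcases w with _ | ⟨x, w⟩
  · have := hk [] []
    simp only [List.length_nil, pow_zero, mul_one] at this
    rw [List.map_nil, assocIns_nil, insTwo, insTwo, this]
  · have : (fun c => toWords (binary (extendH H)) ((0, x) :: c)) = 0 :=
      funext fun c => toWords_extendH_inr H x c
    have h0 : ∀ (F G : List (A × M) → A × M) (ε δ : K), assocIns ε δ F G
        (0 : List (A × M) → A × M) (w.map fun u => (0, u)) = 0 := fun F G ε δ => by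
      have hz : ∀ (ε : K) (F : List (A × M) → A × M), ins ε F (0 : List (A × M) → A × M) = 0 :=
        fun ε F => funext fun w => (Submodule.mem_bot K).1 (ins_mem ⊥ _ _ _ _ fun a b c _ => rfl)
      simp [assocIns, hz]
    rw [List.map_cons, assocIns_cons _ _ _ _ _ hX.headAdd hX.headSMul hk, this, h0, smul_zero,
      zero_add]

/-- In the full expansion the terms with a lift outermost and both slots of `H` filled survive. A
lift composed with values in `A` is zero, and filling `H` with all three lifts is zero as well. -/
theorem gerstenhaber_extendH {p q r : ℤ} {x y z : CochSpace K M A} (hx : x ∈ degreePart K M A p)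
    (hy : y ∈ degreePart K M A q) (hz : z ∈ degreePart K M A r) :
    gerstenhaber (gerstenhaber (gerstenhaber (binary (extendH H)) (lift x)) (lift y)) (lift z) =
      -(sgn K (p + 1) • circL (lift x) (circL (circL (binary (extendH H)) (lift y)) (lift z)) +
        sgn K (p * (q + 1)) •
          circL (lift y) (circL (circL (binary (extendH H)) (lift x)) (lift z)) +
        sgn K ((p + q + 1) * (r + 1)) •
          circL (lift z) (circL (circL (binary (extendH H)) (lift x)) (lift y))) := by
  have hh := binary_mem (K := K) (extendH H)
  have hX := lift_mem hx
  have hY := lift_mem hy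
  have hZ := lift_mem hz
  have h1 := gerstenhaber_mem hh hX
  have h2 := gerstenhaber_mem h1 hY
  -- By weight this composite is a lift, so its values are in `A`; but `H` is outermost, so its
  -- values are in `M`.
  have z1 : circL (circL (circL (binary (extendH H)) (lift x)) (lift y)) (lift z) = 0 := by
    have w1 : circL (circL (circL (binary (extendH H)) (lift x)) (lift y)) (lift z) ∈
        weight K A M (-1) := by
      have := circL_mem_weight (circL_mem_weight (circL_mem_weight (extendH_mem_weight H)
        (lift_mem_weight x) hX) (lift_mem_weight y) hY) (lift_mem_weight z) hZ
      norm_num at this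
      exact this
    have w2 : ∀ w, toWords (circL (circL (circL (binary (extendH H)) (lift x)) (lift y)) (lift z)) w
        ∈ LinearMap.ker (LinearMap.fst K A M) :=
      toWords_circL_mem _ (toWords_circL_mem _ (toWords_circL_mem _ (fun w => by
        by_cases h : w.length = 2
        · obtain ⟨a, b, rfl⟩ := List.length_eq_two.1 h
          rw [toWords_binary]; simp
        · rw [toWords_extendH_of_length H h]; exact zero_mem _) hX) hY) hZ
    rw [← lift_component w1]
    have : component (circL (circL (circL (binary (extendH H)) (lift x)) (lift y)) (lift z)) = 0 := by
      apply toWords_injective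
      funext w
      rw [toWords_component]
      simpa using w2 (w.map fun u => (0, u))
    rw [this, map_zero]
  have z2 : circL (lift z) (circL (lift y) (circL (binary (extendH H)) (lift x))) = 0 :=
    circL_lift_eq_zero z (circL_mem hY (circL_mem hh hX)) (toWords_circL_lift y (circL_mem hh hX))
  have z3 : circL (lift z) (circL (lift x) (circL (binary (extendH H)) (lift y))) = 0 :=
    circL_lift_eq_zero z (circL_mem hX (circL_mem hh hY)) (toWords_circL_lift x (circL_mem hh hY))
  have z4 : circL (lift y) (circL (lift x) (binary (extendH H))) = 0 :=
    circL_lift_eq_zero y (circL_mem hX hh) (toWords_circL_lift x hh)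
  have e1 : sgn K ((2 + 1) * (p + 1)) = sgn K (p + 1) := by
    apply sgn_congr; push_cast; generalize (p : ZMod 2) = p'; decide +revert
  have e2 : sgn K ((2 + p - 1 + 1) * (q + 1)) = sgn K (p * (q + 1)) := by
    apply sgn_congr; push_cast
    generalize (p : ZMod 2) = p', (q : ZMod 2) = q'; decide +revert
  have e3 : sgn K ((2 + p - 1 + q - 1 + 1) * (r + 1)) = sgn K ((p + q + 1) * (r + 1)) := by
    congr 1; ring
  rw [gerstenhaber_eq h2 hZ, gerstenhaber_eq h1 hY, gerstenhaber_eq hh hX, e1, e2, e3]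
  simp only [map_sub, map_smul, LinearMap.sub_apply, LinearMap.smul_apply,
    circL_circL_lift x hh hy, circL_circL_lift x (circL_mem hh hY) hz,
    circL_circL_lift y (circL_mem hh hX) hz, z1, z2, z3, z4, map_zero, LinearMap.zero_apply]
  module

theorem component_circL_circL_extendH (x : CochSpace K M A) {q r : ℕ} (Q : Coch K M A q)
    (R : Coch K M A r) :
    component (circL (lift x) (circL (circL (binary (extendH H)) (lift (single q Q)))
      (lift (single r R)))) =
      sgn K (q * (r + 1)) • circL x (single (q + r) (cupH H q r Q R)) +
      sgn K (q + 1) • circL x (single (r + q) (cupH H r q R Q)) := by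
  have hN := circL_mem (circL_mem (binary_mem (K := K) (extendH H))
    (lift_mem (single_mem_degreePart q Q))) (lift_mem (single_mem_degreePart r R))
  have h1 := single_mem_degreePart (q + r) (cupH H q r Q R)
  have h2 := single_mem_degreePart (r + q) (cupH H r q R Q)
  rw [show (2 + (q : ℤ) - 1 + r - 1) = ((q + r : ℕ) : ℤ) by push_cast; ring] at hN
  rw [show ((r + q : ℕ) : ℤ) = ((q + r : ℕ) : ℤ) by rw [add_comm]] at h2
  rw [← map_smul (circL x), ← map_smul (circL x), ← map_add (circL x)]
  refine component_circL_lift x hN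
    (add_mem (Submodule.smul_mem _ _ h1) (Submodule.smul_mem _ _ h2)) fun w => ?_
  rw [toWords_circL_circL_extendH, map_add, map_smul, map_smul, Pi.add_apply, Pi.smul_apply,
    Pi.smul_apply, ← sgn_natCast, ← sgn_natCast, ← sgn_natCast, ← sgn_add]
  congr 2
  apply sgn_congr
  push_cast
  generalize (q : ZMod 2) = q', (r : ZMod 2) = r'
  decide +revert

/-- The three surviving composites of `gerstenhaber_extendH` each split into the two orders of the
arguments of `H`, which accounts for the six terms of the ternary bracket. Their signs are compared
through exponents modulo two. -/
theorem ternary_eq {p q r : ℕ} (P : Coch K M A p) (Q : Coch K M A q) (R : Coch K M A r) :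
    bracket₃ H (single p P) (single q Q) (single r R) =
      -(sgn K q • component (gerstenhaber (gerstenhaber (gerstenhaber (binary (extendH H))
        (lift (single p P))) (lift (single q Q))) (lift (single r R)))) := by
  rw [gerstenhaber_extendH H (single_mem_degreePart p P) (single_mem_degreePart q Q)
    (single_mem_degreePart r R), map_neg, map_add, map_add, map_smul, map_smul, map_smul,
    component_circL_circL_extendH, component_circL_circL_extendH, component_circL_circL_extendH,
    bracket₃, extend₃_single]
  simp only [ternary, LinearMap.coe_mk, AddHom.coe_mk, LinearMap.mk₂_apply, term, ← circL_single,
    ← sgn_natCast]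
  push_cast
  generalize circL (single p P) (single (q + r) (cupH H q r Q R)) = X1
  generalize circL (single p P) (single (r + q) (cupH H r q R Q)) = X2
  generalize circL (single q Q) (single (p + r) (cupH H p r P R)) = X3
  generalize circL (single q Q) (single (r + p) (cupH H r p R P)) = X4
  generalize circL (single r R) (single (q + p) (cupH H q p Q P)) = X5
  generalize circL (single r R) (single (p + q) (cupH H p q P Q)) = X6
  have signs : ∀ p q r : ℤ,
      sgn K 1 * sgn K (p + q * r) = sgn K q * sgn K (p + 1) * sgn K (q * (r + 1)) ∧
      sgn K (q * r) * sgn K (p + r * q) = sgn K q * sgn K (p + 1) * sgn K (q + 1) ∧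
      sgn K (p * q) * sgn K (q + p * r) = sgn K q * sgn K (p * (q + 1)) * sgn K (p * (r + 1)) ∧
      sgn K 1 * (sgn K (p * (q + r)) * sgn K (q + r * p)) =
        sgn K q * sgn K (p * (q + 1)) * sgn K (p + 1) ∧
      sgn K (p * q + q * r + r * p) * sgn K (r + q * p) =
        sgn K q * sgn K ((p + q + 1) * (r + 1)) * sgn K (p + 1) ∧
      sgn K 1 * (sgn K ((p + q) * r) * sgn K (r + p * q)) =
        sgn K q * sgn K ((p + q + 1) * (r + 1)) * sgn K (p * (q + 1)) := by
    intro p q r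
    simp only [← sgn_add]
    refine ⟨?_, ?_, ?_, ?_, ?_, ?_⟩ <;>
    · apply sgn_congr
      push_cast
      generalize (p : ZMod 2) = p', (q : ZMod 2) = q', (r : ZMod 2) = r'
      decide +revert
  obtain ⟨c1, c2, c3, c4, c5, c6⟩ := signs p q r
  rw [sgn_one] at c1 c4 c6
  linear_combination (norm := module)
    c1 • X1 + c2 • X2 + c3 • X3 + c4 • X4 + c5 • X5 + c6 • X6

end Ternary

/-! ### Derived brackets in a graded Lie algebra with weights bounded below -/

section Derived

variable {K : Type*} [Field K] {E : Type*} [AddCommGroup E] [Module K E]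

/-- A graded Lie bracket `B` of degree `-1` (for a grading shifted by one) which is compatible with
a second grading by weights; there are no elements of weight less than `-1`. `W j d` consists of
the elements of weight `j` and degree `d`. -/
structure IsWeightedLie (B : E →ₗ[K] E →ₗ[K] E) (W : ℤ → ℤ → Submodule K E) : Prop where
  mem : ∀ {i j a b : ℤ} {x y : E}, x ∈ W i a → y ∈ W j b → B x y ∈ W (i + j) (a + b - 1)
  skew : ∀ {i j a b : ℤ} {x y : E}, x ∈ W i a → y ∈ W j b →
    B x y = -(sgn K ((a + 1) * (b + 1)) • B y x)
  leibniz : ∀ {i j k a b c : ℤ} {x y z : E}, x ∈ W i a → y ∈ W j b → z ∈ W k c →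
    B (B x y) z = B x (B y z) + sgn K ((b + 1) * (c + 1)) • B (B x z) y
  eq_zero : ∀ {j d : ℤ} {x : E}, x ∈ W j d → j < -1 → x = 0

/-- The sum over all distributions of `xs` to the two arguments of a bracket. -/
def distribute (B : E →ₗ[K] E →ₗ[K] E) : E → E → ℤ → List (E × ℤ) → E
  | x, y, _, [] => B x y
  | x, y, b, p :: xs => distribute B x (B y p.1) (b + p.2 - 1) xs +
      sgn K ((b + 1) * (p.2 + 1)) • distribute B (B x p.1) y b xs

theorem add_congr {a b c d : E} (h : a = c) (h' : b = d) : a + b = c + d := by rw [h, h']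

theorem sgn_smul_congr {a b : ℤ} (h : (a : ZMod 2) = b) (x : E) : sgn K a • x = sgn K b • x := by
  rw [sgn_congr h]

variable {B : E →ₗ[K] E →ₗ[K] E} {W : ℤ → ℤ → Submodule K E}

local notation:70 x:70 "⋄" y:71 => B x y

namespace IsWeightedLie

theorem bracket_eq_zero (hB : IsWeightedLie B W) {i j a b : ℤ} {x y : E} (hx : x ∈ W i a)
    (hy : y ∈ W j b) (h : i + j < -1) : x⋄y = 0 := hB.eq_zero (hB.mem hx hy) h

/-- Elements of weight `-1` act on the right by graded commuting operators. -/
theorem right_comm (hB : IsWeightedLie B W) {j a b c : ℤ} {x y z : E}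
    (hx : x ∈ W j a) (hy : y ∈ W (-1) b) (hz : z ∈ W (-1) c) :
    x⋄y⋄z = sgn K ((b + 1) * (c + 1)) • (x⋄z⋄y) := by
  rw [hB.leibniz hx hy hz, hB.bracket_eq_zero hy hz (by norm_num), map_zero, zero_add]

theorem right_comm₂ (hB : IsWeightedLie B W) {j a b c d : ℤ} {x y z t : E}
    (hx : x ∈ W j a) (hy : y ∈ W (-1) b) (hz : z ∈ W (-1) c) (ht : t ∈ W (-1) d) :
    x⋄y⋄z⋄t = sgn K ((b + 1) * (d + 1) + (c + 1) * (d + 1)) • (x⋄t⋄y⋄z) := by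
  rw [hB.right_comm (hB.mem hx hy) hz ht, hB.right_comm hx hy ht,
    map_smul, LinearMap.smul_apply, smul_smul, ← sgn_add, add_comm]

/-- Bracketing on the right is a graded derivation; applying it once for each element of the list
distributes the list over both factors. -/
theorem foldl (hB : IsWeightedLie B W) (xs : List (E × ℤ))
    (hxs : ∀ p ∈ xs, ∃ k, p.1 ∈ W k p.2) {i j a b : ℤ} {x y : E} (hx : x ∈ W i a)
    (hy : y ∈ W j b) : xs.foldl (fun t p => t⋄p.1) (x⋄y) = distribute B x y b xs := by
  have add : ∀ (xs : List (E × ℤ)) s t (k : K),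
      xs.foldl (fun t p => t⋄p.1) (s + k • t) =
        xs.foldl (fun t p => t⋄p.1) s + k • xs.foldl (fun t p => t⋄p.1) t := by
    intro xs
    induction xs with
    | nil => intro s t k; rfl
    | cons p xs ih => intro s t k; simp [ih]
  induction xs generalizing x y i j a b with
  | nil => rfl
  | cons p xs ih =>
    obtain ⟨k, hp⟩ := hxs p (by simp)
    have hxs' : ∀ p ∈ xs, ∃ k, p.1 ∈ W k p.2 := fun q hq => hxs q (by simp [hq])
    rw [List.foldl_cons, hB.leibniz hx hy hp, add, ih hxs' hx (hB.mem hy hp),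
      ih hxs' (hB.mem hx hp) hy]
    rfl

theorem skew_sgn (hB : IsWeightedLie B W) {i j a b : ℤ} {x y : E} (hx : x ∈ W i a)
    (hy : y ∈ W j b) : x⋄y = sgn K ((a + 1) * (b + 1) + 1) • (y⋄x) := by
  rw [hB.skew hx hy, sgn_add, sgn_one]
  module

/-- Here `z` is meant to be the value of an inner operation, again of weight `-1`; the lemma brings
it into the first argument of the outer operation. `skew_comm₂` does the same for ternary outer
operations. -/
theorem skew_comm (hB : IsWeightedLie B W) {i a b c : ℤ} {x y z : E} (hx : x ∈ W i a)
    (hy : y ∈ W (-1) b) (hz : z ∈ W (-1) c) :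
    z⋄(x⋄y) = sgn K ((c + 1) * (a + b - 1 + 1) + 1 + (b + 1) * (c + 1)) • (x⋄z⋄y) := by
  rw [hB.skew_sgn hz (hB.mem hx hy), hB.right_comm hx hy hz, smul_smul, ← sgn_add]

theorem skew_comm₂ (hB : IsWeightedLie B W) {i a b c d : ℤ} {x y z t : E} (hx : x ∈ W i a)
    (hy : y ∈ W (-1) b) (hz : z ∈ W (-1) c) (ht : t ∈ W (-1) d) :
    t⋄(x⋄y⋄z) = sgn K ((d + 1) * (a + b - 1 + c - 1 + 1) + 1 +
      ((b + 1) * (d + 1) + (c + 1) * (d + 1))) • (x⋄t⋄y⋄z) := by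
  rw [hB.skew_sgn ht (hB.mem (hB.mem hx hy) hz), hB.right_comm₂ hx hy hz ht, smul_smul, ← sgn_add]

/-! ### The quadratic identities of derived brackets -/

/-- The relation `e` is bracketed with `x₂, …, x₅`. By weight each `h` can absorb at most three
elements, so only the distributions in which one `h` absorbs three and the other two survive. There
are ten, one for each choice of the three inputs of the inner operation. -/
theorem jacobi_five (hB : IsWeightedLie B W) {d₁ d₂ d₃ d₄ d₅ : ℤ} {h x₁ x₂ x₃ x₄ x₅ : E}
    (hh : h ∈ W 2 2) (e : h⋄(h⋄x₁) = 0)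
    (h₁ : x₁ ∈ W (-1) d₁)
    (h₂ : x₂ ∈ W (-1) d₂)
    (h₃ : x₃ ∈ W (-1) d₃)
    (h₄ : x₄ ∈ W (-1) d₄)
    (h₅ : x₅ ∈ W (-1) d₅) :
    sgn K 0 • (h⋄(h⋄x₁⋄x₂⋄x₃)⋄x₄⋄x₅) +
      sgn K ((d₃ + 1) * (d₄ + 1)) • (h⋄(h⋄x₁⋄x₂⋄x₄)⋄x₃⋄x₅) +
      sgn K ((d₃ + 1) * (d₅ + 1) + (d₄ + 1) * (d₅ + 1)) • (h⋄(h⋄x₁⋄x₂⋄x₅)⋄x₃⋄x₄) +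
      sgn K ((d₁ + 1) * (d₃ + 1) + (d₁ + 1) * (d₄ + 1) + (d₁ + 1) * (d₅ + 1) +
          (d₂ + 1) * (d₃ + 1) + (d₂ + 1) * (d₄ + 1) + (d₂ + 1) * (d₅ + 1)) •
        (h⋄(h⋄x₃⋄x₄⋄x₅)⋄x₁⋄x₂) +
      sgn K ((d₂ + 1) * (d₃ + 1) + (d₂ + 1) * (d₄ + 1)) • (h⋄(h⋄x₁⋄x₃⋄x₄)⋄x₂⋄x₅) +
      sgn K ((d₂ + 1) * (d₃ + 1) + (d₂ + 1) * (d₅ + 1) + (d₄ + 1) * (d₅ + 1)) •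
        (h⋄(h⋄x₁⋄x₃⋄x₅)⋄x₂⋄x₄) +
      sgn K ((d₁ + 1) * (d₂ + 1) + (d₁ + 1) * (d₄ + 1) + (d₁ + 1) * (d₅ + 1) +
          (d₃ + 1) * (d₄ + 1) + (d₃ + 1) * (d₅ + 1)) • (h⋄(h⋄x₂⋄x₄⋄x₅)⋄x₁⋄x₃) +
      sgn K ((d₂ + 1) * (d₄ + 1) + (d₂ + 1) * (d₅ + 1) + (d₃ + 1) * (d₄ + 1) +
          (d₃ + 1) * (d₅ + 1)) • (h⋄(h⋄x₁⋄x₄⋄x₅)⋄x₂⋄x₃) +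
      sgn K ((d₁ + 1) * (d₂ + 1) + (d₁ + 1) * (d₃ + 1) + (d₁ + 1) * (d₅ + 1) +
          (d₄ + 1) * (d₅ + 1)) • (h⋄(h⋄x₂⋄x₃⋄x₅)⋄x₁⋄x₄) +
      sgn K ((d₁ + 1) * (d₂ + 1) + (d₁ + 1) * (d₃ + 1) + (d₁ + 1) * (d₄ + 1)) •
        (h⋄(h⋄x₂⋄x₃⋄x₄)⋄x₁⋄x₅) = 0 := by
  have eq := hB.foldl [(x₂, d₂), (x₃, d₃), (x₄, d₄), (x₅, d₅)]
    (by simpa using ⟨⟨_, h₂⟩, ⟨_, h₃⟩, ⟨_, h₄⟩, ⟨_, h₅⟩⟩) hh (hB.mem hh h₁)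
  -- The weight is `2 - 4 = -2`.
  have z : ∀ {a b c d : ℤ} {x y z t : E}, x ∈ W (-1) a → y ∈ W (-1) b → z ∈ W (-1) c →
      t ∈ W (-1) d → h⋄x⋄y⋄z⋄t = 0 := fun hx hy hz ht =>
    hB.bracket_eq_zero (hB.mem (hB.mem (hB.mem hh hx) hy) hz) ht (by norm_num)
  simp only [distribute, List.foldl, e, map_zero, LinearMap.zero_apply, z h₁ h₂ h₃ h₄,
    z h₁ h₂ h₃ h₅, z h₁ h₂ h₄ h₅, z h₁ h₃ h₄ h₅, z h₂ h₃ h₄ h₅, add_zero, zero_add, smul_zero] at eq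
  rw [hB.right_comm₂ hh h₄ h₅ (hB.mem (hB.mem (hB.mem hh h₁) h₂) h₃),
    hB.right_comm₂ hh h₃ h₅ (hB.mem (hB.mem (hB.mem hh h₁) h₂) h₄),
    hB.right_comm₂ hh h₃ h₄ (hB.mem (hB.mem (hB.mem hh h₁) h₂) h₅),
    hB.skew_comm₂ hh h₁ h₂ (hB.mem (hB.mem (hB.mem hh h₃) h₄) h₅),
    hB.right_comm₂ hh h₂ h₅ (hB.mem (hB.mem (hB.mem hh h₁) h₃) h₄),
    hB.right_comm₂ hh h₂ h₄ (hB.mem (hB.mem (hB.mem hh h₁) h₃) h₅),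
    hB.skew_comm₂ hh h₁ h₃ (hB.mem (hB.mem (hB.mem hh h₂) h₄) h₅),
    hB.right_comm₂ hh h₂ h₃ (hB.mem (hB.mem (hB.mem hh h₁) h₄) h₅),
    hB.skew_comm₂ hh h₁ h₄ (hB.mem (hB.mem (hB.mem hh h₂) h₃) h₅),
    hB.skew_comm₂ hh h₁ h₅ (hB.mem (hB.mem (hB.mem hh h₂) h₃) h₄)] at eq
  simp only [smul_add, smul_smul, ← sgn_add, add_assoc] at eq ⊢
  refine Eq.trans ?_ eq.symm
  -- Both sides list the same ten brackets in the same order, so only the parities of their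
  -- coefficients have to be compared.
  repeat' first
    | refine add_congr ?_ ?_
    | refine sgn_smul_congr ?_ _
  all_goals
    push_cast
    generalize (d₁ : ZMod 2) = a₁, (d₂ : ZMod 2) = a₂, (d₃ : ZMod 2) = a₃,
      (d₄ : ZMod 2) = a₄, (d₅ : ZMod 2) = a₅
    decide +revert

/-- The relation `h⋄m = 0` is bracketed with all four elements. By weight `m` absorbs at most two
and `h` at most three: six terms have `m` inside and four have `h` inside. -/
theorem jacobi_four (hB : IsWeightedLie B W) {d₁ d₂ d₃ d₄ : ℤ} {h m x₁ x₂ x₃ x₄ : E}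
    (hh : h ∈ W 2 2) (hm : m ∈ W 1 2) (e : h⋄m = 0)
    (h₁ : x₁ ∈ W (-1) d₁)
    (h₂ : x₂ ∈ W (-1) d₂)
    (h₃ : x₃ ∈ W (-1) d₃)
    (h₄ : x₄ ∈ W (-1) d₄) :
    sgn K 0 • (h⋄(m⋄x₁⋄x₂)⋄x₃⋄x₄) +
      sgn K ((d₂ + 1) * (d₃ + 1)) • (h⋄(m⋄x₁⋄x₃)⋄x₂⋄x₄) +
      sgn K ((d₂ + 1) * (d₄ + 1) + (d₃ + 1) * (d₄ + 1)) • (h⋄(m⋄x₁⋄x₄)⋄x₂⋄x₃) +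
      sgn K ((d₁ + 1) * (d₂ + 1) + (d₁ + 1) * (d₃ + 1) + (d₁ + 1) * (d₄ + 1)) •
        (m⋄(h⋄x₂⋄x₃⋄x₄)⋄x₁) +
      sgn K ((d₁ + 1) * (d₂ + 1) + (d₁ + 1) * (d₃ + 1)) • (h⋄(m⋄x₂⋄x₃)⋄x₁⋄x₄) +
      sgn K ((d₁ + 1) * (d₂ + 1) + (d₁ + 1) * (d₄ + 1) + (d₃ + 1) * (d₄ + 1)) •
        (h⋄(m⋄x₂⋄x₄)⋄x₁⋄x₃) +
      sgn K ((d₂ + 1) * (d₃ + 1) + (d₂ + 1) * (d₄ + 1)) • (m⋄(h⋄x₁⋄x₃⋄x₄)⋄x₂) +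
      sgn K ((d₁ + 1) * (d₃ + 1) + (d₁ + 1) * (d₄ + 1) + (d₂ + 1) * (d₃ + 1) +
          (d₂ + 1) * (d₄ + 1)) • (h⋄(m⋄x₃⋄x₄)⋄x₁⋄x₂) +
      sgn K ((d₃ + 1) * (d₄ + 1)) • (m⋄(h⋄x₁⋄x₂⋄x₄)⋄x₃) +
      sgn K 0 • (m⋄(h⋄x₁⋄x₂⋄x₃)⋄x₄) = 0 := by
  have eq := hB.foldl [(x₁, d₁), (x₂, d₂), (x₃, d₃), (x₄, d₄)]
    (by simpa using ⟨⟨_, h₁⟩, ⟨_, h₂⟩, ⟨_, h₃⟩, ⟨_, h₄⟩⟩) hh hm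
  have z : ∀ {a b c d : ℤ} {x y z t : E}, x ∈ W (-1) a → y ∈ W (-1) b → z ∈ W (-1) c →
      t ∈ W (-1) d → h⋄x⋄y⋄z⋄t = 0 := fun hx hy hz ht =>
    hB.bracket_eq_zero (hB.mem (hB.mem (hB.mem hh hx) hy) hz) ht (by norm_num)
  have z' : ∀ {a b c : ℤ} {x y z : E}, x ∈ W (-1) a → y ∈ W (-1) b → z ∈ W (-1) c →
      m⋄x⋄y⋄z = 0 := fun hx hy hz => hB.bracket_eq_zero (hB.mem (hB.mem hm hx) hy) hz (by norm_num)
  simp only [distribute, List.foldl, e, map_zero, LinearMap.zero_apply, z h₁ h₂ h₃ h₄, z' h₁ h₂ h₃,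
    z' h₁ h₂ h₄, z' h₁ h₃ h₄, z' h₂ h₃ h₄, add_zero, zero_add, smul_zero] at eq
  rw [hB.right_comm₂ hh h₃ h₄ (hB.mem (hB.mem hm h₁) h₂),
    hB.right_comm₂ hh h₂ h₄ (hB.mem (hB.mem hm h₁) h₃),
    hB.right_comm₂ hh h₂ h₃ (hB.mem (hB.mem hm h₁) h₄),
    hB.skew_comm hm h₁ (hB.mem (hB.mem (hB.mem hh h₂) h₃) h₄),
    hB.right_comm₂ hh h₁ h₄ (hB.mem (hB.mem hm h₂) h₃),
    hB.right_comm₂ hh h₁ h₃ (hB.mem (hB.mem hm h₂) h₄),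
    hB.skew_comm hm h₂ (hB.mem (hB.mem (hB.mem hh h₁) h₃) h₄),
    hB.right_comm₂ hh h₁ h₂ (hB.mem (hB.mem hm h₃) h₄),
    hB.skew_comm hm h₃ (hB.mem (hB.mem (hB.mem hh h₁) h₂) h₄),
    hB.skew_comm hm h₄ (hB.mem (hB.mem (hB.mem hh h₁) h₂) h₃)] at eq
  simp only [smul_add, smul_smul, ← sgn_add, add_assoc] at eq ⊢
  refine Eq.trans ?_ eq.symm
  repeat' first
    | refine add_congr ?_ ?_
    | refine sgn_smul_congr ?_ _
  all_goals
    push_cast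
    generalize (d₁ : ZMod 2) = a₁, (d₂ : ZMod 2) = a₂, (d₃ : ZMod 2) = a₃, (d₄ : ZMod 2) = a₄
    decide +revert

/-- The relation `e` is half the bracket of `m⋄m + 2 h⋄d = 0` with `x₁`. Stating it in this form
keeps the division by two out of the argument; it is then bracketed with `x₂` and `x₃`. -/
theorem jacobi_three (hB : IsWeightedLie B W) {d₁ d₂ d₃ : ℤ} {h m d x₁ x₂ x₃ : E}
    (hh : h ∈ W 2 2) (hm : m ∈ W 1 2) (hd : d ∈ W 0 2)
    (e : m⋄(m⋄x₁) + (h⋄(d⋄x₁) + sgn K (d₁ + 1) • (h⋄x₁⋄d)) = 0)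
    (h₁ : x₁ ∈ W (-1) d₁)
    (h₂ : x₂ ∈ W (-1) d₂)
    (h₃ : x₃ ∈ W (-1) d₃) :
    sgn K 0 • (m⋄(m⋄x₁⋄x₂)⋄x₃) +
      sgn K ((d₂ + 1) * (d₃ + 1)) • (m⋄(m⋄x₁⋄x₃)⋄x₂) +
      sgn K ((d₁ + 1) * (d₂ + 1) + (d₁ + 1) * (d₃ + 1)) • (m⋄(m⋄x₂⋄x₃)⋄x₁) +
      sgn K 0 • (h⋄(d⋄x₁)⋄x₂⋄x₃) +
      sgn K ((d₁ + 1) * (d₂ + 1)) • (h⋄(d⋄x₂)⋄x₁⋄x₃) +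
      sgn K ((d₁ + 1) * (d₃ + 1) + (d₂ + 1) * (d₃ + 1)) • (h⋄(d⋄x₃)⋄x₁⋄x₂) +
      sgn K 0 • (d⋄(h⋄x₁⋄x₂⋄x₃)) = 0 := by
  have eq₁ := hB.foldl [(x₂, d₂), (x₃, d₃)]
    (by simpa using ⟨⟨_, h₂⟩, ⟨_, h₃⟩⟩) hm (hB.mem hm h₁)
  have eq₂ := hB.foldl [(x₂, d₂), (x₃, d₃)]
    (by simpa using ⟨⟨_, h₂⟩, ⟨_, h₃⟩⟩) hh (hB.mem hd h₁)
  have eq₃ := hB.foldl [(x₂, d₂), (x₃, d₃)]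
    (by simpa using ⟨⟨_, h₂⟩, ⟨_, h₃⟩⟩) (hB.mem hh h₁) hd
  have z' : ∀ {a b c : ℤ} {x y z : E}, x ∈ W (-1) a → y ∈ W (-1) b → z ∈ W (-1) c →
      m⋄x⋄y⋄z = 0 := fun hx hy hz => hB.bracket_eq_zero (hB.mem (hB.mem hm hx) hy) hz (by norm_num)
  have z'' : ∀ {a b : ℤ} {x y : E}, x ∈ W (-1) a → y ∈ W (-1) b → d⋄x⋄y = 0 :=
    fun hx hy => hB.bracket_eq_zero (hB.mem hd hx) hy (by norm_num)
  simp only [distribute, List.foldl, map_zero, LinearMap.zero_apply, z' h₁ h₂ h₃,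
    z'' h₁ h₂, z'' h₁ h₃, z'' h₂ h₃, add_zero, zero_add, smul_zero] at eq₁ eq₂ eq₃
  have eq := congrArg (fun t => t⋄x₂⋄x₃) e
  simp only [map_add, map_smul, LinearMap.add_apply, LinearMap.smul_apply, map_zero,
    LinearMap.zero_apply, eq₁, eq₂, eq₃] at eq
  rw [hB.right_comm hm h₃ (hB.mem (hB.mem hm h₁) h₂), hB.right_comm hm h₂ (hB.mem (hB.mem hm h₁) h₃),
    hB.skew_comm hm h₁ (hB.mem (hB.mem hm h₂) h₃), hB.right_comm₂ hh h₂ h₃ (hB.mem hd h₁),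
    hB.right_comm₂ hh h₁ h₃ (hB.mem hd h₂), hB.right_comm₂ hh h₁ h₂ (hB.mem hd h₃),
    hB.skew_sgn (hB.mem (hB.mem (hB.mem hh h₁) h₂) h₃) hd] at eq
  simp only [smul_add, smul_smul, ← sgn_add, add_assoc] at eq ⊢
  refine Eq.trans ?_ eq
  repeat' first
    | refine add_congr ?_ ?_
    | refine sgn_smul_congr ?_ _
  all_goals
    push_cast
    generalize (d₁ : ZMod 2) = a₁, (d₂ : ZMod 2) = a₂, (d₃ : ZMod 2) = a₃
    decide +revert

theorem jacobi_two (hB : IsWeightedLie B W) {d₁ d₂ : ℤ} {m d x₁ x₂ : E}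
    (hm : m ∈ W 1 2) (hd : d ∈ W 0 2) (e : m⋄d = 0)
    (h₁ : x₁ ∈ W (-1) d₁)
    (h₂ : x₂ ∈ W (-1) d₂) :
    sgn K 0 • (m⋄(d⋄x₁)⋄x₂) +
      sgn K ((d₁ + 1) * (d₂ + 1)) • (m⋄(d⋄x₂)⋄x₁) +
      sgn K 0 • (d⋄(m⋄x₁⋄x₂)) = 0 := by
  have eq := hB.foldl [(x₁, d₁), (x₂, d₂)]
    (by simpa using ⟨⟨_, h₁⟩, ⟨_, h₂⟩⟩) hm hd
  have z'' : ∀ {a b : ℤ} {x y : E}, x ∈ W (-1) a → y ∈ W (-1) b → d⋄x⋄y = 0 :=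
    fun hx hy => hB.bracket_eq_zero (hB.mem hd hx) hy (by norm_num)
  simp only [distribute, List.foldl, e, map_zero, LinearMap.zero_apply, z'' h₁ h₂,
    zero_add] at eq
  rw [hB.right_comm hm h₂ (hB.mem hd h₁), hB.right_comm hm h₁ (hB.mem hd h₂),
    hB.skew_sgn (hB.mem (hB.mem hm h₁) h₂) hd] at eq
  simp only [smul_add, smul_smul, ← sgn_add, add_assoc] at eq ⊢
  refine Eq.trans ?_ eq.symm
  repeat' first
    | refine add_congr ?_ ?_
    | refine sgn_smul_congr ?_ _
  all_goals
    push_cast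
    generalize (d₁ : ZMod 2) = a₁, (d₂ : ZMod 2) = a₂
    decide +revert

end IsWeightedLie
end Derived

/-! ### Twisting by an element of weight `-1` and degree one -/

section Twist

variable {K : Type*} [Field K] {E : Type*} [AddCommGroup E] [Module K E]
variable {B : E →ₗ[K] E →ₗ[K] E} {W : ℤ → ℤ → Submodule K E}

local notation:70 x:70 "⋄" y:71 => B x y

variable (B) in
/-- The part of weight one of the twist of `μ + h` by `t`. -/
def twistOne (h μ t : E) : E := μ + h⋄t

variable (B) in
/-- The part of weight zero of the twist of `μ + h` by `t`. -/
def twistZero (h μ t : E) : E := μ⋄t + (1 / 2 : K) • (h⋄t⋄t)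

variable (B) in
/-- The part of weight `-1` of the twist of `μ + h` by `t`: the Maurer-Cartan expression. -/
def twistCurv (h μ t : E) : E :=
  (1 / 2 : K) • (μ⋄t⋄t) + (1 / 6 : K) • (h⋄t⋄t⋄t)

namespace IsWeightedLie

/-- Degree two is odd after the shift, so the bracket is symmetric there. -/
theorem comm_two (hB : IsWeightedLie B W) {i j : ℤ} {x y : E} (hx : x ∈ W i 2) (hy : y ∈ W j 2) :
    x⋄y = y⋄x := by
  have : sgn K ((2 + 1) * (2 + 1)) = sgn K 1 := sgn_congr (by push_cast; decide)
  rw [hB.skew hx hy, this, sgn_one]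
  module

theorem bracket_even (hB : IsWeightedLie B W) {i j k a b : ℤ} {x y t : E} (hx : x ∈ W i a)
    (hy : y ∈ W j b) (ht : t ∈ W k 1) : x⋄y⋄t = x⋄(y⋄t) + x⋄t⋄y := by
  have : sgn K ((b + 1) * (1 + 1)) = sgn K 0 := sgn_congr (by
    push_cast; generalize (b : ZMod 2) = b'; decide +revert)
  rw [hB.leibniz hx hy ht, this, sgn_zero, one_smul]

theorem bracket_odd (hB : IsWeightedLie B W) {i j k b : ℤ} {x y z : E} (hx : x ∈ W i 2)
    (hy : y ∈ W j 2) (hz : z ∈ W k b) : x⋄y⋄z = x⋄(y⋄z) + sgn K (b + 1) • (x⋄z⋄y) := by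
  have : sgn K ((2 + 1) * (b + 1)) = sgn K (b + 1) := sgn_congr (by
    push_cast; generalize (b : ZMod 2) = b'; decide +revert)
  rw [hB.leibniz hx hy hz, this]

theorem sq_bracket (hB : IsWeightedLie B W) {i j b : ℤ} {x y : E} (hx : x ∈ W i 2)
    (hy : y ∈ W j b) : x⋄x⋄y = (2 : K) • (x⋄(x⋄y)) := by
  have h1 := hB.skew_sgn (hB.mem hx hy) hx
  have : sgn K ((2 + b - 1 + 1) * (2 + 1) + 1) = sgn K (b + 1) := sgn_congr (by
    push_cast; generalize (b : ZMod 2) = b'; decide +revert)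
  rw [hB.bracket_odd hx hx hy, h1, this, smul_smul, sgn_mul_self]
  module

theorem mem_even (hB : IsWeightedLie B W) {i : ℤ} {x t : E} (hx : x ∈ W i 2) (ht : t ∈ W (-1) 1) :
    x⋄t ∈ W (i - 1) 2 := by
  have := hB.mem hx ht
  norm_num at this
  simpa [sub_eq_add_neg] using this

variable {h μ t : E}

theorem twistOne_mem (hB : IsWeightedLie B W) (hh : h ∈ W 2 2) (hμ : μ ∈ W 1 2)
    (ht : t ∈ W (-1) 1) : twistOne B h μ t ∈ W 1 2 := add_mem hμ (hB.mem_even hh ht)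

theorem twistZero_mem (hB : IsWeightedLie B W) (hh : h ∈ W 2 2) (hμ : μ ∈ W 1 2)
    (ht : t ∈ W (-1) 1) : twistZero B h μ t ∈ W 0 2 :=
  add_mem (hB.mem_even hμ ht) (Submodule.smul_mem _ _ (hB.mem_even (hB.mem_even hh ht) ht))

section

variable [CharZero K]

theorem bracket_bracket_self (hB : IsWeightedLie B W) {i j b : ℤ} {x y : E} (hx : x ∈ W i 2)
    (e : x⋄x = 0) (hy : y ∈ W j b) : x⋄(x⋄y) = 0 := by
  have := hB.sq_bracket hx hy
  rw [e, map_zero, LinearMap.zero_apply] at this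
  simpa using this.symm

theorem twist_hh₁ (hB : IsWeightedLie B W) (hh : h ∈ W 2 2) (ht : t ∈ W (-1) 1)
    (hhh : h⋄h = 0) : h⋄(h⋄t) = 0 := hB.bracket_bracket_self hh hhh ht

theorem twist_hh₂ (hB : IsWeightedLie B W) (hh : h ∈ W 2 2) (ht : t ∈ W (-1) 1)
    (hhh : h⋄h = 0) : h⋄(h⋄t⋄t) + h⋄t⋄(h⋄t) = 0 := by
  rw [← hB.bracket_even hh (hB.mem_even hh ht) ht, hB.twist_hh₁ hh ht hhh, map_zero,
    LinearMap.zero_apply]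

/-- The relations `twist_hh₁` to `twist_hh₄` are the successive derivatives of `h⋄h = 0` along `t`,
where bracketing with `t` carries no sign. The family `twist_hμ₁` to `twist_hμ₃` treats `h⋄μ = 0` in
the same way. -/
theorem twist_hh₃ (hB : IsWeightedLie B W) (hh : h ∈ W 2 2) (ht : t ∈ W (-1) 1)
    (hhh : h⋄h = 0) : h⋄(h⋄t⋄t⋄t) + (3 : K) • (h⋄t⋄(h⋄t⋄t)) = 0 := by
  have h1 := hB.mem_even hh ht
  have h2 := hB.mem_even h1 ht
  have e := congrArg (fun x => x⋄t) (hB.twist_hh₂ hh ht hhh)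
  simp only [map_add, LinearMap.add_apply, hB.bracket_even hh h2 ht, hB.bracket_even h1 h1 ht,
    map_zero, LinearMap.zero_apply, hB.comm_two h2 h1] at e
  linear_combination (norm := module) e

theorem twist_hh₄ (hB : IsWeightedLie B W) (hh : h ∈ W 2 2) (ht : t ∈ W (-1) 1)
    (hhh : h⋄h = 0) : (4 : K) • (h⋄t⋄(h⋄t⋄t⋄t)) + (3 : K) • (h⋄t⋄t⋄(h⋄t⋄t)) = 0 := by
  have h1 := hB.mem_even hh ht
  have h2 := hB.mem_even h1 ht
  have h3 := hB.mem_even h2 ht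
  have h4 : h⋄t⋄t⋄t⋄t = 0 := hB.bracket_eq_zero h3 ht (by norm_num)
  have e := congrArg (fun x => x⋄t) (hB.twist_hh₃ hh ht hhh)
  simp only [map_add, map_smul, LinearMap.add_apply, LinearMap.smul_apply,
    hB.bracket_even hh h3 ht, hB.bracket_even h1 h2 ht, h4, map_zero, LinearMap.zero_apply] at e
  linear_combination (norm := module) e

theorem twist_hμ₁ (hB : IsWeightedLie B W) (hh : h ∈ W 2 2) (hμ : μ ∈ W 1 2) (ht : t ∈ W (-1) 1)
    (hhμ : h⋄μ = 0) : h⋄(μ⋄t) + h⋄t⋄μ = 0 := by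
  rw [← hB.bracket_even hh hμ ht, hhμ, map_zero, LinearMap.zero_apply]

theorem twist_hμ₂ (hB : IsWeightedLie B W) (hh : h ∈ W 2 2) (hμ : μ ∈ W 1 2) (ht : t ∈ W (-1) 1)
    (hhμ : h⋄μ = 0) : h⋄(μ⋄t⋄t) + (2 : K) • (h⋄t⋄(μ⋄t)) + h⋄t⋄t⋄μ = 0 := by
  have e := congrArg (fun x => x⋄t) (hB.twist_hμ₁ hh hμ ht hhμ)
  simp only [map_add, LinearMap.add_apply, hB.bracket_even hh (hB.mem_even hμ ht) ht,
    hB.bracket_even (hB.mem_even hh ht) hμ ht, map_zero, LinearMap.zero_apply] at e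
  linear_combination (norm := module) e

theorem twist_hμ₃ (hB : IsWeightedLie B W) (hh : h ∈ W 2 2) (hμ : μ ∈ W 1 2) (ht : t ∈ W (-1) 1)
    (hhμ : h⋄μ = 0) :
    (3 : K) • (h⋄t⋄(μ⋄t⋄t)) + (3 : K) • (h⋄t⋄t⋄(μ⋄t)) + h⋄t⋄t⋄t⋄μ = 0 := by
  have h1 := hB.mem_even hh ht
  have h2 := hB.mem_even h1 ht
  have m1 := hB.mem_even hμ ht
  have m2 := hB.mem_even m1 ht
  have m3 : μ⋄t⋄t⋄t = 0 := hB.bracket_eq_zero m2 ht (by norm_num)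
  have e := congrArg (fun x => x⋄t) (hB.twist_hμ₂ hh hμ ht hhμ)
  simp only [map_add, map_smul, LinearMap.add_apply, LinearMap.smul_apply,
    hB.bracket_even hh m2 ht, hB.bracket_even h1 m1 ht, hB.bracket_even h2 hμ ht, m3, map_zero,
    LinearMap.zero_apply] at e
  linear_combination (norm := module) e

theorem twist_hm (hB : IsWeightedLie B W) (hh : h ∈ W 2 2) (ht : t ∈ W (-1) 1)
    (hhh : h⋄h = 0) (hhμ : h⋄μ = 0) : h⋄twistOne B h μ t = 0 := by
  rw [twistOne, map_add, hhμ, hB.twist_hh₁ hh ht hhh, add_zero]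

theorem twist_mm (hB : IsWeightedLie B W) (hh : h ∈ W 2 2) (hμ : μ ∈ W 1 2) (ht : t ∈ W (-1) 1)
    (hhh : h⋄h = 0) (hhμ : h⋄μ = 0) (hμμ : μ⋄μ = 0) :
    twistOne B h μ t⋄twistOne B h μ t + (2 : K) • (h⋄twistZero B h μ t) = 0 := by
  have e1 := hB.twist_hh₂ hh ht hhh
  have e2 := hB.twist_hμ₁ hh hμ ht hhμ
  simp only [twistOne, twistZero, map_add, map_smul, LinearMap.add_apply,
    hB.comm_two hμ (hB.mem_even hh ht)]
  linear_combination (norm := module) hμμ + e1 + (2 : K) • e2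

/-- The bracket of the quadratic relation of `twist_mm` with a further element. -/
theorem bracket_mm_hd (hB : IsWeightedLie B W) {m d x : E} {i b : ℤ} (hh : h ∈ W 2 2)
    (hm : m ∈ W 1 2) (hd : d ∈ W 0 2) (e : m⋄m + (2 : K) • (h⋄d) = 0) (hx : x ∈ W i b) :
    m⋄(m⋄x) + (h⋄(d⋄x) + sgn K (b + 1) • (h⋄x⋄d)) = 0 := by
  have e' := congrArg (fun t => t⋄x) e
  simp only [map_add, map_smul, LinearMap.add_apply, LinearMap.smul_apply, map_zero,
    LinearMap.zero_apply, hB.sq_bracket hm hx, hB.bracket_odd hh hd hx] at e'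
  linear_combination (norm := module) (1 / 2 : K) • e'

/-- The weight-one part of the square of the twisted element would also contain the bracket of `h`
with the curvature; this is where its vanishing enters, through `e4`. -/
theorem twist_md (hB : IsWeightedLie B W) (hh : h ∈ W 2 2) (hμ : μ ∈ W 1 2) (ht : t ∈ W (-1) 1)
    (hhh : h⋄h = 0) (hhμ : h⋄μ = 0) (hμμ : μ⋄μ = 0)
    (hc : twistCurv B h μ t = 0) :
    twistOne B h μ t⋄twistZero B h μ t = 0 := by
  have e1 := hB.twist_hh₃ hh ht hhh
  have e2 := hB.twist_hμ₂ hh hμ ht hhμ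
  have e3 := hB.bracket_bracket_self hμ hμμ ht
  rw [twistCurv] at hc
  have e4 := congrArg (fun x => h⋄x) hc
  simp only [twistOne, twistZero, map_add, map_smul, LinearMap.add_apply, map_zero,
    hB.comm_two hμ (hB.mem_even (hB.mem_even hh ht) ht)] at e4 ⊢
  linear_combination (norm := module) e3 + (1 / 2 : K) • e2 + (1 / 6 : K) • e1 - e4

theorem twist_dd (hB : IsWeightedLie B W) (hh : h ∈ W 2 2) (hμ : μ ∈ W 1 2) (ht : t ∈ W (-1) 1)
    (hhh : h⋄h = 0) (hhμ : h⋄μ = 0) (hμμ : μ⋄μ = 0)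
    (hc : twistCurv B h μ t = 0) :
    twistZero B h μ t⋄twistZero B h μ t = 0 := by
  have h1 := hB.mem_even hh ht
  have h2 := hB.mem_even h1 ht
  have h3 := hB.mem_even h2 ht
  have m1 := hB.mem_even hμ ht
  have e1 := hB.twist_hh₄ hh ht hhh
  have e2 := hB.twist_hμ₃ hh hμ ht hhμ
  have e3 := congrArg (fun x => x⋄t) (hB.bracket_bracket_self hμ hμμ ht)
  rw [twistCurv] at hc
  have e4 := congrArg (fun x => h⋄t⋄x) hc
  have e5 := congrArg (fun x => μ⋄x) hc
  simp only [twistZero, map_add, map_smul, LinearMap.add_apply, LinearMap.smul_apply, map_zero,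
    LinearMap.zero_apply, hB.bracket_even hμ m1 ht, hB.comm_two m1 h2, hB.comm_two hμ h3]
    at e3 e4 e5 ⊢
  -- Expanding the square leaves no term with `μ⋄t⋄t` or `h⋄t⋄t⋄t`. The curvature equation bracketed
  -- with `h⋄t` (`e4`) and with `μ` (`e5`) cancels those occurring in `e1`, `e2` and `e3`.
  linear_combination (norm := module) (1 / 12 : K) • e1 + (1 / 3 : K) • e2 + e3 -
    (2 : K) • e4 - (2 : K) • e5

/-- The Maurer-Cartan expression of a sum. -/
theorem twistCurv_add (hB : IsWeightedLie B W) (hh : h ∈ W 2 2) (hμ : μ ∈ W 1 2)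
    (ht : t ∈ W (-1) 1) {s : E} (hs : s ∈ W (-1) 1) :
    twistCurv B h μ (t + s) = twistCurv B h μ t + (twistZero B h μ t⋄s +
      (1 / 2 : K) • (twistOne B h μ t⋄s⋄s) + (1 / 6 : K) • (h⋄s⋄s⋄s)) := by
  have comm : ∀ {j : ℤ} {x : E}, x ∈ W j 2 → x⋄s⋄t = x⋄t⋄s := fun hx => by
    have : sgn K ((1 + 1) * (1 + 1)) = sgn K 0 := sgn_congr (by push_cast; decide)
    rw [hB.right_comm hx hs ht, this, sgn_zero, one_smul]
  have hs1 := hB.mem_even hh hs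
  have ht1 := hB.mem_even hh ht
  simp only [twistCurv, twistZero, twistOne, map_add, map_smul, LinearMap.add_apply,
    LinearMap.smul_apply, comm hμ, comm hh, comm hs1, comm ht1]
  module

end

end IsWeightedLie

end Twist

/-! ### The brackets of the theorem as derived brackets on `A ⊕ M` -/

section Brackets

variable {K A M : Type*} [Field K] [NonUnitalRing A] [Module K A] [IsScalarTower K A A]
  [SMulCommClass K A A] [AddCommGroup M] [Module K M]

local notation:70 x:70 "⋄" y:71 => gerstenhaber x y

/-- The elements of weight `j` and degree `d`. -/
def bideg (K A M : Type*) [Field K] [NonUnitalRing A] [Module K A] [AddCommGroup M] [Module K M]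
    (j d : ℤ) : Submodule K (CochSpace K (A × M) (A × M)) :=
  weight K A M j ⊓ degreePart K (A × M) (A × M) d

theorem isWeightedLie_gerstenhaber :
    IsWeightedLie (gerstenhaber (K := K) (V := A × M)) (bideg K A M) where
  mem hx hy := ⟨gerstenhaber_mem_weight hx.1 hy.1 hx.2 hy.2, gerstenhaber_mem hx.2 hy.2⟩
  skew hx hy := gerstenhaber_skew hx.2 hy.2
  leibniz hx hy hz := gerstenhaber_leibniz hx.2 hy.2 hz.2
  eq_zero hx hj := eq_zero_of_weight hj hx.1

theorem lift_mem_bideg {d : ℤ} {x : CochSpace K M A} (hx : x ∈ degreePart K M A d) :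
    lift x ∈ bideg K A M (-1) d := ⟨lift_mem_weight x, lift_mem hx⟩

theorem lift_injective : Function.Injective (lift (K := K) (A := A) (M := M)) :=
  Function.LeftInverse.injective component_lift

theorem extendH_mem_bideg (H : A →ₗ[K] A →ₗ[K] M) : binary (extendH H) ∈ bideg K A M 2 2 :=
  ⟨extendH_mem_weight H, binary_mem _⟩

theorem mulLR_mem_bideg (β : Bimod K A M) : binary β.mulLR ∈ bideg K A M 1 2 :=
  ⟨mulLR_mem_weight β, binary_mem _⟩

theorem extendH_extendH (H : A →ₗ[K] A →ₗ[K] M) :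
    binary (extendH H)⋄binary (extendH H) = 0 :=
  gerstenhaber_binary _ _ fun x y z => by simp

theorem mulLR_mulLR (β : Bimod K A M) : binary β.mulLR⋄binary β.mulLR = 0 :=
  gerstenhaber_binary _ _ fun x y z => by
    ext
    · simp [mul_assoc]
    · simp [β.mul_left, β.left_right, β.right_mul]
      abel

/-- On the `M`-component the bracket is minus the Hochschild coboundary of `H`. -/
theorem extendH_mulLR (β : Bimod K A M) {H : A →ₗ[K] A →ₗ[K] M} (hH : β.IsTwoCocycle H) :
    binary (extendH H)⋄binary β.mulLR = 0 :=
  gerstenhaber_binary _ _ fun x y z => by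
    ext
    · simp
    · have := hH x.1 y.1 z.1
      simp only [extendH_apply, mulLR_apply, Prod.snd_add, Prod.snd_sub, map_zero, zero_add, add_zero,
        LinearMap.zero_apply, Prod.snd_zero]
      linear_combination (norm := module) -this

theorem ofLinear_mem (T : M →ₗ[K] A) : ofLinear T ∈ degreePart K M A 1 :=
  single_mem_degreePart 1 _

theorem parity_apply {d : ℤ} {x : CochSpace K M A} (hx : x ∈ degreePart K M A d) :
    parity x = sgn K d • x := by
  rcases degreePart_cases hx with rfl | ⟨n, f, rfl, rfl⟩
  · simp
  · rw [sgn_natCast, parity]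
    exact extend₁_single _ n f

theorem bracket₂_eq (β : Bimod K A M) {d : ℤ} {x : CochSpace K M A} (hx : x ∈ degreePart K M A d)
    (y : CochSpace K M A) :
    β.bracket₂ x y = sgn K d • component (binary β.mulLR⋄lift x⋄lift y) := by
  rw [Bimod.bracket₂, parity_apply hx]
  simp only [map_smul, LinearMap.smul_apply]

theorem bracket₃_eq (H : A →ₗ[K] A →ₗ[K] M) {a b c : ℤ} {x y z : CochSpace K M A}
    (hx : x ∈ degreePart K M A a) (hy : y ∈ degreePart K M A b) (hz : z ∈ degreePart K M A c) :
    bracket₃ H x y z =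
      -(sgn K b • component (binary (extendH H)⋄lift x⋄lift y⋄lift z)) := by
  rcases degreePart_cases hx with rfl | ⟨p, P, rfl, rfl⟩
  · simp [bracket₃]
  rcases degreePart_cases hy with rfl | ⟨q, Q, rfl, rfl⟩
  · simp [bracket₃]
  rcases degreePart_cases hz with rfl | ⟨r, R, rfl, rfl⟩
  · simp [bracket₃]
  exact ternary_eq H P Q R

theorem lift_bracket₃ (H : A →ₗ[K] A →ₗ[K] M) {a b c : ℤ} {x y z : CochSpace K M A}
    (hx : x ∈ degreePart K M A a) (hy : y ∈ degreePart K M A b) (hz : z ∈ degreePart K M A c) :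
    lift (bracket₃ H x y z) = sgn K (b + 1) • (binary (extendH H)⋄lift x⋄lift y⋄lift z) := by
  have h := isWeightedLie_gerstenhaber.mem (isWeightedLie_gerstenhaber.mem
    (isWeightedLie_gerstenhaber.mem (extendH_mem_bideg H) (lift_mem_bideg hx)) (lift_mem_bideg hy))
    (lift_mem_bideg hz)
  rw [bracket₃_eq H hx hy hz, map_neg, map_smul, lift_component h.1, sgn_add, sgn_one]
  module

section Twisted

variable (β : Bimod K A M) (H : A →ₗ[K] A →ₗ[K] M) (T : M →ₗ[K] A)

/-- The part of weight one of the twisted structure. -/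
abbrev twistM : CochSpace K (A × M) (A × M) :=
  twistOne gerstenhaber (binary (extendH H)) (binary β.mulLR) (lift (ofLinear T))

/-- The part of weight zero of the twisted structure. -/
abbrev twistD : CochSpace K (A × M) (A × M) :=
  twistZero gerstenhaber (binary (extendH H)) (binary β.mulLR) (lift (ofLinear T))

theorem twistM_mem : twistM β H T ∈ bideg K A M 1 2 :=
  isWeightedLie_gerstenhaber.twistOne_mem (extendH_mem_bideg H) (mulLR_mem_bideg β)
    (lift_mem_bideg (ofLinear_mem T))

theorem twistD_mem : twistD β H T ∈ bideg K A M 0 2 :=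
  isWeightedLie_gerstenhaber.twistZero_mem (extendH_mem_bideg H) (mulLR_mem_bideg β)
    (lift_mem_bideg (ofLinear_mem T))

theorem differential_eq {a : ℤ} {x : CochSpace K M A} (hx : x ∈ degreePart K M A a) :
    β.differential H T x = -component (twistD β H T⋄lift x) := by
  rw [Bimod.differential, bracket₂_eq β (ofLinear_mem T),
    bracket₃_eq H (ofLinear_mem T) (ofLinear_mem T) hx, sgn_one, twistD, twistZero]
  simp only [map_add, map_smul, LinearMap.add_apply, LinearMap.smul_apply]
  module

/-- The binary operation of the twisted structure. -/
def twistedBracket₂ (x y : CochSpace K M A) : CochSpace K M A :=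
  β.bracket₂ x y - bracket₃ H (ofLinear T) x y

theorem twistedBracket₂_eq {a b : ℤ} {x y : CochSpace K M A} (hx : x ∈ degreePart K M A a)
    (hy : y ∈ degreePart K M A b) :
    twistedBracket₂ β H T x y = sgn K a • component (twistM β H T⋄lift x⋄lift y) := by
  rw [twistedBracket₂, bracket₂_eq β hx, bracket₃_eq H (ofLinear_mem T) hx hy, twistM, twistOne]
  simp only [map_add, LinearMap.add_apply]
  module

theorem differential_mem {a : ℤ} {x : CochSpace K M A} (hx : x ∈ degreePart K M A a) :
    β.differential H T x ∈ degreePart K M A (a + 1) := by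
  have h := isWeightedLie_gerstenhaber.mem (twistD_mem β H T) (lift_mem_bideg hx)
  rw [differential_eq β H T hx, show a + 1 = 2 + a - 1 by ring]
  exact neg_mem (component_mem h.2)

theorem twistedBracket₂_mem {a b : ℤ} {x y : CochSpace K M A} (hx : x ∈ degreePart K M A a)
    (hy : y ∈ degreePart K M A b) :
    twistedBracket₂ β H T x y ∈ degreePart K M A (a + b) := by
  have h := isWeightedLie_gerstenhaber.mem (isWeightedLie_gerstenhaber.mem (twistM_mem β H T)
    (lift_mem_bideg hx)) (lift_mem_bideg hy)
  rw [twistedBracket₂_eq β H T hx hy, show a + b = 2 + a - 1 + b - 1 by ring]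
  exact Submodule.smul_mem _ _ (component_mem h.2)

theorem bracket₃_mem {a b c : ℤ} {x y z : CochSpace K M A} (hx : x ∈ degreePart K M A a)
    (hy : y ∈ degreePart K M A b) (hz : z ∈ degreePart K M A c) :
    bracket₃ H x y z ∈ degreePart K M A (a + b + c - 1) := by
  have h := isWeightedLie_gerstenhaber.mem (isWeightedLie_gerstenhaber.mem
    (isWeightedLie_gerstenhaber.mem (extendH_mem_bideg H) (lift_mem_bideg hx)) (lift_mem_bideg hy))
    (lift_mem_bideg hz)
  rw [bracket₃_eq H hx hy hz, show a + b + c - 1 = 2 + a - 1 + b - 1 + c - 1 by ring]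
  exact neg_mem (Submodule.smul_mem _ _ (component_mem h.2))

theorem lift_differential {a : ℤ} {x : CochSpace K M A} (hx : x ∈ degreePart K M A a) :
    lift (β.differential H T x) = sgn K 1 • (twistD β H T⋄lift x) := by
  have h := isWeightedLie_gerstenhaber.mem (twistD_mem β H T) (lift_mem_bideg hx)
  rw [differential_eq β H T hx, map_neg, lift_component h.1, sgn_one]
  module

theorem lift_twistedBracket₂ {a b : ℤ} {x y : CochSpace K M A} (hx : x ∈ degreePart K M A a)
    (hy : y ∈ degreePart K M A b) :
    lift (twistedBracket₂ β H T x y) = sgn K a • (twistM β H T⋄lift x⋄lift y) := by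
  have h := isWeightedLie_gerstenhaber.mem (isWeightedLie_gerstenhaber.mem (twistM_mem β H T)
    (lift_mem_bideg hx)) (lift_mem_bideg hy)
  rw [twistedBracket₂_eq β H T hx hy, map_smul, lift_component h.1]

end Twisted

/-! ### The Maurer-Cartan equation -/

/-- The commutator of a bilinear map with a linear map. -/
def derive {V : Type*} [AddCommGroup V] [Module K V] (B : V →ₗ[K] V →ₗ[K] V) (τ : V →ₗ[K] V) :
    V →ₗ[K] V →ₗ[K] V :=
  B.compl₁₂ τ LinearMap.id + B.compl₁₂ LinearMap.id τ - B.compr₂ τ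

theorem derive_apply {V : Type*} [AddCommGroup V] [Module K V] (B : V →ₗ[K] V →ₗ[K] V)
    (τ : V →ₗ[K] V) (x y : V) : derive B τ x y = B (τ x) y + B x (τ y) - τ (B x y) := rfl

theorem gerstenhaber_ofLinear {V : Type*} [AddCommGroup V] [Module K V]
    (B : V →ₗ[K] V →ₗ[K] V) (τ : V →ₗ[K] V) :
    binary B⋄ofLinear τ = binary (derive B τ) := by
  rw [ofLinear, gerstenhaber_eq (binary_mem B) (single_mem_degreePart 1 _), binary, circL_single,
    circL_single]
  have hs : sgn K ((2 + 1) * (((1 : ℕ) : ℤ) + 1)) = sgn K 0 := sgn_congr (by push_cast; decide)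
  rw [hs, sgn_zero, one_smul, ← map_sub]
  refine congrArg (single (K := K) 2) ?_
  ext x
  simp [circ, Fin.sum_univ_two, partialComp, insertArgs, derive]

theorem lift_ofLinear (T : M →ₗ[K] A) :
    lift (ofLinear T) = ofLinear (LinearMap.inl K A M ∘ₗ T ∘ₗ LinearMap.snd K A M) := by
  rw [ofLinear, lift_single]
  rfl

theorem smul_binary_add_smul_binary {V : Type*} [AddCommGroup V] [Module K V] (a b : K)
    (B C : V →ₗ[K] V →ₗ[K] V) : a • binary B + b • binary C = binary (a • B + b • C) := by
  rw [binary, binary, ← map_smul, ← map_smul, ← map_add]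
  rfl

theorem binary_eq_zero_iff {V : Type*} [AddCommGroup V] [Module K V] (B : V →ₗ[K] V →ₗ[K] V) :
    binary B = 0 ↔ ∀ x y, B x y = 0 := by
  rw [binary, ← map_zero (single (K := K) (V := V) (W := V) 2)]
  refine ⟨fun h x y => ?_, fun h => congrArg _ (MultilinearMap.ext fun x => h _ _)⟩
  exact DFunLike.congr_fun (DirectSum.of_injective 2 h) ![x, y]

/-- Write the bracket with `τ`, the lift of `T`, as first-slot insertion plus second-slot insertion
minus post-composition. These commute and square to zero because `τ ∘ τ = 0`. Hence the double
bracket carries a factor `2` and the triple bracket a factor `6`, cancelled by `1/2` and `1/6`. -/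
theorem isTwistedRB_iff [CharZero K] (β : Bimod K A M) (H : A →ₗ[K] A →ₗ[K] M) (T : M →ₗ[K] A) :
    β.IsTwistedRB H T ↔
      twistCurv gerstenhaber (binary (extendH H)) (binary β.mulLR) (lift (ofLinear T)) = 0 := by
  have key : ∀ x y : A × M,
      ((1 / 2 : K) • derive (derive β.mulLR (LinearMap.inl K A M ∘ₗ T ∘ₗ LinearMap.snd K A M))
        (LinearMap.inl K A M ∘ₗ T ∘ₗ LinearMap.snd K A M) + (1 / 6 : K) • derive (derive (derive
        (extendH H) (LinearMap.inl K A M ∘ₗ T ∘ₗ LinearMap.snd K A M))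
        (LinearMap.inl K A M ∘ₗ T ∘ₗ LinearMap.snd K A M))
        (LinearMap.inl K A M ∘ₗ T ∘ₗ LinearMap.snd K A M)) x y =
      (T x.2 * T y.2 - T (β.right x.2 (T y.2) + β.left (T x.2) y.2 + H (T x.2) (T y.2)), 0) := by
    intro x y
    ext
    all_goals
      simp only [LinearMap.add_apply, LinearMap.smul_apply, derive_apply, LinearMap.comp_apply,
        LinearMap.inl_apply, LinearMap.snd_apply, extendH_apply, mulLR_apply, Prod.fst_add,
        Prod.snd_add, Prod.smul_fst, Prod.smul_snd, Prod.fst_sub, Prod.snd_sub, Prod.fst_zero,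
        Prod.snd_zero, map_zero, map_add, map_sub, LinearMap.zero_apply, add_zero, zero_add,
        sub_zero]
      module
  rw [lift_ofLinear, twistCurv]
  simp only [gerstenhaber_ofLinear]
  rw [smul_binary_add_smul_binary, binary_eq_zero_iff]
  simp only [key, Prod.mk_eq_zero, and_true, sub_eq_zero]
  exact ⟨fun h x y => h x.2 y.2, fun h u v => h (0, u) (0, v)⟩

end Brackets

section Unshuffles

/-! ### Unshuffles with few inputs -/

open scoped Classical in
theorem sum_isUnshuffle {n : ℕ} (i : ℕ) (s : List (Equiv.Perm (Fin n))) (hs : s.Nodup)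
    (h : ∀ σ, IsUnshuffle i σ ↔ σ ∈ s) {E : Type*} [AddCommGroup E] (f : Equiv.Perm (Fin n) → E) :
    ∑ σ with IsUnshuffle i σ, f σ = (s.map f).sum := by
  rw [← List.sum_toFinset f hs]
  refine Finset.sum_congr (Finset.ext fun σ => ?_) fun _ _ => rfl
  simp [h]

theorem negOnePow_smul {K : Type*} [Field K] {E : Type*} [AddCommGroup E] [Module K E] (a : ℤ)
    (x : E) : a.negOnePow • x = sgn K a • x := by
  rw [sgn, Int.cast_smul_eq_zsmul]
  rfl

/-- The exponent of `sign σ * koszulSign d σ` modulo two. -/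
def koszulExp {n : ℕ} (D : Fin n → ZMod 2) (σ : Equiv.Perm (Fin n)) : ZMod 2 :=
  ∑ q : Fin n × Fin n, if q.1 < q.2 ∧ σ q.2 < σ q.1 then D (σ q.1) * D (σ q.2) + 1 else 0

/-- Both signs are products over inversions, so their product has as exponent a sum over inversions.
-/
theorem sign_mul_koszulSign {n : ℕ} (d : Fin n → ℤ) (σ : Equiv.Perm (Fin n)) :
    Equiv.Perm.sign σ * koszulSign d σ = (∑ q : Fin n × Fin n,
      if q.1 < q.2 ∧ σ q.2 < σ q.1 then d (σ q.1) * d (σ q.2) + 1 else 0).negOnePow := by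
  have hsum : ∀ (s : Finset (Fin n × Fin n)) (f : Fin n × Fin n → ℤ),
      (∑ q ∈ s, f q).negOnePow = ∏ q ∈ s, (f q).negOnePow := fun s f => by
    induction s using Finset.cons_induction with
    | empty => simp
    | cons a s ha ih => rw [Finset.sum_cons, Finset.prod_cons, Int.negOnePow_add, ih]
  have hs : Equiv.Perm.sign σ =
      ∏ q : Fin n × Fin n, if q.1 < q.2 ∧ σ q.2 < σ q.1 then -1 else 1 := by
    rw [Equiv.Perm.sign_eq_prod_prod_Ioi, ← Finset.univ_product_univ, Finset.prod_product]
    refine Finset.prod_congr rfl fun i _ => ?_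
    have hi : Finset.Ioi i = Finset.univ.filter (fun j => i < j) := by ext; simp
    rw [hi, Finset.prod_filter]
    refine Finset.prod_congr rfl fun j _ => ?_
    by_cases hij : i < j
    · rcases lt_trichotomy (σ i) (σ j) with h | h | h
      · simp [hij, h, h.not_gt]
      · exact absurd (σ.injective h) hij.ne
      · simp [hij, h, h.not_gt]
    · simp [hij]
  rw [hs, koszulSign, ← Finset.prod_mul_distrib, hsum]
  refine Finset.prod_congr rfl fun q _ => ?_
  split_ifs <;> simp [Int.negOnePow_add]

/-- Here `D` stands for the degrees modulo two, so the exponent comparison `h` becomes a finite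
statement. -/
theorem sign_smul {K : Type*} [Field K] {E : Type*} [AddCommGroup E] [Module K E] {n : ℕ}
    {d : Fin n → ℤ} {D : Fin n → ZMod 2} (hD : ∀ i, (d i : ZMod 2) = D i) (σ : Equiv.Perm (Fin n))
    (a b : ℤ) (N : ℕ) (h : koszulExp D σ + N + a = b) (x : E) :
    (Equiv.Perm.sign σ * koszulSign d σ * (-1) ^ N) • (sgn K a • x) = sgn K b • x := by
  have e : ((-1 : ℤˣ) ^ N) = (N : ℤ).negOnePow := by simp [Int.negOnePow_def]
  rw [sign_mul_koszulSign, e, ← Int.negOnePow_add, negOnePow_smul (K := K), smul_smul, ← sgn_add]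
  refine congrArg (· • x) (sgn_congr ?_)
  rw [← h, koszulExp]
  push_cast
  simp only [hD]

open scoped Classical in
theorem sum_unshuffles_one {E : Type*} [AddCommGroup E] (F : Fin 1 → Equiv.Perm (Fin 1) → E) :
    ∑ i' : Fin 1, ∑ σ : Equiv.Perm (Fin 1) with IsUnshuffle (i'.val + 1) σ, F i' σ =
      F 0 ⟨![0], ![0], by decide, by decide⟩ := by
  have e1 : ∑ σ with IsUnshuffle ((0 : Fin 1).val + 1) σ, F 0 σ = _ :=
    sum_isUnshuffle 1 [⟨![0], ![0], by decide, by decide⟩]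
    (by decide) (by unfold IsUnshuffle; decide +kernel) (F 0)
  rw [Finset.univ_unique, Finset.sum_singleton, Fin.default_eq_zero, e1]
  simp only [List.map_cons, List.map_nil, List.sum_cons, List.sum_nil, add_zero]

open scoped Classical in
theorem sum_unshuffles_two {E : Type*} [AddCommGroup E] (F : Fin 2 → Equiv.Perm (Fin 2) → E) :
    ∑ i' : Fin 2, ∑ σ : Equiv.Perm (Fin 2) with IsUnshuffle (i'.val + 1) σ, F i' σ =
      F 0 ⟨![0, 1], ![0, 1], by decide, by decide⟩ +
      F 0 ⟨![1, 0], ![1, 0], by decide, by decide⟩ +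
      F 1 ⟨![0, 1], ![0, 1], by decide, by decide⟩ := by
  have e1 : ∑ σ with IsUnshuffle ((0 : Fin 2).val + 1) σ, F 0 σ = _ :=
    sum_isUnshuffle 1 [⟨![0, 1], ![0, 1], by decide, by decide⟩,
    ⟨![1, 0], ![1, 0], by decide, by decide⟩]
    (by decide) (by unfold IsUnshuffle; decide +kernel) (F 0)
  have e2 : ∑ σ with IsUnshuffle ((1 : Fin 2).val + 1) σ, F 1 σ = _ :=
    sum_isUnshuffle 2 [⟨![0, 1], ![0, 1], by decide, by decide⟩]
    (by decide) (by unfold IsUnshuffle; decide +kernel) (F 1)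
  rw [Fin.sum_univ_two, e1, e2]
  simp only [List.map_cons, List.map_nil, List.sum_cons, List.sum_nil, add_zero]

open scoped Classical in
theorem sum_unshuffles_three {E : Type*} [AddCommGroup E] (F : Fin 3 → Equiv.Perm (Fin 3) → E) :
    ∑ i' : Fin 3, ∑ σ : Equiv.Perm (Fin 3) with IsUnshuffle (i'.val + 1) σ, F i' σ =
      F 1 ⟨![0, 1, 2], ![0, 1, 2], by decide, by decide⟩ +
      F 1 ⟨![0, 2, 1], ![0, 2, 1], by decide, by decide⟩ +
      F 1 ⟨![1, 2, 0], ![2, 0, 1], by decide, by decide⟩ +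
      F 0 ⟨![0, 1, 2], ![0, 1, 2], by decide, by decide⟩ +
      F 0 ⟨![1, 0, 2], ![1, 0, 2], by decide, by decide⟩ +
      F 0 ⟨![2, 0, 1], ![1, 2, 0], by decide, by decide⟩ +
      F 2 ⟨![0, 1, 2], ![0, 1, 2], by decide, by decide⟩ := by
  have e1 : ∑ σ with IsUnshuffle ((0 : Fin 3).val + 1) σ, F 0 σ = _ :=
    sum_isUnshuffle 1 [⟨![0, 1, 2], ![0, 1, 2], by decide, by decide⟩,
    ⟨![1, 0, 2], ![1, 0, 2], by decide, by decide⟩,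
    ⟨![2, 0, 1], ![1, 2, 0], by decide, by decide⟩]
    (by decide) (by unfold IsUnshuffle; decide +kernel) (F 0)
  have e2 : ∑ σ with IsUnshuffle ((1 : Fin 3).val + 1) σ, F 1 σ = _ :=
    sum_isUnshuffle 2 [⟨![0, 1, 2], ![0, 1, 2], by decide, by decide⟩,
    ⟨![0, 2, 1], ![0, 2, 1], by decide, by decide⟩,
    ⟨![1, 2, 0], ![2, 0, 1], by decide, by decide⟩]
    (by decide) (by unfold IsUnshuffle; decide +kernel) (F 1)
  have e3 : ∑ σ with IsUnshuffle ((2 : Fin 3).val + 1) σ, F 2 σ = _ :=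
    sum_isUnshuffle 3 [⟨![0, 1, 2], ![0, 1, 2], by decide, by decide⟩]
    (by decide) (by unfold IsUnshuffle; decide +kernel) (F 2)
  rw [Fin.sum_univ_three, e1, e2, e3]
  simp only [List.map_cons, List.map_nil, List.sum_cons, List.sum_nil, add_zero]
  abel

-- With four inputs, `i = 1` and `i = 4` involve an operation of arity four, hence the two vanishing
-- hypotheses. The summands follow the order of `jacobi_four`, to allow comparison term by term.
open scoped Classical in
theorem sum_unshuffles_four {E : Type*} [AddCommGroup E] (F : Fin 4 → Equiv.Perm (Fin 4) → E)
    (h0 : ∀ σ, F 0 σ = 0)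
    (h3 : ∀ σ, F 3 σ = 0) :
    ∑ i' : Fin 4, ∑ σ : Equiv.Perm (Fin 4) with IsUnshuffle (i'.val + 1) σ, F i' σ =
      F 1 ⟨![0, 1, 2, 3], ![0, 1, 2, 3], by decide, by decide⟩ +
      F 1 ⟨![0, 2, 1, 3], ![0, 2, 1, 3], by decide, by decide⟩ +
      F 1 ⟨![0, 3, 1, 2], ![0, 2, 3, 1], by decide, by decide⟩ +
      F 2 ⟨![1, 2, 3, 0], ![3, 0, 1, 2], by decide, by decide⟩ +
      F 1 ⟨![1, 2, 0, 3], ![2, 0, 1, 3], by decide, by decide⟩ +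
      F 1 ⟨![1, 3, 0, 2], ![2, 0, 3, 1], by decide, by decide⟩ +
      F 2 ⟨![0, 2, 3, 1], ![0, 3, 1, 2], by decide, by decide⟩ +
      F 1 ⟨![2, 3, 0, 1], ![2, 3, 0, 1], by decide, by decide⟩ +
      F 2 ⟨![0, 1, 3, 2], ![0, 1, 3, 2], by decide, by decide⟩ +
      F 2 ⟨![0, 1, 2, 3], ![0, 1, 2, 3], by decide, by decide⟩ := by
  have e1 : ∑ σ with IsUnshuffle ((0 : Fin 4).val + 1) σ, F 0 σ = 0 :=
    Finset.sum_eq_zero fun σ _ => h0 σ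
  have e4 : ∑ σ with IsUnshuffle ((3 : Fin 4).val + 1) σ, F 3 σ = 0 :=
    Finset.sum_eq_zero fun σ _ => h3 σ
  have e2 : ∑ σ with IsUnshuffle ((1 : Fin 4).val + 1) σ, F 1 σ = _ :=
    sum_isUnshuffle 2 [⟨![0, 1, 2, 3], ![0, 1, 2, 3], by decide, by decide⟩,
    ⟨![0, 2, 1, 3], ![0, 2, 1, 3], by decide, by decide⟩,
    ⟨![0, 3, 1, 2], ![0, 2, 3, 1], by decide, by decide⟩,
    ⟨![1, 2, 0, 3], ![2, 0, 1, 3], by decide, by decide⟩,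
    ⟨![1, 3, 0, 2], ![2, 0, 3, 1], by decide, by decide⟩,
    ⟨![2, 3, 0, 1], ![2, 3, 0, 1], by decide, by decide⟩]
    (by decide) (by unfold IsUnshuffle; decide +kernel) (F 1)
  have e3 : ∑ σ with IsUnshuffle ((2 : Fin 4).val + 1) σ, F 2 σ = _ :=
    sum_isUnshuffle 3 [⟨![1, 2, 3, 0], ![3, 0, 1, 2], by decide, by decide⟩,
    ⟨![0, 2, 3, 1], ![0, 3, 1, 2], by decide, by decide⟩,
    ⟨![0, 1, 3, 2], ![0, 1, 3, 2], by decide, by decide⟩,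
    ⟨![0, 1, 2, 3], ![0, 1, 2, 3], by decide, by decide⟩]
    (by decide) (by unfold IsUnshuffle; decide +kernel) (F 2)
  rw [Fin.sum_univ_four, e1, e2, e3, e4]
  simp only [List.map_cons, List.map_nil, List.sum_cons, List.sum_nil, add_zero, zero_add]
  abel

-- Only `i = j = 3` avoids operations of arity at least four; the order of the ten unshuffles is
-- that of `jacobi_five`.
open scoped Classical in
theorem sum_unshuffles_five {E : Type*} [AddCommGroup E] (F : Fin 5 → Equiv.Perm (Fin 5) → E)
    (h0 : ∀ σ, F 0 σ = 0)
    (h1 : ∀ σ, F 1 σ = 0)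
    (h3 : ∀ σ, F 3 σ = 0)
    (h4 : ∀ σ, F 4 σ = 0) :
    ∑ i' : Fin 5, ∑ σ : Equiv.Perm (Fin 5) with IsUnshuffle (i'.val + 1) σ, F i' σ =
      F 2 ⟨![0, 1, 2, 3, 4], ![0, 1, 2, 3, 4], by decide, by decide⟩ +
      F 2 ⟨![0, 1, 3, 2, 4], ![0, 1, 3, 2, 4], by decide, by decide⟩ +
      F 2 ⟨![0, 1, 4, 2, 3], ![0, 1, 3, 4, 2], by decide, by decide⟩ +
      F 2 ⟨![2, 3, 4, 0, 1], ![3, 4, 0, 1, 2], by decide, by decide⟩ +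
      F 2 ⟨![0, 2, 3, 1, 4], ![0, 3, 1, 2, 4], by decide, by decide⟩ +
      F 2 ⟨![0, 2, 4, 1, 3], ![0, 3, 1, 4, 2], by decide, by decide⟩ +
      F 2 ⟨![1, 3, 4, 0, 2], ![3, 0, 4, 1, 2], by decide, by decide⟩ +
      F 2 ⟨![0, 3, 4, 1, 2], ![0, 3, 4, 1, 2], by decide, by decide⟩ +
      F 2 ⟨![1, 2, 4, 0, 3], ![3, 0, 1, 4, 2], by decide, by decide⟩ +
      F 2 ⟨![1, 2, 3, 0, 4], ![3, 0, 1, 2, 4], by decide, by decide⟩ := by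
  have e1 : ∑ σ with IsUnshuffle ((0 : Fin 5).val + 1) σ, F 0 σ = 0 :=
    Finset.sum_eq_zero fun σ _ => h0 σ
  have e2 : ∑ σ with IsUnshuffle ((1 : Fin 5).val + 1) σ, F 1 σ = 0 :=
    Finset.sum_eq_zero fun σ _ => h1 σ
  have e4 : ∑ σ with IsUnshuffle ((3 : Fin 5).val + 1) σ, F 3 σ = 0 :=
    Finset.sum_eq_zero fun σ _ => h3 σ
  have e5 : ∑ σ with IsUnshuffle ((4 : Fin 5).val + 1) σ, F 4 σ = 0 :=
    Finset.sum_eq_zero fun σ _ => h4 σ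
  have e3 : ∑ σ with IsUnshuffle ((2 : Fin 5).val + 1) σ, F 2 σ = _ :=
    sum_isUnshuffle 3 [⟨![0, 1, 2, 3, 4], ![0, 1, 2, 3, 4], by decide, by decide⟩,
    ⟨![0, 1, 3, 2, 4], ![0, 1, 3, 2, 4], by decide, by decide⟩,
    ⟨![0, 1, 4, 2, 3], ![0, 1, 3, 4, 2], by decide, by decide⟩,
    ⟨![2, 3, 4, 0, 1], ![3, 4, 0, 1, 2], by decide, by decide⟩,
    ⟨![0, 2, 3, 1, 4], ![0, 3, 1, 2, 4], by decide, by decide⟩,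
    ⟨![0, 2, 4, 1, 3], ![0, 3, 1, 4, 2], by decide, by decide⟩,
    ⟨![1, 3, 4, 0, 2], ![3, 0, 4, 1, 2], by decide, by decide⟩,
    ⟨![0, 3, 4, 1, 2], ![0, 3, 4, 1, 2], by decide, by decide⟩,
    ⟨![1, 2, 4, 0, 3], ![3, 0, 1, 4, 2], by decide, by decide⟩,
    ⟨![1, 2, 3, 0, 4], ![3, 0, 1, 2, 4], by decide, by decide⟩]
    (by decide) (by unfold IsUnshuffle; decide +kernel) (F 2)
  rw [Fin.sum_univ_five, e1, e2, e3, e4, e5]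
  simp only [List.map_cons, List.map_nil, List.sum_cons, List.sum_nil, add_zero, zero_add]
  abel
end Unshuffles

section DerivedOperations

/-! ### Operations given by iterated brackets -/

variable {K : Type*} [Field K] {L E : Type*} [AddCommGroup L] [Module K L] [AddCommGroup E]
  [Module K E]

/-- The iterated brackets of at most three elements with `d`, `m` and `h`. -/
def derivedWord (B : E →ₗ[K] E →ₗ[K] E) (d m h : E) : (k : ℕ) → (Fin k → E) → E
  | 1, y => B d (y 0)
  | 2, y => B (B m (y 0)) (y 1)
  | 3, y => B (B (B h (y 0)) (y 1)) (y 2)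
  | _, _ => 0

/-- The exponent of the sign between the iterated brackets and the operations. -/
def derivedExp : (k : ℕ) → (Fin k → ZMod 2) → ZMod 2
  | 1, _ => 1
  | 2, D => D 0
  | 3, D => D 1 + 1
  | _, _ => 0

/-- The operations `l` on `L` are, up to signs, the iterated brackets with `d`, `m` and `h`. -/
structure IsDerived (B : E →ₗ[K] E →ₗ[K] E) (W : ℤ → ℤ → Submodule K E) (φ : L →ₗ[K] E)
    (𝒜 : ℤ → Submodule K L) (l : (k : ℕ) → MultilinearMap K (fun _ : Fin k => L) L)
    (d m h : E) : Prop where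
  lie : IsWeightedLie B W
  injective : Function.Injective φ
  map_mem : ∀ {a : ℤ} {x : L}, x ∈ 𝒜 a → φ x ∈ W (-1) a
  degree : ∀ (k : ℕ) (e : Fin k → ℤ) (x : Fin k → L), (∀ a, x a ∈ 𝒜 (e a)) →
    l k x ∈ 𝒜 (∑ a, e a + (2 - (k : ℤ)))
  apply : ∀ (k : ℕ) (e : Fin k → ℤ) (x : Fin k → L), (∀ a, x a ∈ 𝒜 (e a)) →
    ∀ b : ℤ, (b : ZMod 2) = derivedExp k (fun a => (e a : ZMod 2)) →
    φ (l k x) = sgn K b • derivedWord B d m h k (fun a => φ (x a))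
  eq_zero : ∀ k, 4 ≤ k → l k = 0
  mem_h : h ∈ W 2 2
  mem_m : m ∈ W 1 2
  mem_d : d ∈ W 0 2
  bracket_hh : ∀ {a : ℤ} {x : E}, x ∈ W (-1) a → B h (B h x) = 0
  bracket_hm : B h m = 0
  bracket_mm : B m m + (2 : K) • B h d = 0
  bracket_md : B m d = 0
  bracket_dd : B d d = 0

/-- The summands of the higher Jacobi identities. -/
def jacobiTerm (l : (k : ℕ) → MultilinearMap K (fun _ : Fin k => L) L) {n : ℕ} (d : Fin n → ℤ)
    (x : Fin n → L) (i' : Fin n) (σ : Equiv.Perm (Fin n)) : L :=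
  (Equiv.Perm.sign σ * koszulSign d σ * (-1) ^ ((i'.val + 1) * (n - (i'.val + 1)))) •
    l ((n - (i'.val + 1)) + 1)
      (Fin.cons (l (i'.val + 1) (fun a => x (σ ⟨a.val, by omega⟩)))
        (fun b : Fin (n - (i'.val + 1)) => x (σ ⟨i'.val + 1 + b.val, by omega⟩)))

theorem map_unit_smul (φ : L →ₗ[K] E) (u : ℤˣ) (x : L) : φ (u • x) = u • φ x := by
  rw [Units.smul_def, Units.smul_def, map_zsmul]

theorem derivedWord_cons (B : E →ₗ[K] E →ₗ[K] E) (d m h : E) (n : ℕ) (c : K) (y : E)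
    (z : Fin n → E) : derivedWord B d m h (n + 1) (Fin.cons (c • y) z) =
      c • derivedWord B d m h (n + 1) (Fin.cons y z) := by
  rcases n with _ | _ | _ | n
  · exact map_smul _ _ _
  · change B (B m (c • y)) (z 0) = c • B (B m y) (z 0)
    simp
  · change B (B (B h (c • y)) (z 0)) (z 1) = c • B (B (B h y) (z 0)) (z 1)
    simp
  · exact (smul_zero c).symm

namespace IsDerived

variable {B : E →ₗ[K] E →ₗ[K] E} {W : ℤ → ℤ → Submodule K E} {φ : L →ₗ[K] E}
  {𝒜 : ℤ → Submodule K L} {l : (k : ℕ) → MultilinearMap K (fun _ : Fin k => L) L} {d m h : E}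

/-- Operations derived from a twisted structure. -/
theorem of_twist [CharZero K] {μ t : E} (lie : IsWeightedLie B W) (injective : Function.Injective φ)
    (map_mem : ∀ {a : ℤ} {x : L}, x ∈ 𝒜 a → φ x ∈ W (-1) a)
    (degree : ∀ (k : ℕ) (e : Fin k → ℤ) (x : Fin k → L), (∀ a, x a ∈ 𝒜 (e a)) →
      l k x ∈ 𝒜 (∑ a, e a + (2 - (k : ℤ))))
    (apply : ∀ (k : ℕ) (e : Fin k → ℤ) (x : Fin k → L), (∀ a, x a ∈ 𝒜 (e a)) →
      ∀ b : ℤ, (b : ZMod 2) = derivedExp k (fun a => (e a : ZMod 2)) →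
      φ (l k x) = sgn K b •
        derivedWord B (twistZero B h μ t) (twistOne B h μ t) h k (fun a => φ (x a)))
    (eq_zero : ∀ k, 4 ≤ k → l k = 0) (hh : h ∈ W 2 2) (hμ : μ ∈ W 1 2) (ht : t ∈ W (-1) 1)
    (hhh : B h h = 0) (hhμ : B h μ = 0) (hμμ : B μ μ = 0) (hc : twistCurv B h μ t = 0) :
    IsDerived B W φ 𝒜 l (twistZero B h μ t) (twistOne B h μ t) h where
  lie := lie
  injective := injective
  map_mem := map_mem
  degree := degree
  apply := apply
  eq_zero := eq_zero
  mem_h := hh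
  mem_m := lie.twistOne_mem hh hμ ht
  mem_d := lie.twistZero_mem hh hμ ht
  bracket_hh := lie.bracket_bracket_self hh hhh
  bracket_hm := lie.twist_hm hh ht hhh hhμ
  bracket_mm := lie.twist_mm hh hμ ht hhh hhμ hμμ
  bracket_md := lie.twist_md hh hμ ht hhh hhμ hμμ hc
  bracket_dd := lie.twist_dd hh hμ ht hhh hhμ hμμ hc

theorem jacobiTerm_eq_zero (S : IsDerived B W φ 𝒜 l d m h) {n : ℕ} (e : Fin n → ℤ)
    (x : Fin n → L) (i' : Fin n) (σ : Equiv.Perm (Fin n))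
    (hi : 4 ≤ i'.val + 1 ∨ 4 ≤ n - (i'.val + 1) + 1) : jacobiTerm l e x i' σ = 0 := by
  rw [jacobiTerm]
  rcases hi with hi | hi
  · rw [S.eq_zero _ hi, MultilinearMap.map_coord_zero _ 0 rfl, smul_zero]
  · rw [S.eq_zero _ hi, zero_apply, smul_zero]

/-- The exponent collects the Koszul sign, the factor `(-1)^(i(j-1))`, and the signs relating the
outer and the inner operation to iterated brackets. It is a function of the degrees in `ZMod 2`, so
each later use is a finite check. -/
theorem map_jacobiTerm (S : IsDerived B W φ 𝒜 l d m h) {n : ℕ} {e : Fin n → ℤ}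
    {D : Fin n → ZMod 2} (hD : ∀ i, (e i : ZMod 2) = D i) {x : Fin n → L}
    (hx : ∀ a, x a ∈ 𝒜 (e a)) (i' : Fin n) (σ : Equiv.Perm (Fin n)) (b : ℤ)
    (hb : (b : ZMod 2) = koszulExp D σ + (((i'.val + 1) * (n - (i'.val + 1)) : ℕ) : ZMod 2) +
      (derivedExp ((n - (i'.val + 1)) + 1) (Fin.cons
        (∑ a : Fin (i'.val + 1), D (σ ⟨a.val, by omega⟩) + (i'.val + 1 : ℕ))
        (fun b : Fin (n - (i'.val + 1)) => D (σ ⟨i'.val + 1 + b.val, by omega⟩))) +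
      derivedExp (i'.val + 1) (fun a => D (σ ⟨a.val, by omega⟩)))) :
    φ (jacobiTerm l e x i' σ) = sgn K b • derivedWord B d m h ((n - (i'.val + 1)) + 1)
      (Fin.cons (derivedWord B d m h (i'.val + 1) (fun a => φ (x (σ ⟨a.val, by omega⟩))))
        (fun b : Fin (n - (i'.val + 1)) => φ (x (σ ⟨i'.val + 1 + b.val, by omega⟩)))) := by
  obtain ⟨p, hp⟩ := ZMod.intCast_surjective
    (derivedExp (i'.val + 1) (fun a => D (σ ⟨a.val, by omega⟩)))
  obtain ⟨q, hq⟩ := ZMod.intCast_surjective (derivedExp ((n - (i'.val + 1)) + 1) (Fin.cons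
        (∑ a : Fin (i'.val + 1), D (σ ⟨a.val, by omega⟩) + (i'.val + 1 : ℕ))
        (fun b : Fin (n - (i'.val + 1)) => D (σ ⟨i'.val + 1 + b.val, by omega⟩))))
  have h₁ := S.apply (i'.val + 1) (fun a => e (σ ⟨a.val, by omega⟩))
    (fun a => x (σ ⟨a.val, by omega⟩)) (fun a => hx _) p (by simp only [hp, hD])
  have h₂ := S.degree (i'.val + 1) (fun a => e (σ ⟨a.val, by omega⟩))
    (fun a => x (σ ⟨a.val, by omega⟩)) (fun a => hx _)
  have h₃ := S.apply ((n - (i'.val + 1)) + 1) (Fin.cons _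
    (fun b : Fin (n - (i'.val + 1)) => e (σ ⟨i'.val + 1 + b.val, by omega⟩)))
    (Fin.cons _ (fun b : Fin (n - (i'.val + 1)) => x (σ ⟨i'.val + 1 + b.val, by omega⟩)))
    (Fin.cases h₂ fun b => hx _) q (by
      rw [hq]
      congr 1
      funext a
      refine Fin.cases ?_ (fun a => ?_) a
      · simp only [Fin.cons_zero]
        push_cast
        simp only [hD]
        -- The inner operation shifts the degree by `2 - i`, which is `i` modulo two.
        have : (2 : ZMod 2) = 0 := rfl
        rw [this, zero_sub, ZMod.neg_eq_self_mod_two]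
      · simp only [Fin.cons_succ, hD])
  have h₄ : (fun a => φ ((Fin.cons (l (i'.val + 1) (fun a => x (σ ⟨a.val, by omega⟩)))
      (fun b : Fin (n - (i'.val + 1)) => x (σ ⟨i'.val + 1 + b.val, by omega⟩)) :
      Fin ((n - (i'.val + 1)) + 1) → L) a)) = Fin.cons (sgn K p • derivedWord B d m h (i'.val + 1)
        (fun a => φ (x (σ ⟨a.val, by omega⟩))))
      (fun b : Fin (n - (i'.val + 1)) => φ (x (σ ⟨i'.val + 1 + b.val, by omega⟩))) := by
    funext a
    refine Fin.cases ?_ (fun a => ?_) a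
    · exact h₁
    · rfl
  rw [jacobiTerm, map_unit_smul, h₃, h₄, derivedWord_cons, smul_smul, ← sgn_add]
  refine sign_smul hD σ _ _ _ ?_ _
  rw [hb, ← hp, ← hq]
  push_cast
  rfl

end IsDerived

end DerivedOperations

/-! ### Higher Jacobi identities for derived operations -/

section DerivedJacobi

variable {K : Type*} [Field K] {L E : Type*} [AddCommGroup L] [Module K L] [AddCommGroup E]
  [Module K E]

namespace IsDerived

variable [CharZero K] {B : E →ₗ[K] E →ₗ[K] E} {W : ℤ → ℤ → Submodule K E} {φ : L →ₗ[K] E}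
  {𝒜 : ℤ → Submodule K L} {l : (k : ℕ) → MultilinearMap K (fun _ : Fin k => L) L} {d m h : E}

open scoped Classical in
theorem jacobi_one_input (S : IsDerived B W φ 𝒜 l d m h) (e : Fin 1 → ℤ) (x : Fin 1 → L)
    (hx : ∀ a, x a ∈ 𝒜 (e a)) :
    ∑ i' : Fin 1, ∑ σ : Equiv.Perm (Fin 1) with IsUnshuffle (i'.val + 1) σ,
      jacobiTerm l e x i' σ = 0 := by
  have J := S.lie.bracket_bracket_self S.mem_d S.bracket_dd (S.map_mem (hx 0))
  obtain ⟨D, hD⟩ : ∃ D : Fin 1 → ZMod 2, ∀ i, (e i : ZMod 2) = D i := ⟨_, fun _ => rfl⟩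
  refine S.injective ?_
  rw [sum_unshuffles_one (jacobiTerm l e x)]
  refine Eq.trans ?_ (map_zero φ).symm
  refine Eq.trans ?_ (smul_zero (sgn K 0))
  rw [← J]
  refine S.map_jacobiTerm hD hx _ _ _ ?_
  push_cast
  clear hD J
  revert D
  decide +kernel

open scoped Classical in
theorem jacobi_two_inputs (S : IsDerived B W φ 𝒜 l d m h) (e : Fin 2 → ℤ) (x : Fin 2 → L)
    (hx : ∀ a, x a ∈ 𝒜 (e a)) :
    ∑ i' : Fin 2, ∑ σ : Equiv.Perm (Fin 2) with IsUnshuffle (i'.val + 1) σ,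
      jacobiTerm l e x i' σ = 0 := by
  have J := S.lie.jacobi_two S.mem_m S.mem_d S.bracket_md
    (S.map_mem (hx 0)) (S.map_mem (hx 1))
  obtain ⟨D, hD⟩ : ∃ D : Fin 2 → ZMod 2, ∀ i, (e i : ZMod 2) = D i := ⟨_, fun _ => rfl⟩
  refine S.injective ?_
  rw [sum_unshuffles_two (jacobiTerm l e x)]
  refine Eq.trans ?_ (map_zero φ).symm
  -- The Jacobi sum is the derived identity `J` multiplied by this overall sign. The proofs for
  -- other numbers of inputs use the corresponding factor.
  refine Eq.trans ?_ (smul_zero (sgn K (e 0 + 1)))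
  rw [← J]
  simp only [map_add, smul_add, smul_smul, ← sgn_add]
  repeat' refine add_congr ?_ ?_
  all_goals
    refine S.map_jacobiTerm hD hx _ _ _ ?_
    push_cast
    simp only [hD]
    clear hD J
    revert D
    decide +kernel

open scoped Classical in
theorem jacobi_three_inputs (S : IsDerived B W φ 𝒜 l d m h) (e : Fin 3 → ℤ) (x : Fin 3 → L)
    (hx : ∀ a, x a ∈ 𝒜 (e a)) :
    ∑ i' : Fin 3, ∑ σ : Equiv.Perm (Fin 3) with IsUnshuffle (i'.val + 1) σ,
      jacobiTerm l e x i' σ = 0 := by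
  have J := S.lie.jacobi_three S.mem_h S.mem_m S.mem_d
    (S.lie.bracket_mm_hd S.mem_h S.mem_m S.mem_d S.bracket_mm (S.map_mem (hx 0)))
    (S.map_mem (hx 0)) (S.map_mem (hx 1)) (S.map_mem (hx 2))
  obtain ⟨D, hD⟩ : ∃ D : Fin 3 → ZMod 2, ∀ i, (e i : ZMod 2) = D i := ⟨_, fun _ => rfl⟩
  refine S.injective ?_
  rw [sum_unshuffles_three (jacobiTerm l e x)]
  refine Eq.trans ?_ (map_zero φ).symm
  refine Eq.trans ?_ (smul_zero (sgn K (e 1)))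
  rw [← J]
  simp only [map_add, smul_add, smul_smul, ← sgn_add]
  repeat' refine add_congr ?_ ?_
  all_goals
    refine S.map_jacobiTerm hD hx _ _ _ ?_
    push_cast
    simp only [hD]
    clear hD J
    revert D
    decide +kernel

open scoped Classical in
theorem jacobi_four_inputs (S : IsDerived B W φ 𝒜 l d m h) (e : Fin 4 → ℤ) (x : Fin 4 → L)
    (hx : ∀ a, x a ∈ 𝒜 (e a)) :
    ∑ i' : Fin 4, ∑ σ : Equiv.Perm (Fin 4) with IsUnshuffle (i'.val + 1) σ,
      jacobiTerm l e x i' σ = 0 := by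
  have J := S.lie.jacobi_four S.mem_h S.mem_m S.bracket_hm
    (S.map_mem (hx 0)) (S.map_mem (hx 1)) (S.map_mem (hx 2)) (S.map_mem (hx 3))
  obtain ⟨D, hD⟩ : ∃ D : Fin 4 → ZMod 2, ∀ i, (e i : ZMod 2) = D i := ⟨_, fun _ => rfl⟩
  refine S.injective ?_
  rw [sum_unshuffles_four (jacobiTerm l e x)
    (fun σ => S.jacobiTerm_eq_zero e x 0 σ (by decide))
    (fun σ => S.jacobiTerm_eq_zero e x 3 σ (by decide))]
  refine Eq.trans ?_ (map_zero φ).symm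
  refine Eq.trans ?_ (smul_zero (sgn K (e 0 + e 2 + 1)))
  rw [← J]
  simp only [map_add, smul_add, smul_smul, ← sgn_add]
  repeat' refine add_congr ?_ ?_
  all_goals
    refine S.map_jacobiTerm hD hx _ _ _ ?_
    push_cast
    simp only [hD]
    clear hD J
    revert D
    decide +kernel

open scoped Classical in
theorem jacobi_five_inputs (S : IsDerived B W φ 𝒜 l d m h) (e : Fin 5 → ℤ) (x : Fin 5 → L)
    (hx : ∀ a, x a ∈ 𝒜 (e a)) :
    ∑ i' : Fin 5, ∑ σ : Equiv.Perm (Fin 5) with IsUnshuffle (i'.val + 1) σ,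
      jacobiTerm l e x i' σ = 0 := by
  have J := S.lie.jacobi_five S.mem_h (S.bracket_hh (S.map_mem (hx 0)))
    (S.map_mem (hx 0)) (S.map_mem (hx 1)) (S.map_mem (hx 2)) (S.map_mem (hx 3)) (S.map_mem (hx 4))
  obtain ⟨D, hD⟩ : ∃ D : Fin 5 → ZMod 2, ∀ i, (e i : ZMod 2) = D i := ⟨_, fun _ => rfl⟩
  refine S.injective ?_
  rw [sum_unshuffles_five (jacobiTerm l e x)
    (fun σ => S.jacobiTerm_eq_zero e x 0 σ (by decide))
    (fun σ => S.jacobiTerm_eq_zero e x 1 σ (by decide))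
    (fun σ => S.jacobiTerm_eq_zero e x 3 σ (by decide))
    (fun σ => S.jacobiTerm_eq_zero e x 4 σ (by decide))]
  refine Eq.trans ?_ (map_zero φ).symm
  refine Eq.trans ?_ (smul_zero (sgn K (e 1 + e 3)))
  rw [← J]
  simp only [map_add, smul_add, smul_smul, ← sgn_add]
  repeat' refine add_congr ?_ ?_
  all_goals
    refine S.map_jacobiTerm hD hx _ _ _ ?_
    push_cast
    simp only [hD]
    clear hD J
    revert D
    decide +kernel
open scoped Classical in
theorem jacobi (S : IsDerived B W φ 𝒜 l d m h) (n : ℕ) (hn : 1 ≤ n) (e : Fin n → ℤ) (x : Fin n → L)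
    (hx : ∀ a, x a ∈ 𝒜 (e a)) :
    ∑ i' : Fin n, ∑ σ : Equiv.Perm (Fin n) with IsUnshuffle (i'.val + 1) σ,
      jacobiTerm l e x i' σ = 0 := by
  rcases le_or_gt n 5 with h | h
  · interval_cases n
    · exact S.jacobi_one_input e x hx
    · exact S.jacobi_two_inputs e x hx
    · exact S.jacobi_three_inputs e x hx
    · exact S.jacobi_four_inputs e x hx
    · exact S.jacobi_five_inputs e x hx
  -- For `n ≥ 6` the equation `i + j = n + 1` makes `i` or `j` at least four.
  · exact Finset.sum_eq_zero fun i' _ => Finset.sum_eq_zero fun σ _ =>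
      S.jacobiTerm_eq_zero e x i' σ (by omega)

end IsDerived

end DerivedJacobi

/-! ### Graded skew-symmetry of derived operations -/

section DerivedSkew

variable {K : Type*} [Field K] {L E : Type*} [AddCommGroup L] [Module K L] [AddCommGroup E]
  [Module K E]

namespace IsDerived

variable {B : E →ₗ[K] E →ₗ[K] E} {W : ℤ → ℤ → Submodule K E} {φ : L →ₗ[K] E}
  {𝒜 : ℤ → Submodule K L} {l : (k : ℕ) → MultilinearMap K (fun _ : Fin k => L) L} {d m h : E}

/-- Elements of weight `-1` act by graded commuting operators, so permuting the inputs changes an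
iterated bracket by a sign `c`. Skew-symmetry of `l k` is then the parity condition `hc`, whose last
two summands are the sign conventions before and after the permutation. -/
theorem skew_of_derivedWord (S : IsDerived B W φ 𝒜 l d m h) {k : ℕ} {e : Fin k → ℤ}
    {x : Fin k → L} (hx : ∀ a, x a ∈ 𝒜 (e a)) (σ : Equiv.Perm (Fin k)) (c : ℤ)
    (hw : derivedWord B d m h k (fun a => φ (x (σ a))) =
      sgn K c • derivedWord B d m h k (fun a => φ (x a)))
    (hc : ∀ D : Fin k → ZMod 2, (∀ i, (e i : ZMod 2) = D i) →
      (c : ZMod 2) = koszulExp D σ + derivedExp k (fun a => D (σ a)) + derivedExp k D) :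
    l k (fun a => x (σ a)) = (Equiv.Perm.sign σ * koszulSign e σ) • l k x := by
  have hc := hc _ fun _ => rfl
  obtain ⟨p, hp⟩ := ZMod.intCast_surjective (derivedExp k fun a => (e (σ a) : ZMod 2))
  obtain ⟨q, hq⟩ := ZMod.intCast_surjective (derivedExp k fun a => (e a : ZMod 2))
  have hs := sign_smul (K := K) (fun i => rfl) σ q (p + c) 0 (by
    push_cast; rw [hc, hp, hq]
    linear_combination -CharTwo.add_self_eq_zero (derivedExp k fun a => (e (σ a) : ZMod 2)))
    (derivedWord B d m h k fun a => φ (x a))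
  rw [pow_zero, mul_one] at hs
  refine S.injective ?_
  rw [map_unit_smul, S.apply k (fun a => e (σ a)) _ (fun a => hx _) p hp, S.apply k e x hx q hq, hw,
    smul_smul, ← sgn_add, hs]

theorem skew (S : IsDerived B W φ 𝒜 l d m h) (k : ℕ) (e : Fin k → ℤ) (x : Fin k → L)
    (hx : ∀ a, x a ∈ 𝒜 (e a)) (σ : Equiv.Perm (Fin k)) :
    l k (fun a => x (σ a)) = (Equiv.Perm.sign σ * koszulSign e σ) • l k x := by
  have hm := S.mem_m
  have hh := S.mem_h
  rcases k with _ | _ | _ | _ | k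
  · refine S.skew_of_derivedWord hx σ 0 (by rw [sgn_zero, one_smul]; rfl) ?_
    intro D hD; push_cast; clear hD; revert D σ; decide
  · obtain rfl : σ = 1 := Subsingleton.elim (α := Equiv.Perm (Fin 1)) _ _
    refine S.skew_of_derivedWord hx 1 0 (by rw [sgn_zero, one_smul]; rfl) ?_
    intro D hD; push_cast; clear hD; revert D; decide
  · have hσ : σ ∈ [⟨![0, 1], ![0, 1], by decide, by decide⟩,
      (⟨![1, 0], ![1, 0], by decide, by decide⟩ : Equiv.Perm (Fin 2))] := by revert σ; decide
    simp only [List.mem_cons, List.not_mem_nil, or_false] at hσ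
    rcases hσ with rfl | rfl
    · refine S.skew_of_derivedWord hx _ 0 (by rw [sgn_zero, one_smul]; rfl) ?_
      intro D hD; push_cast; clear hD; revert D; decide
    · refine S.skew_of_derivedWord hx _ _ (S.lie.right_comm hm (S.map_mem (hx 1))
        (S.map_mem (hx 0))) ?_
      intro D hD; push_cast; simp only [hD]; clear hD; revert D; decide
  · have hσ : σ ∈ [⟨![0, 1, 2], ![0, 1, 2], by decide, by decide⟩,
      ⟨![1, 0, 2], ![1, 0, 2], by decide, by decide⟩,
      ⟨![0, 2, 1], ![0, 2, 1], by decide, by decide⟩,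
      ⟨![1, 2, 0], ![2, 0, 1], by decide, by decide⟩,
      ⟨![2, 0, 1], ![1, 2, 0], by decide, by decide⟩,
      (⟨![2, 1, 0], ![2, 1, 0], by decide, by decide⟩ : Equiv.Perm (Fin 3))] := by
      revert σ; decide
    have h0 := S.map_mem (hx 0)
    have h1 := S.map_mem (hx 1)
    have h2 := S.map_mem (hx 2)
    have w10 := S.lie.right_comm hh h1 h0
    have w20 := S.lie.right_comm hh h2 h0
    have w21 := S.lie.right_comm (S.lie.mem hh h0) h2 h1
    have w120 := S.lie.right_comm₂ hh h1 h2 h0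
    have w210 := S.lie.right_comm₂ hh h2 h1 h0
    simp only [List.mem_cons, List.not_mem_nil, or_false] at hσ
    rcases hσ with rfl | rfl | rfl | rfl | rfl | rfl
    · refine S.skew_of_derivedWord hx _ 0 (by rw [sgn_zero, one_smul]; rfl) ?_
      intro D hD; push_cast; clear hD; revert D; decide +kernel
    · refine S.skew_of_derivedWord hx _ _ ((congrArg (fun y => B y (φ (x 2))) w10).trans
        (by rw [map_smul, LinearMap.smul_apply]; rfl)) ?_
      intro D hD; push_cast; simp only [hD]; clear hD; revert D; decide +kernel
    · refine S.skew_of_derivedWord hx _ _ w21 ?_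
      intro D hD; push_cast; simp only [hD]; clear hD; revert D; decide +kernel
    · refine S.skew_of_derivedWord hx _ _ w120 ?_
      intro D hD; push_cast; simp only [hD]; clear hD; revert D; decide +kernel
    · refine S.skew_of_derivedWord hx _ _ ((congrArg (fun y => B y (φ (x 1))) w20).trans
        (by rw [map_smul, LinearMap.smul_apply, w21, smul_smul, ← sgn_add]; rfl)) ?_
      intro D hD; push_cast; simp only [hD]; clear hD; revert D; decide +kernel
    · refine S.skew_of_derivedWord hx _ _ (w210.trans
        (by rw [w21, smul_smul, ← sgn_add]; rfl)) ?_
      intro D hD; push_cast; simp only [hD]; clear hD; revert D; decide +kernel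
  · rw [S.eq_zero _ (by omega), zero_apply, zero_apply, smul_zero]

end IsDerived

end DerivedSkew

/-! ### The integer grading of the cochain space -/

section Grading

variable {K : Type*} [Field K] {V W : Type*} [AddCommGroup V] [Module K V] [AddCommGroup W]
  [Module K W]

/-- The decomposition map sends each arity to the same nonnegative degree; the negative degrees are
zero and cause no obstruction. -/
theorem isInternal_degreePart : DirectSum.IsInternal (degreePart K V W) := by
  classical
  let f : CochSpace K V W →ₗ[K] ⨁ i, degreePart K V W i :=
    DirectSum.toModule K ℕ _ fun n => DirectSum.lof K ℤ (fun i => degreePart K V W i) n ∘ₗ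
      (single n).codRestrict (degreePart K V W n) (single_mem_degreePart n)
  have hf : ∀ n (g : Coch K V W n), f (single n g) =
      DirectSum.lof K ℤ (fun i => degreePart K V W i) n ⟨single n g, single_mem_degreePart n g⟩ :=
    fun n g => DirectSum.toModule_lof K n g
  let : DirectSum.Decomposition (degreePart K V W) :=
    DirectSum.Decomposition.ofLinearMap _ f
      (by
        refine DirectSum.linearMap_ext K fun n => LinearMap.ext fun g => ?_
        change DirectSum.coeLinearMap _ (f (single n g)) = single n g
        rw [hf, DirectSum.coeLinearMap_lof])
      (by
        refine DirectSum.linearMap_ext K fun i => LinearMap.ext fun ⟨y, hy⟩ => ?_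
        change f (DirectSum.coeLinearMap _ (DirectSum.lof K ℤ _ i ⟨y, hy⟩)) =
          DirectSum.lof K ℤ _ i ⟨y, hy⟩
        rw [DirectSum.coeLinearMap_lof]
        rcases degreePart_cases hy with rfl | ⟨n, g, rfl, rfl⟩
        · rw [map_zero]
          exact (map_zero _).symm
        · exact hf n g)
  exact DirectSum.Decomposition.isInternal _

/-- A trilinear map as an element of `Hom (V^{⊗ 3}, W)`. -/
def ofTrilinear (B : V →ₗ[K] V →ₗ[K] V →ₗ[K] W) : Coch K V W 3 :=
  MultilinearMap.mk' (fun x => B (x 0) (x 1) (x 2))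
    (fun x i a b => by fin_cases i <;> simp)
    (fun x i c a => by fin_cases i <;> simp)

end Grading

/-! ### The twisted structure maps and the `L_∞`-algebra -/

section Operations

variable {K A M : Type*} [Field K] [NonUnitalRing A] [Module K A] [IsScalarTower K A A]
  [SMulCommClass K A A] [AddCommGroup M] [Module K M]
local notation:70 x:70 "⋄" y:71 => gerstenhaber x y

variable (β : Bimod K A M) (H : A →ₗ[K] A →ₗ[K] M) (T : M →ₗ[K] A)

/-- The differential as a linear map. -/
def differentialHom : CochSpace K M A →ₗ[K] CochSpace K M A where
  toFun := β.differential H T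
  map_add' x y := by
    simp only [Bimod.differential, Bimod.bracket₂, bracket₃, map_add, smul_add]
    abel
  map_smul' c x := by
    simp only [Bimod.differential, Bimod.bracket₂, bracket₃, map_smul, RingHom.id_apply, smul_sub,
      smul_comm c (1 / 2 : K)]

/-- The binary operation as a bilinear map. -/
def twistedBracketHom : CochSpace K M A →ₗ[K] CochSpace K M A →ₗ[K] CochSpace K M A :=
  LinearMap.mk₂ K (twistedBracket₂ β H T)
    (fun x x' y => by
      simp only [twistedBracket₂, Bimod.bracket₂, bracket₃, map_add, LinearMap.add_apply]
      abel)
    (fun c x y => by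
      simp only [twistedBracket₂, Bimod.bracket₂, bracket₃, map_smul, LinearMap.smul_apply,
        smul_sub])
    (fun x y y' => by
      simp only [twistedBracket₂, Bimod.bracket₂, bracket₃, map_add]
      abel)
    (fun c x y => by
      simp only [twistedBracket₂, Bimod.bracket₂, bracket₃, map_smul, smul_sub])

/-- The structure maps of the twisted `L_∞`-algebra. -/
def twistedOp : (k : ℕ) →
    MultilinearMap K (fun _ : Fin k => CochSpace K M A) (CochSpace K M A)
  | 1 => MultilinearMap.ofSubsingleton K _ _ (0 : Fin 1) (differentialHom β H T)
  | 2 => ofBilinear (twistedBracketHom β H T)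
  | 3 => ofTrilinear (extend₃ (ternary H))
  | _ => 0

theorem twistedOp_eq_zero (k : ℕ) (hk : 4 ≤ k) : twistedOp β H T k = 0 := by
  obtain ⟨k, rfl⟩ := Nat.exists_eq_add_of_le' hk
  rfl

theorem twistedOp_mem (k : ℕ) (e : Fin k → ℤ) (x : Fin k → CochSpace K M A)
    (hx : ∀ a, x a ∈ degreePart K M A (e a)) :
    twistedOp β H T k x ∈ degreePart K M A (∑ a, e a + (2 - (k : ℤ))) := by
  rcases k with _ | _ | _ | _ | k
  · exact zero_mem _
  · have he : ∑ a : Fin 1, e a + (2 - ((1 : ℕ) : ℤ)) = e 0 + 1 := by simp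
    exact (congrArg (_ ∈ degreePart K M A ·) he).mpr (differential_mem β H T (hx 0))
  · have he : ∑ a : Fin 2, e a + (2 - ((2 : ℕ) : ℤ)) = e 0 + e 1 := by simp [Fin.sum_univ_two]
    exact (congrArg (_ ∈ degreePart K M A ·) he).mpr (twistedBracket₂_mem β H T (hx 0) (hx 1))
  · have he : ∑ a : Fin 3, e a + (2 - ((3 : ℕ) : ℤ)) = e 0 + e 1 + e 2 - 1 := by
      rw [Fin.sum_univ_three]; push_cast; ring
    exact (congrArg (_ ∈ degreePart K M A ·) he).mpr (bracket₃_mem H (hx 0) (hx 1) (hx 2))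
  · rw [twistedOp_eq_zero β H T _ (by omega)]
    exact zero_mem _

theorem lift_twistedOp (k : ℕ) (e : Fin k → ℤ) (x : Fin k → CochSpace K M A)
    (hx : ∀ a, x a ∈ degreePart K M A (e a)) (b : ℤ)
    (hb : (b : ZMod 2) = derivedExp k (fun a => (e a : ZMod 2))) :
    lift (twistedOp β H T k x) = sgn K b • derivedWord gerstenhaber (twistD β H T) (twistM β H T)
      (binary (extendH H)) k (fun a => lift (x a)) := by
  rcases k with _ | _ | _ | _ | k
  · exact (map_zero _).trans (smul_zero _).symm
  · rw [sgn_congr (b := 1) (hb.trans (by push_cast; rfl))]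
    exact lift_differential β H T (hx 0)
  · rw [sgn_congr (b := e 0) hb]
    exact lift_twistedBracket₂ β H T (hx 0) (hx 1)
  · rw [sgn_congr (b := e 1 + 1) (hb.trans (by push_cast; rfl))]
    exact lift_bracket₃ H (hx 0) (hx 1) (hx 2)
  · rw [twistedOp_eq_zero β H T _ (by omega)]
    exact (map_zero _).trans (smul_zero _).symm

theorem isDerived_twistedOp [CharZero K] (hH : β.IsTwoCocycle H) (hT : β.IsTwistedRB H T) :
    IsDerived (gerstenhaber (K := K) (V := A × M)) (bideg K A M) (lift (K := K) (A := A) (M := M))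
      (degreePart K M A) (twistedOp β H T) (twistD β H T) (twistM β H T)
      (binary (extendH H)) :=
  IsDerived.of_twist isWeightedLie_gerstenhaber lift_injective lift_mem_bideg
    (twistedOp_mem β H T) (lift_twistedOp β H T) (twistedOp_eq_zero β H T) (extendH_mem_bideg H)
    (mulLR_mem_bideg β) (lift_mem_bideg (ofLinear_mem T)) (extendH_extendH H)
    (extendH_mulLR β hH) (mulLR_mulLR β) ((isTwistedRB_iff β H T).1 hT)

/-- The twisted `L_∞`-algebra. -/
def twistedLInfinityAlgebra [CharZero K] (hH : β.IsTwoCocycle H) (hT : β.IsTwistedRB H T) :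
    LInfinityAlgebra K (degreePart K M A) where
  isInternal := isInternal_degreePart
  l := twistedOp β H T
  l_zero := rfl
  degree := twistedOp_mem β H T
  skew := (isDerived_twistedOp β H T hH hT).skew
  jacobi := (isDerived_twistedOp β H T hH hT).jacobi

end Operations

/-! ### Maurer-Cartan elements and deformations of `T` -/

section MaurerCartan

variable {K : Type*} [Field K] [CharZero K]

namespace IsDerived

variable {L E : Type*} [AddCommGroup L] [Module K L] [AddCommGroup E] [Module K E]
  {B : E →ₗ[K] E →ₗ[K] E} {W : ℤ → ℤ → Submodule K E} {φ : L →ₗ[K] E} {𝒜 : ℤ → Submodule K L}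
  {h μ t : E}

/-- The Taylor expansion `twistCurv_add` at the flat point `t` is compared with the Maurer-Cartan
sum, which has no terms outside arities one, two and three. -/
theorem isMaurerCartan_iff {𝓛 : LInfinityAlgebra K 𝒜}
    (S : IsDerived B W φ 𝒜 𝓛.l (twistZero B h μ t) (twistOne B h μ t) h) (hμ : μ ∈ W 1 2)
    (ht : t ∈ W (-1) 1) (hc : twistCurv B h μ t = 0) {α : L} (hα : α ∈ 𝒜 1) :
    𝓛.IsMaurerCartan α ↔ twistCurv B h μ (t + φ α) = 0 := by
  have hsub : ∀ f : ℕ → L, (∀ k, 𝓛.l k (fun _ => α) = 0 → f k = 0) →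
      Function.support f ⊆ (({1, 2, 3} : Finset ℕ) : Set ℕ) := fun f hf k hk => by
    by_contra hk'
    refine hk (hf k ?_)
    rcases k with _ | _ | _ | _ | k
    · rw [𝓛.l_zero, zero_apply]
    · simp at hk'
    · simp at hk'
    · simp at hk'
    · rw [S.eq_zero _ (by omega), zero_apply]
  have hfin : {k : ℕ | 𝓛.l k (fun _ => α) ≠ 0}.Finite :=
    (Finset.finite_toSet _).subset (hsub _ fun k hk => hk)
  -- On inputs of degree one, `l₁` and `l₂` are minus the iterated brackets and `l₃` is plus. With
  -- the coefficients `1`, `1/2`, `-1/6` the Maurer-Cartan sum is the negative of the Taylor terms,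
  -- which explains `neg_eq_zero` below.
  have h₁ := S.apply 1 (fun _ => 1) (fun _ => α) (fun _ => hα) 1 rfl
  have h₂ := S.apply 2 (fun _ => 1) (fun _ => α) (fun _ => hα) 1 rfl
  have h₃ := S.apply 3 (fun _ => 1) (fun _ => α) (fun _ => hα) 0 rfl
  rw [sgn_one] at h₁ h₂
  rw [sgn_zero, one_smul] at h₃
  rw [LInfinityAlgebra.IsMaurerCartan, and_iff_right hα, and_iff_right hfin,
    finsum_eq_sum_of_support_subset _ (hsub _ fun k hk => by rw [hk, smul_zero]),
    ← S.injective.eq_iff, S.lie.twistCurv_add S.mem_h hμ ht (S.map_mem hα), hc, zero_add, map_zero,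
    map_sum, Finset.sum_insert (by decide), Finset.sum_insert (by decide), Finset.sum_singleton,
    map_smul, map_smul, map_smul, h₁, h₂, h₃, ← neg_eq_zero]
  simp only [derivedWord, Nat.factorial]
  refine Eq.congr ?_ rfl
  norm_num
  module

end IsDerived

variable {A M : Type*} [NonUnitalRing A] [Module K A] [IsScalarTower K A A]
  [SMulCommClass K A A] [AddCommGroup M] [Module K M]

theorem ofLinear_add (T T' : M →ₗ[K] A) : ofLinear (T + T') = ofLinear T + ofLinear T' := by
  rw [ofLinear, ofLinear, ofLinear, ← map_add]
  rfl

theorem isTwistedRB_add_iff (β : Bimod K A M) (H : A →ₗ[K] A →ₗ[K] M) (T : M →ₗ[K] A)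
    (hH : β.IsTwoCocycle H) (hT : β.IsTwistedRB H T) (T' : M →ₗ[K] A) :
    β.IsTwistedRB H (T + T') ↔
      (twistedLInfinityAlgebra β H T hH hT).IsMaurerCartan (ofLinear T') := by
  rw [isTwistedRB_iff, ofLinear_add, map_add]
  exact (IsDerived.isMaurerCartan_iff (𝓛 := twistedLInfinityAlgebra β H T hH hT)
    (isDerived_twistedOp β H T hH hT) (mulLR_mem_bideg β) (lift_mem_bideg (ofLinear_mem T))
    ((isTwistedRB_iff β H T).1 hT) (ofLinear_mem T')).symm

end MaurerCartan

end TwistedRB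

end

theorem mainTheorem2 {K : Type*} [Field K] [CharZero K]
    {A : Type*} [NonUnitalRing A] [Module K A] [IsScalarTower K A A] [SMulCommClass K A A]
    {M : Type*} [AddCommGroup M] [Module K M] (β : TwistedRB.Bimod K A M)
    (H : A →ₗ[K] A →ₗ[K] M) (hH : β.IsTwoCocycle H)
    (T : M →ₗ[K] A) (hT : β.IsTwistedRB H T) :
    ∃ 𝓛 : TwistedRB.LInfinityAlgebra K (TwistedRB.degreePart K M A),
      (∀ P, 𝓛.l 1 ![P] = β.differential H T P) ∧
      (∀ P Q, 𝓛.l 2 ![P, Q] =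
        β.bracket₂ P Q - TwistedRB.bracket₃ H (TwistedRB.ofLinear T) P Q) ∧
      (∀ P Q R, 𝓛.l 3 ![P, Q, R] = TwistedRB.bracket₃ H P Q R) ∧
      (∀ k, 4 ≤ k → 𝓛.l k = 0) ∧
      ∀ T' : M →ₗ[K] A,
        β.IsTwistedRB H (T + T') ↔ 𝓛.IsMaurerCartan (TwistedRB.ofLinear T') :=
  ⟨TwistedRB.twistedLInfinityAlgebra β H T hH hT, fun _ => rfl, fun _ _ => rfl, fun _ _ _ => rfl,
    TwistedRB.twistedOp_eq_zero β H T, TwistedRB.isTwistedRB_add_iff β H T hH hT⟩
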